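/- Let $l>1$ be an odd integer, $\mathcal A=\mathbb Z[v,v^{-1}]$, let $\mathcal B$ be the quotient of $\mathbb Z[\tfrac12][v]$ by the ideal generated by the $l$-th cyclotomic polynomial, and let $q$ be the image of $v$ in $\mathcal B$; write $\mathbb Q(v)$, $\mathbb Q(q)$ for the fraction fields of $\mathcal A$, $\mathcal B$. Let $U_{\mathbb Q(v)}$ be the $\mathbb Q(v)$-algebra with generators $E,F,K^{\pm1}$ and relations $KK^{-1}=K^{-1}K=1$, $KE=v^2EK$, $KF=v^{-2}FK$, $EF-FE=\frac{K-K^{-1}}{v-v^{-1}}$. Put $[n]!=\prod_{k=1}^n\frac{v^k-v^{-k}}{v-v^{-1}}$, $E^{(n)}=E^n/[n]!$, $F^{(n)}=F^n/[n]!$, and $$\begin{bmatrix}K\\m\end{bmatrix}=\prod_{h=1}^m\frac{Kv^{1-h}-K^{-1}v^{h-1}}{v^h-v^{-h}}.$$ Let $U$ be the $\mathcal A$-subalgebra generated by $E^{(n)},F^{(n)}$ $(n\ge 0)$ and $K^{\pm1}$, and let $U_{\mathcal B}=U\otimes_{\mathcal A}\mathcal B$ and $U_q=U_{\mathcal B}\otimes_{\mathcal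 B}\mathbb Q(q)$. The element $\begin{bmatrix}K\\m\end{bmatrix}$ lies in $U$, and its image in $U_{\mathcal B}$ is denoted in the same way. The canonical map $U_{\mathcal B}\to U_q$ is injective, and $U_{\mathcal B}$ is identified with its image. Let $X,Y,H$ be the standard basis of $\mathfrak{sl}_2$ over $\mathbb Q$, let $X^{[n]}=X^n/n!$, $Y^{[n]}=Y^n/n!$, $\binom Hn=\frac{H(H-1)\cdots(H-n+1)}{n!}$ in its universal enveloping algebra, let $\mathbf U$ be the $\mathbb Z$-subalgebra generated by all $X^{[n]},Y^{[n]}$ (it contains all $\binom Hn$), and let $\mathbf U_{\mathcal B}=\mathbf U\otimes_{\mathbb Z}\mathcal B$. Let $\mathrm{Fr}:U_{\mathcal B}\to\mathbf U_{\mathcal B}$ be the quantum Frobenius morphism, that is, the homomorphism of unital $\mathcal B$-algebras, which exists and is unique, such that $\mathrm{Fr}(K^{\pm1})=1$ and, for all $n\ge0$, $\mathrm{Fr}(E^{(n)})=X^{[n/l]}$ and $\mathrm{Fr}(F^{(n)})=Y^{[n/l]}$ if $l\mid n$, and $\mathrm{Fr}(E^{(n)})=\mathrm{Fr}(F^{(n)})=0$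 otherwise. Then: (i) For every $j\in\mathbb Z$, the element $\kappa_j=\frac1{2l}\sum_{i=0}^{2l-1}q^{-2ji}K^i$ of $U_q$ belongs to $U_{\mathcal B}$. (ii) In $U_{\mathcal B}$, $$\kappa_0=\frac12\sum_{i=0}^{l-1}(-1)^i\begin{bmatrix}K\\i\end{bmatrix}(q^i+q^{-i}K).$$ (iii) Put $\kappa=\kappa_0$. There is a $\mathcal B$-linear multiplicative map (a not necessarily unital morphism of $\mathcal B$-algebras) $\phi:\mathbf U_{\mathcal B}\to U_{\mathcal B}$ such that, for all $i\ge0$, $$\phi(X^{[i]})=E^{(li)}\kappa,\quad \phi(Y^{[i]})=F^{(li)}\kappa,\quad \phi(1)=\kappa,\quad \phi\Big(\binom Hi\Big)=\begin{bmatrix}K\\li\end{bmatrix}\kappa .$$ It is the only $\mathcal B$-linear multiplicative map $\mathbf U_{\mathcal B}\to U_{\mathcal B}$ with these values on $1$ and on all $X^{[i]}$ and $Y^{[i]}$, and it splits the Frobenius morphism: $\mathrm{Fr}\circ\phi=\mathrm{id}_{\mathbf U_{\mathcal B}}$. -/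

import Mathlib

open scoped TensorProduct LaurentPolynomial

noncomputable section

namespace QuantumSl2

/-! ## Quantum `sl₂` over `ℚ(v)` and its integral form -/

/-- `𝒜 = ℤ[v, v⁻¹]`. -/
abbrev A : Type := ℤ[T;T⁻¹]

instance : IsDomain A := inferInstanceAs (IsDomain (AddMonoidAlgebra ℤ ℤ))

/-- `ℚ(v)`, the field of fractions of `𝒜`. -/
abbrev Qv : Type := FractionRing A

/-- The indeterminate `v`, viewed in `ℚ(v)`. -/
def v : Qv := algebraMap A Qv (LaurentPolynomial.T 1)

/-- The quantum integer `[n] = (vⁿ - v⁻ⁿ) / (v - v⁻¹)`. -/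
def qInt (n : ℕ) : Qv := (v ^ n - v⁻¹ ^ n) / (v - v⁻¹)

/-- The quantum factorial `[n]! = [1] [2] ⋯ [n]`. -/
def qFactorial (n : ℕ) : Qv := ∏ k ∈ Finset.Icc 1 n, qInt k

/-- Names of the generators. -/
inductive Gen : Type
  | E | F | K | Kinv

/-- The generator with a given name in the free algebra. -/
abbrev gen (g : Gen) : FreeAlgebra Qv Gen := FreeAlgebra.ι Qv g

/-- The defining relations of quantum `sl₂`. -/
inductive Rel : FreeAlgebra Qv Gen → FreeAlgebra Qv Gen → Prop
  | K_mul_Kinv : Rel (gen .K * gen .Kinv) 1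
  | Kinv_mul_K : Rel (gen .Kinv * gen .K) 1
  | K_mul_E : Rel (gen .K * gen .E) (v ^ 2 • (gen .E * gen .K))
  | K_mul_F : Rel (gen .K * gen .F) ((v ^ 2)⁻¹ • (gen .F * gen .K))
  | E_F : Rel (gen .E * gen .F - gen .F * gen .E) ((v - v⁻¹)⁻¹ • (gen .K - gen .Kinv))

/-- The quantum algebra of `sl₂` over `ℚ(v)`. -/
abbrev UQv : Type := RingQuot Rel

/-- The standard generators of the quantum algebra. -/
def stdGen (g : Gen) : UQv := RingQuot.mkAlgHom Qv Rel (gen g)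

/-- The divided power `E⁽ⁿ⁾ = Eⁿ / [n]!`. -/
def divE (n : ℕ) : UQv := (qFactorial n)⁻¹ • stdGen .E ^ n

/-- The divided power `F⁽ⁿ⁾ = Fⁿ / [n]!`. -/
def divF (n : ℕ) : UQv := (qFactorial n)⁻¹ • stdGen .F ^ n

/-- `[K; c, m] = ∏_{h=1}^{m} (K v^{c-h+1} - K⁻¹ v^{-(c-h+1)}) / (v^h - v^{-h})`
(the product over `h = i + 1` with `0 ≤ i < m`; the factors commute). -/
def torusBinom (c : ℤ) (m : ℕ) : UQv :=
  ((List.range m).map fun i : ℕ =>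
    (v ^ (i + 1) - v⁻¹ ^ (i + 1))⁻¹ •
      (v ^ (c - (i : ℤ)) • stdGen .K - v ^ (-(c - (i : ℤ))) • stdGen .Kinv)).prod

/-- The `𝒜`-form `U` with divided powers: the `𝒜`-subalgebra generated by all `E⁽ⁿ⁾`, `F⁽ⁿ⁾` and
`K^{±1}`. -/
def U : Subalgebra A UQv :=
  Algebra.adjoin A (Set.range divE ∪ Set.range divF ∪ {stdGen .K, stdGen .Kinv})

lemma divE_mem (n : ℕ) : divE n ∈ U :=
  Algebra.subset_adjoin (Or.inl (Or.inl ⟨n, rfl⟩))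

lemma divF_mem (n : ℕ) : divF n ∈ U :=
  Algebra.subset_adjoin (Or.inl (Or.inr ⟨n, rfl⟩))

lemma K_mem : stdGen .K ∈ U := Algebra.subset_adjoin (Or.inr (Or.inl rfl))

lemma Kinv_mem : stdGen .Kinv ∈ U := Algebra.subset_adjoin (Or.inr (Or.inr rfl))

/-! ## The ring `ℬ` and specialization at a root of unity -/

/-- `ℤ[1/2]`. -/
abbrev ZHalf : Type := Localization.Away (2 : ℤ)

/-- `ℬ`, the quotient of `ℤ[1/2][v]` by the ideal generated by the `l`-th cyclotomic polynomial. -/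
def B (l : ℕ) : Type := AdjoinRoot (Polynomial.cyclotomic l ZHalf)

instance (l : ℕ) : CommRing (B l) :=
  inferInstanceAs (CommRing (AdjoinRoot (Polynomial.cyclotomic l ZHalf)))

instance (l : ℕ) : Algebra ZHalf (B l) :=
  inferInstanceAs (Algebra ZHalf (AdjoinRoot (Polynomial.cyclotomic l ZHalf)))

/-- The class of `v` in `ℬ`. -/
def root (l : ℕ) : B l := AdjoinRoot.root (Polynomial.cyclotomic l ZHalf)

lemma root_pow (l : ℕ) : root l ^ l = 1 := by
  change AdjoinRoot.root (Polynomial.cyclotomic l ZHalf) ^ l = 1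
  have h : AdjoinRoot.mk (Polynomial.cyclotomic l ZHalf) (Polynomial.X ^ l - 1) = 0 :=
    AdjoinRoot.mk_eq_zero.2 (Polynomial.cyclotomic.dvd_X_pow_sub_one l ZHalf)
  simpa [sub_eq_zero] using h

instance isDomain_B (l : ℕ) [NeZero l] : IsDomain (B l) := by
  have h2 : Submonoid.powers (2 : ℤ) ≤ nonZeroDivisors ℤ :=
    powers_le_nonZeroDivisors_of_noZeroDivisors (by norm_num)
  have : IsDomain ZHalf := IsLocalization.isDomain_localization h2
  let f : ZHalf →+* ℚ := IsLocalization.lift (M := Submonoid.powers (2 : ℤ))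
    (g := Int.castRingHom ℚ) (by
      rintro ⟨_, n, rfl⟩
      simp)
  let _ : Algebra ZHalf ℚ := f.toAlgebra
  have : @IsScalarTower ℤ ZHalf ℚ Algebra.toSMul Algebra.toSMul Algebra.toSMul :=
    IsScalarTower.of_algebraMap_eq' (RingHom.ext_int _ _)
  have : IsFractionRing ZHalf ℚ :=
    IsFractionRing.isFractionRing_of_isDomain_of_isLocalization
      (Submonoid.powers (2 : ℤ)) ZHalf ℚ
  refine AdjoinRoot.isDomain_of_prime (Irreducible.prime ?_)
  rw [(Polynomial.cyclotomic.monic l ZHalf).irreducible_iff_irreducible_map_fraction_map (K := ℚ),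
    Polynomial.map_cyclotomic]
  exact Polynomial.cyclotomic.irreducible_rat (NeZero.pos l)

/-- `q`, the image of `v` in `ℬ`, as a unit. -/
def q (l : ℕ) [NeZero l] : (B l)ˣ :=
  Units.ofPowEqOne (root l) l (root_pow l) (NeZero.ne l)

/-- `ℬ` is an `𝒜`-algebra through `v ↦ q`. -/
instance algebraAB (l : ℕ) [NeZero l] : Algebra A (B l) :=
  (LaurentPolynomial.eval₂ (Int.castRingHom (B l)) (q l)).toAlgebra

/-- The element `1/2` of `ℬ`. -/
def half (l : ℕ) : B l :=
  algebraMap ZHalf (B l) (IsLocalization.Away.invSelf (2 : ℤ))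

/-- `ℚ(q)`, the field of fractions of `ℬ`. -/
abbrev Qq (l : ℕ) : Type := FractionRing (B l)

/-- `U_ℬ = U ⊗_𝒜 ℬ`. -/
abbrev UB (l : ℕ) [NeZero l] : Type := B l ⊗[A] U

/-- The image in `U_ℬ` of an element of `U`. -/
def toUB (l : ℕ) [NeZero l] (x : UQv) (hx : x ∈ U) : UB l := 1 ⊗ₜ[A] (⟨x, hx⟩ : U)

/-- `U_q = U_ℬ ⊗_ℬ ℚ(q)`. -/
abbrev Uq (l : ℕ) [NeZero l] : Type := Qq l ⊗[B l] UB l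

/-- The canonical map `U_ℬ → U_q`. -/
def toUq (l : ℕ) [NeZero l] : UB l →ₐ[B l] Uq l := Algebra.TensorProduct.includeRight

/-- `κ_j = (1/2l) ∑_{i=0}^{2l-1} q^{-2ji} K^i`, an element of `U_q`. -/
def kappa (l : ℕ) [NeZero l] (j : ℤ) : Uq l :=
  (1 / (2 * (l : Qq l))) • ∑ i ∈ Finset.range (2 * l),
    algebraMap (B l) (Qq l) ((q l ^ (-2 * j * (i : ℤ)) : (B l)ˣ) : B l) •
      toUq l (toUB l (stdGen .K) K_mem) ^ i

/-! ## The Kostant form of the enveloping algebra of `sl₂` -/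

/-- `sl₂` over `ℚ`. -/
abbrev sl2 : Type := LieAlgebra.SpecialLinear.sl (Fin 2) ℚ

/-- The enveloping algebra of `sl₂` over `ℚ`. -/
abbrev Env : Type := UniversalEnvelopingAlgebra ℚ sl2

/-- `X = !![0, 1; 0, 0]`. -/
def X : sl2 := ⟨!![0, 1; 0, 0], by
  simp [LieAlgebra.SpecialLinear.sl, Matrix.trace_fin_two]⟩

/-- `Y = !![0, 0; 1, 0]`. -/
def Y : sl2 := ⟨!![0, 0; 1, 0], by
  simp [LieAlgebra.SpecialLinear.sl, Matrix.trace_fin_two]⟩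

/-- `H = !![1, 0; 0, -1]`. -/
def H : sl2 := ⟨!![1, 0; 0, -1], by
  simp [LieAlgebra.SpecialLinear.sl, Matrix.trace_fin_two]⟩

/-- The divided power `X^{[n]} = Xⁿ / n!`. -/
def divX (n : ℕ) : Env := ((n.factorial : ℚ)⁻¹) • UniversalEnvelopingAlgebra.ι ℚ X ^ n

/-- The divided power `Y^{[n]} = Yⁿ / n!`. -/
def divY (n : ℕ) : Env := ((n.factorial : ℚ)⁻¹) • UniversalEnvelopingAlgebra.ι ℚ Y ^ n

/-- `binom(H, n) = H (H - 1) ⋯ (H - n + 1) / n!`. -/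
def binomH (n : ℕ) : Env :=
  ((n.factorial : ℚ)⁻¹) •
    ((List.range n).map fun i : ℕ => UniversalEnvelopingAlgebra.ι ℚ H - (i : Env)).prod

/-- The Kostant `ℤ`-form: the subring generated by all `X^{[n]}` and `Y^{[n]}`. -/
def Kostant : Subalgebra ℤ Env := Algebra.adjoin ℤ (Set.range divX ∪ Set.range divY)

lemma divX_mem (n : ℕ) : divX n ∈ Kostant := Algebra.subset_adjoin (Or.inl ⟨n, rfl⟩)

lemma divY_mem (n : ℕ) : divY n ∈ Kostant := Algebra.subset_adjoin (Or.inr ⟨n, rfl⟩)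

/-- The base change to `ℬ` of the Kostant form. -/
abbrev KostantB (l : ℕ) : Type := B l ⊗[ℤ] Kostant

/-- The image in the base change to `ℬ` of an element of the Kostant form. -/
def toKostantB (l : ℕ) (x : Env) (hx : x ∈ Kostant) : KostantB l := 1 ⊗ₜ[ℤ] (⟨x, hx⟩ : Kostant)

/-! ## The quantum Frobenius morphism -/

/-- The values on generators that characterize the quantum Frobenius morphism. -/
structure IsFrobenius (l : ℕ) [NeZero l] (Fr : UB l →ₐ[B l] KostantB l) : Prop where
  map_divE : ∀ n, Fr (toUB l (divE n) (divE_mem n)) =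
    if l ∣ n then toKostantB l (divX (n / l)) (divX_mem _) else 0
  map_divF : ∀ n, Fr (toUB l (divF n) (divF_mem n)) =
    if l ∣ n then toKostantB l (divY (n / l)) (divY_mem _) else 0
  map_K : Fr (toUB l (stdGen .K) K_mem) = 1
  map_Kinv : Fr (toUB l (stdGen .Kinv) Kinv_mem) = 1

end QuantumSl2

end

/-!
Quantum `sl₂` and the classical enveloping algebra are both instances of one framework,
`SlTwoDatum`: an algebra with elements `e`, `f` over a commutative torus, with its dual Verma modules.
In this framework the commutation formula `dE_mul_dF` for divided powers shows that the elements
`f⁽ᵃ⁾ t e⁽ᵇ⁾`, with `t` in an integral form of the torus, span a subalgebra, and the action on dual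
Verma modules shows that they are independent (`eq_zero_of_sum_dF_tor_dE`). For the quantum algebra the
integral form of the torus consists of the Laurent polynomials in `K` with values in `𝒜[ω]` at all
`K = ω vⁿ`, where `ω² = 1`; it has the basis `Kᵈ [K; 0, c]`, `d ∈ {0, 1}`. For the classical algebra it consists of the
integer-valued polynomials in `H`. So `U` and `𝐔` are free, with explicit bases (`exists_basis_U`,
`exists_basis_Kostant`), and `U_ℬ → U_q` is injective.

The quantum Frobenius morphism is constructed through the dual Verma modules. By Lucas' theorem
`bin_order_mul`, the divided powers of `U_ℬ` act on the vectors `e_{l n}` of the module of highest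
weight `l μ` as their supposed images act on the vectors `e_n` of the classical module of highest
weight `μ`. The pairs of elements of `U_ℬ` and `𝐔_ℬ` that act in the same way in this sense, for all
`μ`, form a subalgebra of the product. Since `𝐔_ℬ` acts faithfully (`KostantB_faithful`), this is the
graph of a morphism, which also sends `[K; 0, l c]` to `binom(H, c)`, and `[K; 0, m]` to `0` for `l ∤ m`.

Put `κ = ½ (1 + K) [K; -1, l - 1]`, an element of the integral torus over `ℬ`. The formula (ii) is a
telescoping sum (`IsTorusBinom.sum_eq`). At the root of unity, `l [K; -1, l - 1]` is, up to a power of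
`K`, the product of `K² - q^{2i}` for `0 < i < l`, whence `2 l κ = ∑ Kⁱ` over `0 ≤ i < 2 l`
(`order_mul_torusKappa`); substituting `q^{-2j} K` for `K` gives (i).

For (iii), `K κ = κ`, so that `[K; c, j] κ = 0` if `l ∣ c` and `l ∤ j` (`mul_torusKappa_eq_zero`).
Hence only the terms of index divisible by `l` survive in the commutation formula for
`E⁽ˡᵃ⁾ F⁽ˡᵇ⁾ κ`, and the elements `F⁽ˡᵃ⁾ [K; 0, l c] κ E⁽ˡᵇ⁾` span a multiplicatively closed submodule
(`mul_mem_splitRange`). Let `φ` be the linear map that sends the basis element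
`Y^{[a]} binom(H, c) X^{[b]}` of `𝐔_ℬ` to `F⁽ˡᵃ⁾ [K; 0, l c] κ E⁽ˡᵇ⁾`. Its range is this submodule and
`Fr ∘ φ = id`, because `Fr κ = 1`; so `φ` and `Fr` are inverse to each other on the range of `φ`, and
`φ` is multiplicative because `Fr` is (`splitLinear_mul`).
-/

open scoped TensorProduct LaurentPolynomial

noncomputable section

namespace QuantumSl2

open Finset

/-! ### Algebras with an `sl₂`-triple over a torus -/

/-- The common framework of quantum `sl₂` and of the classical enveloping algebra of `sl₂`.
The algebra `𝔘` is given with elements `e`, `f` and a commutative torus `T`; `num n` is the (quantum)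
integer `[n]`, `wt c` the element `[K; c] = (K vᶜ - K⁻¹ v⁻ᶜ) / (v - v⁻¹)` (classically `H + c`), and
`shift` the automorphism of the torus by which it moves past `e`. The characters `char μ` of the torus
are those of the integral weights, and `rep μ` is the dual Verma module of highest weight `μ`, on the
basis `(e_n)` where `e_n` has weight `μ - 2n`. -/
structure SlTwoDatum (k T 𝔘 : Type*) [Field k] [CommRing T] [Algebra k T] [Ring 𝔘] [Algebra k 𝔘] where
  num : ℤ → k
  num_zero : num 0 = 0
  num_one : num 1 = 1
  num_ne_zero : ∀ n : ℕ, num (n + 1) ≠ 0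
  wt : ℤ → T
  wt_rel : ∀ m t x, num (m - t) • wt (x - m) + num t • wt x = num m • wt (x - m + t)
  shift : T ≃ₐ[k] T
  shift_wt : ∀ c, shift (wt c) = wt (c + 2)
  tor : T →ₐ[k] 𝔘
  e : 𝔘
  f : 𝔘
  tor_mul_e : ∀ g, tor g * e = e * tor (shift g)
  tor_mul_f : ∀ g, tor (shift g) * f = f * tor g
  e_mul_f : e * f = f * e + tor (wt 0)
  char : ℤ → T →ₐ[k] k
  char_shift : ∀ μ g, char μ (shift g) = char (μ + 2) g
  char_wt : ∀ μ c, char μ (wt c) = num (μ + c)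
  char_dense : ∀ (N : ℕ) (g : T), (∀ μ : ℕ, N ≤ μ → char μ g = 0) → g = 0
  rep : ℤ → 𝔘 →ₐ[k] Module.End k (ℕ →₀ k)
  rep_e : ∀ μ n, rep μ e (Finsupp.single n 1) = num n • Finsupp.single (n - 1) 1
  rep_f : ∀ (μ : ℤ) (n : ℕ), rep μ f (Finsupp.single n 1) = num (μ - n) • Finsupp.single (n + 1) 1
  rep_tor : ∀ (μ : ℤ) (g : T) (n : ℕ),
    rep μ (tor g) (Finsupp.single n 1) = char (μ - 2 * n) g • Finsupp.single n 1

namespace SlTwoDatum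

variable {k T 𝔘 : Type*} [Field k] [CommRing T] [Algebra k T] [Ring 𝔘] [Algebra k 𝔘]
  (D : SlTwoDatum k T 𝔘)

/-- The factorial `[n]!`. -/
def fact (n : ℕ) : k := ∏ i ∈ range n, D.num (i + 1)

lemma fact_ne_zero (n : ℕ) : D.fact n ≠ 0 :=
  prod_ne_zero_iff.2 fun i _ => D.num_ne_zero i

lemma fact_succ (n : ℕ) : D.fact (n + 1) = D.fact n * D.num (n + 1) := by
  simp [fact, prod_range_succ]

@[simp] lemma fact_zero : D.fact 0 = 1 := by simp [fact]

/-- The divided power `e⁽ⁿ⁾`. -/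
def dE (n : ℕ) : 𝔘 := (D.fact n)⁻¹ • D.e ^ n

/-- The divided power `f⁽ⁿ⁾`. -/
def dF (n : ℕ) : 𝔘 := (D.fact n)⁻¹ • D.f ^ n

/-- The torus element `[K; c, m] = [K; c] [K; c - 1] ⋯ [K; c - m + 1] / [m]!`. -/
def tb (c : ℤ) (m : ℕ) : T := (D.fact m)⁻¹ • ∏ i ∈ range m, D.wt (c - i)

/-- The binomial coefficient `[x] [x - 1] ⋯ [x - m + 1] / [m]!` of an integer `x`. -/
def bin (x : ℤ) (m : ℕ) : k := (D.fact m)⁻¹ * ∏ i ∈ range m, D.num (x - i)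

@[simp] lemma dE_zero : D.dE 0 = 1 := by simp [dE]
@[simp] lemma dF_zero : D.dF 0 = 1 := by simp [dF]
@[simp] lemma tb_zero (c : ℤ) : D.tb c 0 = 1 := by simp [tb]
@[simp] lemma bin_zero (c : ℤ) : D.bin c 0 = 1 := by simp [bin]

lemma e_mul_dE (n : ℕ) : D.e * D.dE n = D.num (n + 1) • D.dE (n + 1) := by
  have := D.num_ne_zero n
  rw [dE, dE, fact_succ, mul_smul_comm, ← pow_succ', smul_smul, mul_inv]
  congr 1
  field_simp

lemma f_mul_dF (n : ℕ) : D.f * D.dF n = D.num (n + 1) • D.dF (n + 1) := by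
  have := D.num_ne_zero n
  rw [dF, dF, fact_succ, mul_smul_comm, ← pow_succ', smul_smul, mul_inv]
  congr 1
  field_simp

lemma dE_succ (n : ℕ) : D.dE (n + 1) = (D.num (n + 1))⁻¹ • (D.e * D.dE n) := by
  rw [e_mul_dE, smul_smul, inv_mul_cancel₀ (D.num_ne_zero n), one_smul]

lemma dF_succ (n : ℕ) : D.dF (n + 1) = (D.num (n + 1))⁻¹ • (D.f * D.dF n) := by
  rw [f_mul_dF, smul_smul, inv_mul_cancel₀ (D.num_ne_zero n), one_smul]

lemma num_smul_tb_right (c : ℤ) (m : ℕ) :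
    D.num (m + 1) • D.tb c (m + 1) = D.tb c m * D.wt (c - m) := by
  have := D.num_ne_zero m
  rw [tb, tb, fact_succ, prod_range_succ, smul_smul, smul_mul_assoc, mul_inv]
  congr 1
  field_simp

lemma num_smul_tb_left (c : ℤ) (m : ℕ) :
    D.num (m + 1) • D.tb (c + 1) (m + 1) = D.wt (c + 1) * D.tb c m := by
  have := D.num_ne_zero m
  rw [tb, tb, fact_succ, prod_range_succ', smul_smul, mul_smul_comm, mul_inv, mul_comm (D.wt _)]
  congr 1
  · field_simp
  · congr 1
    · exact prod_congr rfl fun i _ => by congr 1; push_cast; ring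
    · simp

lemma char_tb (μ c : ℤ) (m : ℕ) : D.char μ (D.tb c m) = D.bin (μ + c) m := by
  simp [tb, bin, D.char_wt, add_sub_assoc]

lemma shift_tb (c : ℤ) (m : ℕ) : D.shift (D.tb c m) = D.tb (c + 2) m := by
  simp only [tb, map_smul, map_prod, D.shift_wt]
  congr 1
  exact prod_congr rfl fun i _ => by congr 1; ring

lemma e_mul_tor_tb (c : ℤ) (m : ℕ) : D.e * D.tor (D.tb c m) = D.tor (D.tb (c - 2) m) * D.e := by
  rw [D.tor_mul_e, shift_tb, sub_add_cancel]

lemma tor_mul_dF (g : T) (n : ℕ) :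
    D.tor ((D.shift : T → T)^[n] g) * D.dF n = D.dF n * D.tor g := by
  induction n generalizing g with
  | zero => simp
  | succ n ih =>
    rw [dF_succ, mul_smul_comm, smul_mul_assoc, Function.iterate_succ_apply', ← mul_assoc,
      D.tor_mul_f, mul_assoc, ih, mul_assoc]

lemma tor_mul_dE (g : T) (n : ℕ) :
    D.tor g * D.dE n = D.dE n * D.tor ((D.shift : T → T)^[n] g) := by
  induction n generalizing g with
  | zero => simp
  | succ n ih =>
    rw [dE_succ, mul_smul_comm, smul_mul_assoc, Function.iterate_succ_apply, ← mul_assoc,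
      D.tor_mul_e, mul_assoc, ih, mul_assoc]

lemma e_mul_f_pow (n : ℕ) :
    D.e * D.f ^ (n + 1) = D.f ^ (n + 1) * D.e + D.num (n + 1) • (D.f ^ n * D.tor (D.wt (-n))) := by
  induction n with
  | zero => simp [D.e_mul_f, D.num_one]
  | succ n ih =>
    have h1 : D.tor (D.wt (-n)) * D.f = D.f * D.tor (D.wt (-n - 2)) := by
      rw [← D.tor_mul_f, D.shift_wt, sub_add_cancel]
    have h2 := D.wt_rel (n + 2) 1 0
    rw [show (n + 2 - 1 : ℤ) = n + 1 by ring, D.num_one, one_smul,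
      show (0 - (n + 2) : ℤ) = -n - 2 by ring, show (-n - 2 + 1 : ℤ) = -(n + 1) by ring] at h2
    rw [pow_succ, ← mul_assoc, ih, add_mul, smul_mul_assoc, mul_assoc _ D.e, D.e_mul_f, mul_assoc _ _ D.f,
      h1, ← mul_assoc (D.f ^ n), ← pow_succ, mul_add, ← mul_assoc, ← pow_succ, add_assoc]
    congr 1
    push_cast
    rw [show (n + 1 + 1 : ℤ) = n + 2 by ring, ← mul_smul_comm _ (D.f ^ _) , ← mul_smul_comm _ (D.f ^ _),
      ← mul_add, ← map_smul, ← map_smul, ← map_add, ← h2, add_comm (D.wt 0)]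

lemma _root_.Finset.sum_add_sum_eq_sum_succ {M : Type*} [AddCommGroup M] {n : ℕ} {x y z : ℕ → M}
    (hx : x n = 0) (h0 : x 0 = z 0) (h : ∀ t, x (t + 1) + y t = z (t + 1)) :
    ∑ t ∈ range n, x t + ∑ t ∈ range n, y t = ∑ t ∈ range (n + 1), z t := by
  have h1 := sum_range_succ x n
  rw [hx, add_zero, sum_range_succ'] at h1
  rw [← h1, sum_range_succ', ← h0, add_right_comm, ← sum_add_distrib, sum_congr rfl fun t _ => h t]

/-- Divided powers with integral index, zero for negative index. -/
def zE (n : ℤ) : 𝔘 := if n < 0 then 0 else D.dE n.toNat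

/-- Divided powers with integral index, zero for negative index. -/
def zF (n : ℤ) : 𝔘 := if n < 0 then 0 else D.dF n.toNat

@[simp] lemma zE_natCast (n : ℕ) : D.zE n = D.dE n := by simp [zE]
@[simp] lemma zF_natCast (n : ℕ) : D.zF n = D.dF n := by simp [zF]
lemma zE_of_neg {n : ℤ} (h : n < 0) : D.zE n = 0 := if_pos h
lemma zF_of_neg {n : ℤ} (h : n < 0) : D.zF n = 0 := if_pos h

lemma e_mul_zE (n : ℤ) : D.e * D.zE n = D.num (n + 1) • D.zE (n + 1) := by
  rcases lt_trichotomy n (-1) with h | rfl | h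
  · rw [zE_of_neg _ (by omega), zE_of_neg _ (by omega)]; simp
  · rw [zE_of_neg _ (by omega)]; simp [D.num_zero]
  · lift n to ℕ using by omega
    rw [zE_natCast, e_mul_dE]
    exact_mod_cast rfl

lemma e_mul_zF (n : ℤ) : D.e * D.zF n = D.zF n * D.e + D.zF (n - 1) * D.tor (D.wt (1 - n)) := by
  rcases lt_trichotomy n 0 with h | rfl | h
  · rw [zF_of_neg _ (by omega), zF_of_neg _ (by omega)]; simp
  · rw [zF_of_neg _ (by omega : (0 : ℤ) - 1 < 0), ← Nat.cast_zero, zF_natCast]; simp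
  · lift n to ℕ using by omega
    obtain ⟨n, rfl⟩ : ∃ m, n = m + 1 := ⟨n - 1, by omega⟩
    have := D.num_ne_zero n
    have := D.fact_ne_zero n
    rw [zF_natCast, show ((n + 1 : ℕ) : ℤ) - 1 = (n : ℕ) by push_cast; ring, zF_natCast, dF, dF,
      mul_smul_comm, e_mul_f_pow, smul_add, smul_mul_assoc, smul_mul_assoc, smul_smul, fact_succ,
      show (1 - ((n + 1 : ℕ) : ℤ)) = -n by push_cast; ring]
    congr 2
    field_simp

/-- The commutation formula `e⁽ᵃ⁾ f⁽ᵇ⁾ = ∑ₜ f⁽ᵇ⁻ᵗ⁾ [K; 2t - a - b, t] e⁽ᵃ⁻ᵗ⁾`. -/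
theorem dE_mul_dF (a b : ℕ) :
    D.dE a * D.dF b = ∑ t ∈ range (a + 1),
      D.zF (b - t) * D.tor (D.tb (2 * t - a - b) t) * D.zE (a - t) := by
  induction a with
  | zero =>
    have h : D.zE 0 = 1 := by simpa using D.zE_natCast 0
    simp [h]
  | succ a ih =>
    have key : ∀ t : ℕ, D.e * (D.zF (b - t) * D.tor (D.tb (2 * t - a - b) t) * D.zE (a - t)) =
        D.num (a - t + 1) • (D.zF (b - t) * D.tor (D.tb (2 * t - a - b - 2) t) * D.zE (a - t + 1)) +
        D.zF (b - t - 1) * D.tor (D.wt (1 - (b - t)) * D.tb (2 * t - a - b) t) * D.zE (a - t) := by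
      intro t
      rw [← mul_assoc, ← mul_assoc, e_mul_zF, add_mul, add_mul, mul_assoc _ D.e, e_mul_tor_tb,
        ← mul_assoc, mul_assoc _ D.e, e_mul_zE, mul_smul_comm, map_mul]
      simp only [mul_assoc]
    have hs : ∀ (c : k) (x : 𝔘) (g : T) (y : 𝔘), c • (x * D.tor g * y) = x * D.tor (c • g) * y :=
      fun c x g y => by rw [map_smul, mul_smul_comm, smul_mul_assoc]
    rw [dE_succ, smul_mul_assoc, mul_assoc, ih, mul_sum, sum_congr rfl fun t _ => key t,
      sum_add_distrib, inv_smul_eq_iff₀ (D.num_ne_zero a), smul_sum]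
    refine sum_add_sum_eq_sum_succ ?_ ?_ fun t => ?_
    · simp [D.num_zero]
    · simp
    · have h := D.num_smul_tb_left (2 * t - a - b) t
      have h' := D.num_smul_tb_right (2 * t - a - b) t
      have h2 := D.wt_rel (a + 1) (t + 1) (t + 1 - b)
      rw [show (b : ℤ) - (t + 1 : ℕ) = b - t - 1 by push_cast; ring,
        show (a : ℤ) - (t + 1 : ℕ) + 1 = a - t by push_cast; ring,
        show ((a + 1 : ℕ) : ℤ) - (t + 1 : ℕ) = a - t by push_cast; ring,
        show 2 * ((t + 1 : ℕ) : ℤ) - a - b - 2 = 2 * t - a - b by push_cast; ring,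
        show 2 * ((t + 1 : ℕ) : ℤ) - (a + 1 : ℕ) - b = 2 * t - a - b + 1 by push_cast; ring,
        hs, hs, ← add_mul, ← mul_add, ← map_add]
      congr 3
      have h3 := D.num_ne_zero t
      apply smul_right_injective _ h3
      simp only [smul_add]
      rw [smul_comm, h', smul_comm, h, mul_comm (D.tb _ _), ← smul_mul_assoc, ← smul_mul_assoc,
        ← smul_mul_assoc, ← add_mul]
      congr 1
      convert h2 using 3 <;> ring_nf

end SlTwoDatum

/-! ### Dual Verma modules and triangular decomposition -/

namespace SlTwoDatum

variable {k T 𝔘 : Type*} [Field k] [CommRing T] [Algebra k T] [Ring 𝔘] [Algebra k 𝔘]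
  (D : SlTwoDatum k T 𝔘)

lemma num_mul_bin_right (x : ℤ) (m : ℕ) :
    D.num (m + 1) * D.bin x (m + 1) = D.bin x m * D.num (x - m) := by
  have := D.num_ne_zero m
  rw [bin, bin, fact_succ, prod_range_succ, mul_inv]
  field_simp

lemma num_mul_bin_left (x : ℤ) (m : ℕ) :
    D.num (m + 1) * D.bin (x + 1) (m + 1) = D.num (x + 1) * D.bin x m := by
  have := D.num_ne_zero m
  have h : ∏ i ∈ range m, D.num (x + 1 - (i + 1 : ℕ)) = ∏ i ∈ range m, D.num (x - i) :=
    prod_congr rfl fun i _ => by congr 1; push_cast; ring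
  rw [bin, bin, fact_succ, prod_range_succ', mul_inv, h]
  field_simp
  simp

lemma bin_natCast_of_lt {n m : ℕ} (h : n < m) : D.bin n m = 0 := by
  rw [bin, prod_eq_zero (mem_range.2 h) (by simp [D.num_zero]), mul_zero]

lemma bin_natCast_ne_zero {n m : ℕ} (h : m ≤ n) : D.bin n m ≠ 0 := by
  refine mul_ne_zero (inv_ne_zero (D.fact_ne_zero m)) (prod_ne_zero_iff.2 fun i hi => ?_)
  have hi := mem_range.1 hi
  rw [show (n : ℤ) - i = ((n - i - 1 : ℕ) : ℤ) + 1 by omega]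
  exact D.num_ne_zero _

lemma bin_self (n : ℕ) : D.bin n n = 1 := by
  induction n with
  | zero => simp
  | succ n ih =>
    have h := D.num_mul_bin_left n n
    rw [ih] at h
    exact mul_left_cancel₀ (D.num_ne_zero n) (by exact_mod_cast h)

lemma dE_mul_dE (a b : ℕ) : D.dE a * D.dE b = D.bin (a + b) a • D.dE (a + b) := by
  induction a with
  | zero => simp
  | succ a ih =>
    have h := D.num_mul_bin_left (a + b) a
    rw [dE_succ, smul_mul_assoc, mul_assoc, ih, mul_smul_comm, e_mul_dE,
      inv_smul_eq_iff₀ (D.num_ne_zero a), smul_smul, smul_smul, show a + 1 + b = a + b + 1 by ring]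
    push_cast
    rw [show (a + 1 + b : ℤ) = a + b + 1 by ring, h, mul_comm]

lemma dF_mul_dF (a b : ℕ) : D.dF a * D.dF b = D.bin (a + b) a • D.dF (a + b) := by
  induction a with
  | zero => simp
  | succ a ih =>
    have h := D.num_mul_bin_left (a + b) a
    rw [dF_succ, smul_mul_assoc, mul_assoc, ih, mul_smul_comm, f_mul_dF,
      inv_smul_eq_iff₀ (D.num_ne_zero a), smul_smul, smul_smul, show a + 1 + b = a + b + 1 by ring]
    push_cast
    rw [show (a + 1 + b : ℤ) = a + b + 1 by ring, h, mul_comm]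

lemma rep_dE (μ : ℤ) (b n : ℕ) :
    D.rep μ (D.dE b) (Finsupp.single n 1) = D.bin n b • Finsupp.single (n - b) 1 := by
  induction b with
  | zero => simp
  | succ b ih =>
    rw [dE_succ, map_smul, map_mul, LinearMap.smul_apply, Module.End.mul_apply, ih, map_smul, D.rep_e,
      inv_smul_eq_iff₀ (D.num_ne_zero b), smul_smul, smul_smul, num_mul_bin_right, Nat.sub_sub]
    rcases le_or_gt b n with h | h
    · rw [Nat.cast_sub h]
    · simp [D.bin_natCast_of_lt h]

lemma rep_dF (μ : ℤ) (a n : ℕ) :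
    D.rep μ (D.dF a) (Finsupp.single n 1) = D.bin (μ - n) a • Finsupp.single (n + a) 1 := by
  induction a with
  | zero => simp
  | succ a ih =>
    rw [dF_succ, map_smul, map_mul, LinearMap.smul_apply, Module.End.mul_apply, ih, map_smul, D.rep_f,
      inv_smul_eq_iff₀ (D.num_ne_zero a), smul_smul, smul_smul, num_mul_bin_right, add_assoc]
    push_cast
    rw [sub_sub]

/-- The action on dual Verma modules of a combination of the elements `f⁽ᵃ⁾ t e⁽ᵇ⁾` determines its
coefficients `t p`, given as functions of the weight. Applied to `e_b` with `b` minimal, only the terms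
`f⁽ᵃ⁾ t e⁽ᵇ⁾` with this `b` survive, and they send `e_b` to multiples of different basis vectors. -/
lemma _root_.QuantumSl2.coeff_eq_zero_of_verma_action {R : Type*} [CommRing R] (s : Finset (ℕ × ℕ))
    (t : ℕ × ℕ → ℤ → R) (β : ℤ → ℕ → R) (hβ : ∀ n b : ℕ, n < b → β n b = 0) (hβ1 : ∀ n : ℕ, β n n = 1)
    (hd : ∀ p ∈ s, (∀ μ : ℕ, p.1 ≤ μ → t p μ * β μ p.1 = 0) → ∀ μ, t p μ = 0)
    (hs : ∀ (μ : ℤ) (n : ℕ), ∑ p ∈ s,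
      (β n p.2 * t p (μ - 2 * (n - p.2 : ℕ)) * β (μ - (n - p.2 : ℕ)) p.1) •
        Finsupp.single (n - p.2 + p.1) (1 : R) = 0) :
    ∀ p ∈ s, ∀ μ, t p μ = 0 := by
  suffices H : ∀ b : ℕ, ∀ p ∈ s, p.2 = b → ∀ μ, t p μ = 0 from fun p hp => H _ p hp rfl
  intro b
  induction b using Nat.strong_induction_on with
  | _ b ih =>
    rintro ⟨a, b⟩ hp rfl
    refine hd _ hp fun μ hμ => ?_
    have h := DFunLike.congr_fun (hs μ b) a
    rw [Finsupp.finsetSum_apply, sum_eq_single (a, b)] at h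
    · simpa [hβ1] using h
    · rintro ⟨a', b'⟩ hp' hne
      rcases lt_trichotomy b' b with hb | rfl | hb
      · simp [ih b' hb _ hp' rfl]
      · have : a' ≠ a := fun h => hne (by rw [h])
        simp [this]
      · simp [hβ _ _ hb]
    · exact fun h => absurd hp h

lemma rep_dF_tor_dE (μ : ℤ) (a b n : ℕ) (g : T) :
    D.rep μ (D.dF a * D.tor g * D.dE b) (Finsupp.single n 1) =
      (D.bin n b * D.char (μ - 2 * (n - b : ℕ)) g * D.bin (μ - (n - b : ℕ)) a) •
        Finsupp.single (n - b + a) 1 := by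
  rw [map_mul, map_mul, Module.End.mul_apply, rep_dE, map_smul, Module.End.mul_apply, D.rep_tor,
    map_smul, rep_dF, smul_smul, smul_smul]

/-- The elements `f⁽ᵃ⁾ t e⁽ᵇ⁾` are independent over the torus. -/
theorem eq_zero_of_sum_dF_tor_dE (x : ℕ × ℕ →₀ T)
    (hx : (x.sum fun p g => D.dF p.1 * D.tor g * D.dE p.2) = 0) : x = 0 := by
  have h := coeff_eq_zero_of_verma_action x.support (fun p μ => D.char μ (x p)) D.bin
    (fun n b => D.bin_natCast_of_lt) D.bin_self (fun p _ h => by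
      have : x p = 0 := D.char_dense p.1 _ fun μ hμ =>
        (mul_eq_zero.1 (h μ hμ)).resolve_right (D.bin_natCast_ne_zero hμ)
      simp [this]) (fun μ n => by
      have := congr_arg (fun y => D.rep μ y (Finsupp.single n 1)) hx
      simpa only [Finsupp.sum, map_sum, LinearMap.sum_apply, rep_dF_tor_dE, map_zero,
        LinearMap.zero_apply] using this)
  ext p
  by_cases hp : p ∈ x.support
  · exact D.char_dense 0 _ fun μ _ => h p hp μ
  · simpa using hp

end SlTwoDatum

/-- The span of the products `F a * x * E b` with `x` in a multiplicative submodule `P` is closed under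
multiplication as soon as every `E a * F b * x` lies in it. -/
lemma mul_mem_span_triangular {R 𝔘 : Type*} [CommRing R] [Ring 𝔘] [Algebra R 𝔘] {E F : ℕ → 𝔘}
    {P : Submodule R 𝔘} (hE : ∀ a b, ∃ r : R, E a * E b = r • E (a + b))
    (hF : ∀ a b, ∃ r : R, F a * F b = r • F (a + b)) (hP : ∀ x ∈ P, ∀ y ∈ P, x * y ∈ P)
    (hPF : ∀ n, ∀ x ∈ P, ∃ y ∈ P, x * F n = F n * y)
    (hEF : ∀ a b, ∀ x ∈ P,
      E a * F b * x ∈ Submodule.span R {z | ∃ a, ∃ y ∈ P, ∃ b, z = F a * y * E b})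
    {z w : 𝔘} (hz : z ∈ Submodule.span R {z | ∃ a, ∃ y ∈ P, ∃ b, z = F a * y * E b})
    (hw : w ∈ Submodule.span R {z | ∃ a, ∃ y ∈ P, ∃ b, z = F a * y * E b}) :
    z * w ∈ Submodule.span R {z | ∃ a, ∃ y ∈ P, ∃ b, z = F a * y * E b} := by
  set W := Submodule.span R {z | ∃ a, ∃ y ∈ P, ∃ b, z = F a * y * E b} with hW
  have hWE : ∀ d, ∀ u ∈ W, u * E d ∈ W := by
    intro d u hu
    induction hu using Submodule.span_induction with
    | mem u hu =>
      obtain ⟨a, y, hy, b, rfl⟩ := hu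
      obtain ⟨r, hr⟩ := hE b d
      rw [mul_assoc, hr, mul_smul_comm]
      exact W.smul_mem _ (Submodule.subset_span ⟨_, y, hy, _, rfl⟩)
    | zero => simp
    | add u v _ _ hu hv => rw [add_mul]; exact W.add_mem hu hv
    | smul r u _ hu => rw [smul_mul_assoc]; exact W.smul_mem _ hu
  have hFW : ∀ a, ∀ x ∈ P, ∀ u ∈ W, F a * x * u ∈ W := by
    intro c x hx u hu
    induction hu using Submodule.span_induction with
    | mem u hu =>
      obtain ⟨a, y, hy, b, rfl⟩ := hu
      obtain ⟨r, hr⟩ := hF c a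
      obtain ⟨x', hx', h⟩ := hPF a x hx
      have : F c * x * (F a * y * E b) = r • (F (c + a) * (x' * y) * E b) := by
        rw [show F c * x * (F a * y * E b) = F c * (x * F a) * y * E b by simp only [mul_assoc], h,
          ← mul_assoc, hr]
        simp only [smul_mul_assoc, mul_assoc]
      rw [this]
      exact W.smul_mem _ (Submodule.subset_span ⟨_, _, hP _ hx' _ hy, _, rfl⟩)
    | zero => simp
    | add u v _ _ hu hv => rw [mul_add]; exact W.add_mem hu hv
    | smul r u _ hu => rw [mul_smul_comm]; exact W.smul_mem _ hu
  induction hz using Submodule.span_induction with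
  | zero => simp
  | add u v _ _ hu hv => rw [add_mul]; exact W.add_mem hu hv
  | smul r u _ hu => rw [smul_mul_assoc]; exact W.smul_mem _ hu
  | mem z hz =>
    induction hw using Submodule.span_induction with
    | zero => simp
    | add u v _ _ hu hv => rw [mul_add]; exact W.add_mem hu hv
    | smul r u _ hu => rw [mul_smul_comm]; exact W.smul_mem _ hu
    | mem w hw =>
      obtain ⟨a, x, hx, b, rfl⟩ := hz
      obtain ⟨c, y, hy, d, rfl⟩ := hw
      rw [show F a * x * E b * (F c * y * E d) = F a * x * (E b * F c * y) * E d by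
        simp only [mul_assoc]]
      exact hWE _ _ (hFW _ _ hx _ (hEF _ _ _ hy))

namespace SlTwoDatum

variable {k T 𝔘 : Type*} [Field k] [CommRing T] [Algebra k T] [Ring 𝔘] [Algebra k 𝔘]
  (D : SlTwoDatum k T 𝔘)

/-! ### Integral forms -/

/-- Binomial coefficients are integral if they satisfy an integral Pascal rule. -/
lemma bin_mem_range {R : Type*} [CommRing R] [Algebra R k] (h : ∀ (x : ℤ) (m : ℕ), ∃ (r : Rˣ) (s : R),
      D.bin (x + 1) (m + 1) = (r : R) • D.bin x (m + 1) + s • D.bin x m) (x : ℤ) (m : ℕ) :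
    ∃ r : R, algebraMap R k r = D.bin x m := by
  induction m generalizing x with
  | zero => exact ⟨1, by simp⟩
  | succ m ih =>
    induction x using Int.induction_on with
    | zero => exact ⟨0, by simpa using (D.bin_natCast_of_lt (Nat.succ_pos m)).symm⟩
    | succ x ih' =>
      obtain ⟨r, s, h⟩ := h x m
      obtain ⟨y, hy⟩ := ih x
      obtain ⟨z, hz⟩ := ih'
      exact ⟨r * z + s * y, by simp [h, hy, hz, Algebra.smul_def]⟩
    | pred x ih' =>
      obtain ⟨r, s, h⟩ := h (-x - 1) m
      obtain ⟨y, hy⟩ := ih (-x - 1)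
      obtain ⟨z, hz⟩ := ih'
      refine ⟨(r⁻¹ : Rˣ) * (z - s * y), ?_⟩
      rw [sub_add_cancel] at h
      rw [map_mul, map_sub, map_mul, hy, hz, h, Algebra.smul_def, Algebra.smul_def, add_sub_cancel_right,
        ← mul_assoc, ← map_mul, Units.inv_mul, map_one, one_mul]

section IntegralForm

variable {R : Type*} [CommRing R] [Algebra R k] [Algebra R T] [Algebra R 𝔘] [IsScalarTower R k 𝔘]
  [IsScalarTower R k T]

/-- The top term of the commutation formula for `e⁽ᵐ⁾ f⁽ᵐ⁾` and a Pascal rule put the elements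
`[K; c, m]` into every subalgebra that contains the divided powers. -/
lemma tor_tb_mem {V : Subalgebra R 𝔘} (hE : ∀ n, D.dE n ∈ V) (hF : ∀ n, D.dF n ∈ V)
    (h : ∀ (c : ℤ) (m : ℕ), ∃ (r : Rˣ) (x : T), D.tor x ∈ V ∧
      D.tb (c + 1) (m + 1) = (r : R) • D.tb c (m + 1) + x * D.tb c m) (c : ℤ) (m : ℕ) :
    D.tor (D.tb c m) ∈ V := by
  have htor : ∀ (r : R) (x : T), D.tor (r • x) = r • D.tor x := fun r x =>
    (D.tor.restrictScalars R).toLinearMap.map_smul r x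
  have hzE : ∀ n, D.zE n ∈ V := fun n => by unfold zE; split_ifs; exacts [V.zero_mem, hE _]
  have hzF : ∀ n, D.zF n ∈ V := fun n => by unfold zF; split_ifs; exacts [V.zero_mem, hF _]
  induction m using Nat.strong_induction_on generalizing c with
  | _ m ih =>
    rcases m with _ | m
    · simpa using V.one_mem
    induction c using Int.induction_on with
    | zero =>
      have h := D.dE_mul_dF (m + 1) (m + 1)
      rw [sum_range_succ, ← sub_eq_iff_eq_add'] at h
      have h0 : D.zE 0 = 1 := by simpa using D.zE_natCast 0
      have h0' : D.zF 0 = 1 := by simpa using D.zF_natCast 0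
      rw [sub_self, show (2 * ((m + 1 : ℕ) : ℤ) - (m + 1 : ℕ) - (m + 1 : ℕ)) = 0 by omega, h0, h0',
        one_mul, mul_one] at h
      rw [← h]
      exact V.sub_mem (V.mul_mem (hE _) (hF _)) (V.sum_mem fun t ht =>
        V.mul_mem (V.mul_mem (hzF _) (ih t (mem_range.1 ht) _)) (hzE _))
    | succ x ih' =>
      obtain ⟨r, y, hy, h⟩ := h x m
      rw [h, map_add, htor, map_mul]
      exact V.add_mem (V.smul_mem ih' _) (V.mul_mem hy (ih m (Nat.lt_succ_self m) _))
    | pred x ih' =>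
      obtain ⟨r, y, hy, h⟩ := h (-x - 1) m
      rw [sub_add_cancel, ← sub_eq_iff_eq_add] at h
      have : D.tb (-x - 1) (m + 1) = ((r⁻¹ : Rˣ) : R) • (D.tb (-x) (m + 1) - y * D.tb (-x - 1) m) := by
        rw [h, smul_smul, Units.inv_mul, one_smul]
      rw [this, htor, map_sub, map_mul]
      exact V.smul_mem (V.sub_mem ih' (V.mul_mem hy (ih m (Nat.lt_succ_self m) _))) _

/-- The `R`-span of the elements `f⁽ᵃ⁾ t e⁽ᵇ⁾` with `t` in an integral form `P` of the torus. -/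
def form (P : Subalgebra R T) : Submodule R 𝔘 :=
  Submodule.span R {z | ∃ a, ∃ y ∈ P.toSubmodule.map (D.tor.restrictScalars R).toLinearMap, ∃ b,
    z = D.dF a * y * D.dE b}

variable {D} in
/-- The conditions on an integral form `P` of the torus under which `D.form P` is an algebra. -/
structure IsIntegral (D : SlTwoDatum k T 𝔘) (P : Subalgebra R T) : Prop where
  bin_mem : ∀ x m, ∃ r : R, algebraMap R k r = D.bin x m
  shift_symm_mem : ∀ g ∈ P, D.shift.symm g ∈ P
  tb_mem : ∀ c m, D.tb c m ∈ P

variable {D} {P : Subalgebra R T}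

lemma dF_tor_dE_mem_form (a b : ℕ) {g : T} (hg : g ∈ P) : D.dF a * D.tor g * D.dE b ∈ D.form P :=
  Submodule.subset_span ⟨a, D.tor g, ⟨g, hg, rfl⟩, b, rfl⟩

lemma dE_mul_tor (n : ℕ) (g : T) : D.dE n * D.tor g = D.tor ((D.shift.symm : T → T)^[n] g) * D.dE n := by
  rw [tor_mul_dE, (Function.LeftInverse.iterate D.shift.apply_symm_apply n g :)]

lemma tor_mul_dF' (n : ℕ) (g : T) : D.tor g * D.dF n = D.dF n * D.tor ((D.shift.symm : T → T)^[n] g) := by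
  rw [← tor_mul_dF, (Function.LeftInverse.iterate D.shift.apply_symm_apply n g :)]

lemma IsIntegral.iterate_shift_symm_mem (hP : D.IsIntegral P) (n : ℕ) {g : T} (hg : g ∈ P) :
    (D.shift.symm : T → T)^[n] g ∈ P := by
  induction n with
  | zero => exact hg
  | succ n ih => rw [Function.iterate_succ_apply']; exact hP.shift_symm_mem _ ih

theorem IsIntegral.mul_mem_form (hP : D.IsIntegral P) {z w : 𝔘} (hz : z ∈ D.form P)
    (hw : w ∈ D.form P) : z * w ∈ D.form P := by
  refine mul_mem_span_triangular ?_ ?_ ?_ ?_ ?_ hz hw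
  · intro a b
    obtain ⟨r, hr⟩ := hP.bin_mem (a + b) a
    exact ⟨r, by rw [dE_mul_dE, ← hr, algebraMap_smul]⟩
  · intro a b
    obtain ⟨r, hr⟩ := hP.bin_mem (a + b) a
    exact ⟨r, by rw [dF_mul_dF, ← hr, algebraMap_smul]⟩
  · rintro _ ⟨x, hx, rfl⟩ _ ⟨y, hy, rfl⟩
    exact ⟨x * y, P.mul_mem hx hy, map_mul D.tor x y⟩
  · rintro n _ ⟨x, hx, rfl⟩
    exact ⟨_, ⟨_, hP.iterate_shift_symm_mem n hx, rfl⟩, tor_mul_dF' n x⟩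
  · rintro a b _ ⟨x, hx, rfl⟩
    change D.dE a * D.dF b * D.tor x ∈ _
    rw [dE_mul_dF, sum_mul]
    refine Submodule.sum_mem _ fun t ht => ?_
    have ht := mem_range.1 ht
    by_cases hb : b < t
    · rw [zF_of_neg _ (by omega)]; simp
    rw [show (b : ℤ) - t = (b - t : ℕ) by omega, show (a : ℤ) - t = (a - t : ℕ) by omega,
      zF_natCast, zE_natCast, mul_assoc, dE_mul_tor, ← mul_assoc, mul_assoc (D.dF _), ← map_mul]
    exact dF_tor_dE_mem_form _ _ (P.mul_mem (hP.tb_mem _ _) (hP.iterate_shift_symm_mem _ hx))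

lemma one_mem_form : (1 : 𝔘) ∈ D.form P := by
  simpa using dF_tor_dE_mem_form (D := D) 0 0 P.one_mem

/-- A subalgebra generated by elements of `D.form P` and containing all `f⁽ᵃ⁾ t e⁽ᵇ⁾` is `D.form P`. -/
theorem IsIntegral.toSubmodule_eq_form (hP : D.IsIntegral P) {s : Set 𝔘} (hs : s ⊆ D.form P)
    (hE : ∀ n, D.dE n ∈ Algebra.adjoin R s) (hF : ∀ n, D.dF n ∈ Algebra.adjoin R s)
    (ht : ∀ g ∈ P, D.tor g ∈ Algebra.adjoin R s) :
    (Algebra.adjoin R s).toSubmodule = D.form P := by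
  apply le_antisymm
  · intro x hx
    change x ∈ Algebra.adjoin R s at hx
    induction hx using Algebra.adjoin_induction with
    | mem x hx => exact hs hx
    | algebraMap r => rw [Algebra.algebraMap_eq_smul_one]; exact Submodule.smul_mem _ _ one_mem_form
    | add x y _ _ hx hy => exact Submodule.add_mem _ hx hy
    | mul x y _ _ hx hy => exact hP.mul_mem_form hx hy
  · refine Submodule.span_le.2 ?_
    rintro _ ⟨a, _, ⟨g, hg, rfl⟩, b, rfl⟩
    exact Subalgebra.mul_mem _ (Subalgebra.mul_mem _ (hF a) (ht g hg)) (hE b)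

/-- The elements `f⁽ᵃ⁾ β e⁽ᵇ⁾` are independent, for `β` in an independent family of torus elements. -/
lemma linearIndependent_dF_tor_dE {I : Type*} {β : I → T} (hβ : LinearIndependent k β) :
    LinearIndependent k fun p : (ℕ × ℕ) × I => D.dF p.1.1 * D.tor (β p.2) * D.dE p.1.2 := by
  rw [linearIndependent_iff] at hβ ⊢
  intro x hx
  have h := D.eq_zero_of_sum_dF_tor_dE
    (x.curry.mapRange (Finsupp.linearCombination k β) (map_zero _)) (by
      rw [Finsupp.linearCombination_apply] at hx
      rw [Finsupp.sum_mapRange_index (by simp), ← hx, ← Finsupp.sum_curry_index x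
        fun p i c => c • (D.dF p.1 * D.tor (β i) * D.dE p.2)]
      refine Finsupp.sum_congr fun p _ => ?_
      simp [Finsupp.linearCombination_apply, Finsupp.sum, mul_sum, sum_mul])
  have h' : x.curry = 0 := by
    ext1 p
    have := DFunLike.congr_fun h p
    rw [Finsupp.mapRange_apply] at this
    exact hβ _ this
  ext ⟨p, i⟩
  have := DFunLike.congr_fun (DFunLike.congr_fun h' p) i
  simpa using this

/-- The basis `f⁽ᵃ⁾ β e⁽ᵇ⁾` of an integral form, for `β` in a basis of the integral form of the torus. -/
theorem exists_basis_of_toSubmodule_eq_form {V : Subalgebra R 𝔘} (hV : V.toSubmodule = D.form P)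
    [FaithfulSMul R k] {I : Type*} {β : I → T} (hβ : LinearIndependent k β)
    (hβP : Submodule.span R (Set.range β) = P.toSubmodule) :
    ∃ b : Module.Basis ((ℕ × ℕ) × I) R V, ∀ p, (b p : 𝔘) = D.dF p.1.1 * D.tor (β p.2) * D.dE p.1.2 := by
  have hmem : ∀ p : (ℕ × ℕ) × I, D.dF p.1.1 * D.tor (β p.2) * D.dE p.1.2 ∈ V := fun p => by
    have h : β p.2 ∈ P := by
      change β p.2 ∈ P.toSubmodule
      rw [← hβP]
      exact Submodule.subset_span ⟨_, rfl⟩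
    change _ ∈ V.toSubmodule
    rw [hV]
    exact dF_tor_dE_mem_form _ _ h
  have hli : LinearIndependent R fun p => (⟨_, hmem p⟩ : V) := by
    refine LinearIndependent.of_comp V.val.toLinearMap ?_
    exact (D.linearIndependent_dF_tor_dE hβ).restrict_scalars
      (by simpa [Algebra.smul_def] using FaithfulSMul.algebraMap_injective R k)
  refine ⟨Module.Basis.mk hli ?_, fun p => by rw [Module.Basis.mk_apply]⟩
  rintro ⟨x, hx⟩ -
  have h : x ∈ (Submodule.span R (Set.range fun p => (⟨_, hmem p⟩ : V))).map V.val.toLinearMap := by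
    rw [Submodule.map_span, ← Set.range_comp]
    have hx' : x ∈ D.form P := by rw [← hV]; exact hx
    refine Submodule.span_le.2 ?_ hx'
    rintro _ ⟨a, _, ⟨g, hg, rfl⟩, b, rfl⟩
    have hg : g ∈ Submodule.span R (Set.range β) := by rw [hβP]; exact hg
    let φ : T →ₗ[R] 𝔘 := LinearMap.mulRight R (D.dE b) ∘ₗ LinearMap.mulLeft R (D.dF a) ∘ₗ
      (D.tor.restrictScalars R).toLinearMap
    have : φ g ∈ (Submodule.span R (Set.range β)).map φ := ⟨g, hg, rfl⟩
    rw [Submodule.map_span, ← Set.range_comp] at this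
    refine Submodule.span_mono ?_ this
    rintro _ ⟨i, rfl⟩
    exact ⟨((a, b), i), rfl⟩
  obtain ⟨y, hy, hyx⟩ := h
  rwa [show (⟨x, hx⟩ : V) = y from Subtype.ext hyx.symm]

end IntegralForm

end SlTwoDatum

/-! ### Morphisms and representations over a base change -/

/-- A relation between two algebras that is compatible with the operations and is the graph of a
function is the graph of an algebra morphism. -/
lemma exists_algHom_of_rel {R X Y : Type*} [CommRing R] [Ring X] [Algebra R X] [Ring Y] [Algebra R Y]
    (G : X → Y → Prop) (hmul : ∀ {x x' y y'}, G x y → G x' y' → G (x * x') (y * y'))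
    (hadd : ∀ {x x' y y'}, G x y → G x' y' → G (x + x') (y + y'))
    (halg : ∀ r : R, G (algebraMap R X r) (algebraMap R Y r))
    (h : ∀ x, ∃ y, G x y) (h0 : ∀ y, G 0 y → y = 0) :
    ∃ f : X →ₐ[R] Y, ∀ x, G x (f x) := by
  choose f hf using h
  have hneg : ∀ {x y}, G x y → G (-x) (-y) := fun {x y} hxy => by
    have := hmul (halg (-1)) hxy
    simpa using this
  have huniq : ∀ {x y}, G x y → f x = y := fun {x y} hy => by
    have := hadd (hf x) (hneg hy)
    rw [add_neg_cancel] at this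
    exact add_neg_eq_zero.1 (h0 _ this)
  exact ⟨{ toFun := f
           map_one' := huniq (by simpa using halg 1)
           map_mul' := fun x y => huniq (hmul (hf x) (hf y))
           map_zero' := huniq (by simpa using halg 0)
           map_add' := fun x y => huniq (hadd (hf x) (hf y))
           commutes' := fun r => huniq (halg r) }, hf⟩

/-- Extension of scalars for finitely supported functions. -/
abbrev extend (R S : Type*) [CommRing R] [CommRing S] [Algebra R S] : (ℕ →₀ R) →ₗ[R] (ℕ →₀ S) :=
  Finsupp.mapRange.linearMap (Algebra.linearMap R S)

lemma extend_single {R S : Type*} [CommRing R] [CommRing S] [Algebra R S] (n : ℕ) (r : R) :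
    extend R S (Finsupp.single n r) = Finsupp.single n (algebraMap R S r) := by
  simp [extend]

/-- An algebra over `R` acting on `ℕ →₀ k` and preserving the lattice `ℕ →₀ R` acts on this lattice. -/
lemma exists_rep_of_lattice {R k V : Type*} [CommRing R] [CommRing k] [Algebra R k]
    [FaithfulSMul R k] [Ring V] [Algebra R V]
    (π : V →ₐ[R] Module.End k (ℕ →₀ k))
    (h : ∀ x, ∃ φ : Module.End R (ℕ →₀ R), ∀ y, extend R k (φ y) = π x (extend R k y)) :
    ∃ ρ : V →ₐ[R] Module.End R (ℕ →₀ R), ∀ x y, extend R k (ρ x y) = π x (extend R k y) := by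
  have hinj : Function.Injective (extend R k) :=
    Finsupp.mapRange_injective _ (map_zero _) (FaithfulSMul.algebraMap_injective R k)
  refine exists_algHom_of_rel (fun (x : V) (u : Module.End R (ℕ →₀ R)) => ∀ y, extend R k (u y) = π x (extend R k y)) ?_ ?_ ?_ h ?_
  · intro x x' u u' h h' y
    rw [map_mul, Module.End.mul_apply, Module.End.mul_apply, h, h']
  · intro x x' u u' h h' y
    rw [map_add, LinearMap.add_apply, LinearMap.add_apply, map_add, h, h']
  · intro r y
    rw [AlgHom.commutes, Module.algebraMap_end_apply, Module.algebraMap_end_apply, map_smul]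
  · intro u hu
    exact LinearMap.ext fun y => hinj (by rw [hu y, map_zero]; simp)

/-- The extension of scalars of a representation on `ℕ →₀ R`. -/
lemma exists_rep_extend {R V : Type*} (S : Type*) [CommRing R] [CommRing S] [Algebra R S] [Ring V]
    [Algebra R V] (π : V →ₐ[R] Module.End R (ℕ →₀ R)) :
    ∃ ρ : S ⊗[R] V →ₐ[S] Module.End S (ℕ →₀ S),
      ∀ x y, ρ (1 ⊗ₜ x) (extend R S y) = extend R S (π x y) := by
  obtain ⟨f, hf⟩ : ∃ f : V →ₐ[R] Module.End S (ℕ →₀ S),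
      ∀ x y, f x (extend R S y) = extend R S (π x y) := by
    refine exists_algHom_of_rel (fun (x : V) (u : Module.End S (ℕ →₀ S)) =>
      ∀ y, u (extend R S y) = extend R S (π x y)) ?_ ?_ ?_ ?_ ?_
    · intro x x' u u' h h' y
      rw [map_mul, Module.End.mul_apply, Module.End.mul_apply, h', h]
    · intro x x' u u' h h' y
      rw [map_add, LinearMap.add_apply, LinearMap.add_apply, map_add, h, h']
    · intro r y
      rw [AlgHom.commutes, Module.algebraMap_end_apply, Module.algebraMap_end_apply, map_smul]
    · intro x
      refine ⟨Finsupp.linearCombination S fun n => extend R S (π x (Finsupp.single n 1)), fun y => ?_⟩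
      induction y using Finsupp.induction_linear with
      | zero => simp
      | add y z hy hz => rw [map_add, map_add, hy, hz, map_add, map_add]
      | single n r =>
        rw [extend_single, Finsupp.linearCombination_single, algebraMap_smul, ← map_smul, ← map_smul,
          Finsupp.smul_single_one]
    · intro u hu
      ext1 n
      ext1
      have := hu (Finsupp.single n 1)
      rw [extend_single, map_one] at this
      simpa using this
  have hc : ∀ (s : S) (x : V), Commute (Algebra.ofId S (Module.End S (ℕ →₀ S)) s) (f x) :=
    fun s x => Algebra.commutes s (f x)
  refine ⟨Algebra.TensorProduct.lift (Algebra.ofId S _) f hc, fun x y => ?_⟩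
  rw [Algebra.TensorProduct.lift_tmul, map_one, one_mul]
  exact hf x y

namespace SlTwoDatum

variable {k T 𝔘 : Type*} [Field k] [CommRing T] [Algebra k T] [Ring 𝔘] [Algebra k 𝔘]
  {D : SlTwoDatum k T 𝔘} {R : Type*} [CommRing R] [Algebra R k] [Algebra R T] [Algebra R 𝔘]
  [IsScalarTower R k 𝔘] [IsScalarTower R k T] [FaithfulSMul R k] {P : Subalgebra R T}

/-- The action of an integral form on a dual Verma module over a base change of `R`. -/
theorem IsIntegral.exists_rep (hP : D.IsIntegral P) {V : Subalgebra R 𝔘}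
    (hV : V.toSubmodule = D.form P) (μ : ℤ)
    (hχ : ∀ g ∈ P, ∀ n : ℕ, ∃ r : R, algebraMap R k r = D.char (μ - 2 * n) g)
    (S : Type*) [CommRing S] [Algebra R S] :
    ∃ ρ : S ⊗[R] V →ₐ[S] Module.End S (ℕ →₀ S), ∀ (x : V) (n m : ℕ) (r : R),
      D.rep μ x (Finsupp.single n 1) = algebraMap R k r • Finsupp.single m 1 →
      ρ (1 ⊗ₜ x) (Finsupp.single n 1) = algebraMap R S r • Finsupp.single m 1 := by
  have key : ∀ x ∈ D.form P, ∃ φ : Module.End R (ℕ →₀ R),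
      ∀ y, extend R k (φ y) = D.rep μ x (extend R k y) := by
    have hbasis : ∀ (x : 𝔘) (φ : Module.End R (ℕ →₀ R)),
        (∀ n, extend R k (φ (Finsupp.single n 1)) = D.rep μ x (Finsupp.single n 1)) →
        ∀ y, extend R k (φ y) = D.rep μ x (extend R k y) := by
      intro x φ h y
      induction y using Finsupp.induction_linear with
      | zero => simp
      | add y z hy hz => simp only [map_add, hy, hz]
      | single n r =>
        rw [← Finsupp.smul_single_one, map_smul, map_smul, h, map_smul, extend_single, map_one,
          ← algebraMap_smul k r, ← algebraMap_smul k r, map_smul]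
    intro x hx
    induction hx using Submodule.span_induction with
    | zero => exact ⟨0, by simp⟩
    | add x y _ _ hx hy =>
      obtain ⟨φ, hφ⟩ := hx
      obtain ⟨ψ, hψ⟩ := hy
      exact ⟨φ + ψ, fun y => by rw [LinearMap.add_apply, map_add, map_add, hφ, hψ, LinearMap.add_apply]⟩
    | smul r x _ hx =>
      obtain ⟨φ, hφ⟩ := hx
      refine ⟨r • φ, fun y => ?_⟩
      rw [LinearMap.smul_apply, map_smul, hφ, ← algebraMap_smul k r x, map_smul, LinearMap.smul_apply,
        algebraMap_smul]
    | mem x hx =>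
      obtain ⟨a, _, ⟨g, hg, rfl⟩, b, rfl⟩ := hx
      choose β hβ using hP.bin_mem
      choose c hc using hχ g hg
      refine ⟨Finsupp.linearCombination R fun n => (β n b * c (n - b) * β (μ - (n - b : ℕ)) a) •
        Finsupp.single (n - b + a) 1, hbasis _ _ fun n => ?_⟩
      rw [Finsupp.linearCombination_single, one_smul, map_smul, extend_single, map_one,
        ← algebraMap_smul k]
      rw [map_mul, map_mul, hβ, hβ, hc]
      exact (D.rep_dF_tor_dE μ a b n g).symm
  obtain ⟨π, hπ⟩ := exists_rep_of_lattice (k := k) (V := V)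
    (((D.rep μ).restrictScalars R).comp V.val) (fun x => key x (by rw [← hV]; exact x.2))
  obtain ⟨ρ, hρ⟩ := exists_rep_extend S π
  refine ⟨ρ, fun x n m r hx => ?_⟩
  have h1 : π x (Finsupp.single n 1) = Finsupp.single m r := by
    apply Finsupp.mapRange_injective _ (map_zero _) (FaithfulSMul.algebraMap_injective R k)
    refine (hπ x _).trans ?_
    rw [extend_single, map_one]
    refine hx.trans ?_
    rw [Finsupp.mapRange_single, Finsupp.smul_single, smul_eq_mul, mul_one]
  have h2 := hρ x (Finsupp.single n 1)
  rw [h1, extend_single, extend_single, map_one] at h2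
  rw [h2, Finsupp.smul_single, smul_eq_mul, mul_one]

end SlTwoDatum

/-! ### The torus of quantum `sl₂` -/

section LaurentHom

open LaurentPolynomial

variable {k : Type*} [Field k]

/-- The morphism of algebras from Laurent polynomials that sends `T` to a given unit. -/
def laurentHom {𝔄 : Type*} [Ring 𝔄] [Algebra k 𝔄] (x : 𝔄ˣ) : k[T;T⁻¹] →ₐ[k] 𝔄 :=
  AddMonoidAlgebra.lift k 𝔄 ℤ ((Units.coeHom 𝔄).comp (zpowersHom 𝔄ˣ x))

@[simp] lemma laurentHom_T {𝔄 : Type*} [Ring 𝔄] [Algebra k 𝔄] (x : 𝔄ˣ) (n : ℤ) :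
    laurentHom (k := k) x (T n) = ((x ^ n : 𝔄ˣ) : 𝔄) := by
  rw [laurentHom, T, AddMonoidAlgebra.lift_single, one_smul]
  simp

lemma laurent_induction {p : k[T;T⁻¹] → Prop} (hT : ∀ n, p (T n)) (hadd : ∀ f g, p f → p g → p (f + g))
    (hsmul : ∀ (c : k) f, p f → p (c • f)) (f : k[T;T⁻¹]) : p f :=
  LaurentPolynomial.induction_on' f hadd fun n a => by
    rw [← smul_eq_C_mul]; exact hsmul _ _ (hT n)

lemma laurent_algHom_ext {𝔄 : Type*} [Ring 𝔄] [Algebra k 𝔄] {φ ψ : k[T;T⁻¹] →ₐ[k] 𝔄}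
    (h : ∀ n, φ (T n) = ψ (T n)) : φ = ψ :=
  AlgHom.ext fun f => laurent_induction (p := fun f => φ f = ψ f) h
    (fun f g hf hg => by rw [map_add, map_add, hf, hg]) (fun c f hf => by rw [map_smul, map_smul, hf]) f

/-- The unit `T` of the ring of Laurent polynomials. -/
def unitT (k : Type*) [Field k] : k[T;T⁻¹]ˣ where
  val := T 1
  inv := T (-1)
  val_inv := by rw [← T_add]; simp
  inv_val := by rw [← T_add]; simp

lemma unitT_zpow (n : ℤ) : ((unitT k ^ n : k[T;T⁻¹]ˣ) : k[T;T⁻¹]) = T n := by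
  induction n using Int.induction_on with
  | zero => simp
  | succ n ih => rw [zpow_add_one, Units.val_mul, ih, unitT, ← T_add]
  | pred n ih =>
    rw [zpow_sub_one, Units.val_mul, ih]
    change T _ * T (-1) = _
    rw [← T_add]; rfl

/-- The automorphism `T ↦ cT` of Laurent polynomials. -/
def scaleT (c : kˣ) : k[T;T⁻¹] →ₐ[k] k[T;T⁻¹] :=
  laurentHom (Units.map (algebraMap k k[T;T⁻¹]).toMonoidHom c * unitT k)

@[simp] lemma scaleT_T (c : kˣ) (n : ℤ) : scaleT c (T n) = ((c ^ n : kˣ) : k) • T n := by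
  rw [scaleT, laurentHom_T, mul_zpow, Units.val_mul, unitT_zpow, ← map_zpow, Units.coe_map,
    Algebra.smul_def]
  rfl

lemma scaleT_scaleT (c d : kˣ) (f : k[T;T⁻¹]) : scaleT c (scaleT d f) = scaleT (c * d) f := by
  have : (scaleT c).comp (scaleT d) = scaleT (c * d) := laurent_algHom_ext fun n => by
    simp [smul_smul, mul_zpow, mul_comm]
  exact DFunLike.congr_fun this f

lemma scaleT_one (f : k[T;T⁻¹]) : scaleT 1 f = f := by
  have : scaleT (1 : kˣ) = AlgHom.id k _ := laurent_algHom_ext fun n => by simp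
  exact DFunLike.congr_fun this f

lemma laurentHom_scaleT (c x : kˣ) (f : k[T;T⁻¹]) :
    laurentHom x (scaleT c f) = laurentHom (𝔄 := k) (x * c) f := by
  have : (laurentHom x).comp (scaleT c) = laurentHom (𝔄 := k) (x * c) := laurent_algHom_ext fun n => by
    simp [mul_zpow, mul_comm]
  exact DFunLike.congr_fun this f

/-- A Laurent polynomial that vanishes at all high powers of an element of infinite order is zero. -/
lemma laurent_eq_zero {v : kˣ} (hv : ∀ n : ℕ, 0 < n → v ^ n ≠ 1) (N : ℕ) (f : k[T;T⁻¹])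
    (h : ∀ m : ℕ, N ≤ m → laurentHom (𝔄 := k) (v ^ (m : ℤ)) f = 0) : f = 0 := by
  obtain ⟨n, p, hp⟩ := exists_T_pow f
  have hinj : Function.Injective fun m : ℕ => ((v ^ m : kˣ) : k) := by
    intro a b hab
    have hab : v ^ a = v ^ b := Units.ext hab
    by_contra hne
    rcases lt_or_gt_of_ne hne with h | h
    · exact hv (b - a) (by omega) (by rw [pow_sub _ h.le, hab, mul_inv_cancel])
    · exact hv (a - b) (by omega) (by rw [pow_sub _ h.le, hab, mul_inv_cancel])
  have hp0 : p = 0 := by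
    refine Polynomial.eq_zero_of_infinite_isRoot p
      (Set.Infinite.mono ?_ ((Set.Ici_infinite N).image hinj.injOn))
    rintro _ ⟨m, hm, rfl⟩
    have h1 : laurentHom (𝔄 := k) (v ^ (m : ℤ)) (Polynomial.toLaurent p) =
        p.eval ((v ^ m : kˣ) : k) := by
      have : ((laurentHom (𝔄 := k) (v ^ (m : ℤ))).comp Polynomial.toLaurentAlg) =
          Polynomial.aeval (R := k) ((v ^ m : kˣ) : k) := by
        ext
        simp
      exact DFunLike.congr_fun this p
    change Polynomial.eval _ p = 0
    rw [← h1, hp, map_mul, h m hm, zero_mul]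
  rw [hp0, map_zero] at hp
  rw [← mul_one f, ← T_zero, ← add_neg_cancel (n : ℤ), T_add, ← mul_assoc, ← hp, zero_mul]

end LaurentHom

section QuantumTorus

open LaurentPolynomial

variable {k : Type*} [Field k] (v : kˣ)

/-- The quantum integer `[n]` for an integer `n`. -/
def qNum (n : ℤ) : k := ((v ^ n : kˣ) - (v ^ (-n) : kˣ)) / (v - (v⁻¹ : kˣ))

/-- The torus element `[K; c] = (K vᶜ - K⁻¹ v⁻ᶜ) / (v - v⁻¹)`. -/
def qWt (c : ℤ) : k[T;T⁻¹] :=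
  ((v : k) - (v⁻¹ : kˣ))⁻¹ • (((v ^ c : kˣ) : k) • T 1 - ((v ^ (-c) : kˣ) : k) • T (-1))

variable {v}

lemma sub_inv_ne_zero_of_sq_ne_one (hv : v ^ 2 ≠ 1) : (v : k) - (v⁻¹ : kˣ) ≠ 0 := by
  intro h
  apply hv
  rw [sq, ← mul_inv_cancel v]
  congr 1
  exact Units.ext (sub_eq_zero.1 h)

lemma qNum_mul_zpow_add (m t x : ℤ) : qNum v (m - t) * (v ^ (x - m) : kˣ) + qNum v t * (v ^ x : kˣ) =
    qNum v m * (v ^ (x - m + t) : kˣ) := by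
  simp only [qNum, zpow_sub, zpow_add, zpow_neg, Units.val_mul, Units.val_inv_eq_inv_val,
    Units.val_zpow_eq_zpow_val, mul_inv, inv_inv]
  have h1 := zpow_ne_zero m v.ne_zero
  have h2 := zpow_ne_zero t v.ne_zero
  have h3 := zpow_ne_zero x v.ne_zero
  rw [div_mul_eq_mul_div, div_mul_eq_mul_div, div_mul_eq_mul_div, ← add_div]
  congr 1
  field_simp
  ring

lemma qNum_neg (n : ℤ) : qNum v (-n) = -qNum v n := by
  rw [qNum, qNum, neg_neg, ← neg_div, neg_sub]

lemma qWt_rel (m t x : ℤ) :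
    qNum v (m - t) • qWt v (x - m) + qNum v t • qWt v x = qNum v m • qWt v (x - m + t) := by
  have h1 := qNum_mul_zpow_add (v := v) m t x
  have h2 := qNum_mul_zpow_add (v := v) (-m) (-t) (-x)
  rw [show -m - -t = -(m - t) by ring, show -x - -m = -(x - m) by ring,
    show -(x - m) + -t = -(x - m + t) by ring, qNum_neg, qNum_neg, qNum_neg] at h2
  simp only [qWt, smul_comm (qNum v _) ((v : k) - (v⁻¹ : kˣ))⁻¹, ← smul_add]
  congr 1
  simp only [smul_sub, smul_smul]
  rw [← h1, show qNum v m * (v ^ (-(x - m + t)) : kˣ) =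
    qNum v (m - t) * (v ^ (-(x - m)) : kˣ) + qNum v t * (v ^ (-x) : kˣ) by linear_combination h2]
  module

lemma qNum_one (hv : v ^ 2 ≠ 1) : qNum v 1 = 1 := by
  rw [qNum, zpow_one, zpow_neg_one, div_self (sub_inv_ne_zero_of_sq_ne_one hv)]

lemma qNum_ne_zero (hv : ∀ n : ℕ, 0 < n → v ^ n ≠ 1) (n : ℕ) : qNum v (n + 1) ≠ 0 := by
  refine div_ne_zero (fun h => hv (2 * (n + 1)) (by omega) ?_)
    (sub_inv_ne_zero_of_sq_ne_one (hv 2 (by norm_num)))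
  have h : (v ^ (n + 1 : ℤ) : kˣ) = v ^ (-(n + 1) : ℤ) := Units.ext (sub_eq_zero.1 h)
  rw [two_mul, pow_add]
  nth_rw 1 [← zpow_natCast]
  push_cast
  rw [h, zpow_neg, inv_mul_eq_one]
  exact_mod_cast rfl

end QuantumTorus

/-! ### Elements satisfying the relations of quantum `sl₂` -/

section QuantumTriple

open LaurentPolynomial

variable {k : Type*} [Field k] {v : kˣ} {𝔘 : Type*} [Ring 𝔘] [Algebra k 𝔘]

lemma zpow_mul_of_mul_eq_smul {K : 𝔘ˣ} {x : 𝔘} {c : kˣ} (h : (K : 𝔘) * x = (c : k) • (x * K)) (n : ℤ) :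
    ((K ^ n : 𝔘ˣ) : 𝔘) * x = ((c ^ n : kˣ) : k) • (x * (K ^ n : 𝔘ˣ)) := by
  have h' : ((K⁻¹ : 𝔘ˣ) : 𝔘) * x = ((c⁻¹ : kˣ) : k) • (x * (K⁻¹ : 𝔘ˣ)) := by
    rw [Units.inv_mul_eq_iff_eq_mul, mul_smul_comm, ← mul_assoc, h, smul_mul_assoc, mul_assoc,
      Units.mul_inv, mul_one, smul_smul, Units.inv_mul, one_smul]
  induction n using Int.induction_on with
  | zero => simp
  | succ n ih =>
    rw [zpow_add_one, zpow_add_one, Units.val_mul, Units.val_mul, mul_assoc, h, mul_smul_comm, ← mul_assoc,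
      ih, smul_mul_assoc, smul_smul, mul_assoc, mul_comm (c : k)]
  | pred n ih =>
    rw [zpow_sub_one, zpow_sub_one, Units.val_mul, Units.val_mul, mul_assoc, h', mul_smul_comm,
      ← mul_assoc, ih, smul_mul_assoc, smul_smul, mul_assoc, mul_comm ((c⁻¹ : kˣ) : k)]

variable (v 𝔘) in
/-- An algebra with elements `K`, `E`, `F` that satisfy the relations of quantum `sl₂`, and with an action
on the dual Verma modules. -/
structure QuantumTriple where
  K : 𝔘ˣ
  E : 𝔘
  F : 𝔘
  K_mul_E : (K : 𝔘) * E = ((v ^ 2 : kˣ) : k) • (E * K)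
  K_mul_F : (K : 𝔘) * F = (((v ^ 2)⁻¹ : kˣ) : k) • (F * K)
  E_mul_F : E * F - F * E = ((v : k) - (v⁻¹ : kˣ))⁻¹ • ((K : 𝔘) - (K⁻¹ : 𝔘ˣ))
  rep : ℤ → 𝔘 →ₐ[k] Module.End k (ℕ →₀ k)
  rep_E : ∀ μ n, rep μ E (Finsupp.single n 1) = qNum v n • Finsupp.single (n - 1) 1
  rep_F : ∀ (μ : ℤ) (n : ℕ), rep μ F (Finsupp.single n 1) = qNum v (μ - n) • Finsupp.single (n + 1) 1
  rep_K : ∀ (μ : ℤ) (n : ℕ),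
    rep μ K (Finsupp.single n 1) = ((v ^ (μ - 2 * n) : kˣ) : k) • Finsupp.single n 1

/-- The automorphism `T ↦ v² T` of the torus of quantum `sl₂`. -/
def qShift (v : kˣ) : k[T;T⁻¹] ≃ₐ[k] k[T;T⁻¹] :=
  AlgEquiv.ofAlgHom (scaleT (v ^ 2)) (scaleT (v ^ 2)⁻¹)
    (AlgHom.ext fun f => by simp [scaleT_scaleT, scaleT_one])
    (AlgHom.ext fun f => by simp [scaleT_scaleT, scaleT_one])

lemma scaleT_qWt (v : kˣ) (c d : ℤ) : scaleT (v ^ d) (qWt v c) = qWt v (c + d) := by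
  simp only [qWt, map_smul, map_sub, scaleT_T, smul_smul, ← Units.val_mul]
  rw [zpow_one, ← zpow_add, ← zpow_mul, ← zpow_add, mul_neg_one, neg_add]

lemma laurentHom_qWt (v : kˣ) (μ c : ℤ) :
    laurentHom (𝔄 := k) (v ^ μ) (qWt v c) = qNum v (μ + c) := by
  simp only [qWt, map_smul, map_sub, laurentHom_T, smul_eq_mul, ← Units.val_mul]
  rw [zpow_one, ← zpow_add, ← zpow_mul, ← zpow_add, mul_neg_one, ← neg_add, add_comm, qNum,
    div_eq_inv_mul]

/-- The framework of `SlTwoDatum` for quantum `sl₂`. -/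
def QuantumTriple.datum (Q : QuantumTriple v 𝔘) (hv : ∀ n : ℕ, 0 < n → v ^ n ≠ 1) :
    SlTwoDatum k k[T;T⁻¹] 𝔘 where
  num := qNum v
  num_zero := by simp [qNum]
  num_one := qNum_one (hv 2 (by norm_num))
  num_ne_zero := qNum_ne_zero hv
  wt := qWt v
  wt_rel := qWt_rel
  shift := qShift v
  shift_wt c := scaleT_qWt v c 2
  tor := laurentHom Q.K
  e := Q.E
  f := Q.F
  tor_mul_e g := by
    refine laurent_induction (p := fun g => laurentHom Q.K g * Q.E = Q.E * laurentHom Q.K (qShift v g))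
      (fun n => ?_) (fun f g hf hg => ?_) (fun c f hf => ?_) g
    · change _ = _ * laurentHom Q.K (scaleT (v ^ 2) (T n))
      rw [scaleT_T, map_smul, laurentHom_T, zpow_mul_of_mul_eq_smul Q.K_mul_E, mul_smul_comm]
    · rw [map_add, map_add, map_add, add_mul, mul_add, hf, hg]
    · rw [map_smul, map_smul, map_smul, smul_mul_assoc, mul_smul_comm, hf]
  tor_mul_f g := by
    refine laurent_induction (p := fun g => laurentHom Q.K (qShift v g) * Q.F = Q.F * laurentHom Q.K g)
      (fun n => ?_) (fun f g hf hg => ?_) (fun c f hf => ?_) g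
    · change laurentHom Q.K (scaleT (v ^ 2) (T n)) * _ = _
      rw [scaleT_T, map_smul, laurentHom_T, smul_mul_assoc, zpow_mul_of_mul_eq_smul Q.K_mul_F, smul_smul,
        ← Units.val_mul, ← mul_zpow]
      simp
    · rw [map_add, map_add, map_add, add_mul, mul_add, hf, hg]
    · rw [map_smul, map_smul, map_smul, smul_mul_assoc, mul_smul_comm, hf]
  e_mul_f := by
    rw [← sub_eq_iff_eq_add', Q.E_mul_F]
    simp [qWt]
  char μ := laurentHom (v ^ μ)
  char_shift μ g := by
    change laurentHom (v ^ μ) (scaleT (v ^ 2) g) = _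
    rw [laurentHom_scaleT, zpow_add]
    rfl
  char_wt := laurentHom_qWt v
  char_dense := laurent_eq_zero hv
  rep := Q.rep
  rep_e := Q.rep_E
  rep_f := Q.rep_F
  rep_tor μ g n := by
    refine laurent_induction (p := fun g => Q.rep μ (laurentHom Q.K g) (Finsupp.single n 1) =
      laurentHom (𝔄 := k) (v ^ (μ - 2 * n)) g • Finsupp.single n 1)
      (fun m => ?_) (fun f g hf hg => ?_) (fun c f hf => ?_) g
    · have h := Q.rep_K μ n
      have h' : Q.rep μ (Q.K⁻¹ : 𝔘ˣ) (Finsupp.single n 1) =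
          (((v ^ (μ - 2 * n))⁻¹ : kˣ) : k) • Finsupp.single n 1 := by
        have := congr_arg (Q.rep μ (Q.K⁻¹ : 𝔘ˣ)) h
        rw [← Module.End.mul_apply, ← map_mul, Units.inv_mul, map_one, Module.End.one_apply, map_smul] at this
        nth_rw 2 [this]
        rw [smul_smul, Units.inv_mul, one_smul]
      rw [laurentHom_T, laurentHom_T]
      generalize v ^ (μ - 2 * (n : ℤ)) = w at h h'
      induction m using Int.induction_on with
      | zero => simp
      | succ m ih =>
        rw [zpow_add_one, Units.val_mul, map_mul, Module.End.mul_apply, h, map_smul, ih, smul_smul,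
          ← Units.val_mul, mul_comm, zpow_add_one]
      | pred m ih =>
        rw [zpow_sub_one, Units.val_mul, map_mul, Module.End.mul_apply, h', map_smul, ih, smul_smul,
          ← Units.val_mul, mul_comm, zpow_sub_one]
    · rw [map_add, map_add, LinearMap.add_apply, hf, hg, map_add, add_smul]
    · rw [map_smul, map_smul, LinearMap.smul_apply, hf, map_smul, smul_assoc]

namespace QuantumTriple

variable (Q : QuantumTriple v 𝔘) (hv : ∀ n : ℕ, 0 < n → v ^ n ≠ 1)

/-- A Pascal rule whose second coefficient involves `K`, which holds before any evaluation at a weight. -/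
lemma tb_pascal (c : ℤ) (m : ℕ) : (Q.datum hv).tb (c + 1) (m + 1) =
    ((v ^ (-(m + 1) : ℤ) : kˣ) : k) • (Q.datum hv).tb c (m + 1) +
      (((v ^ (c - m) : kˣ) : k) • T 1) * (Q.datum hv).tb c m := by
  have h1 := (Q.datum hv).num_smul_tb_left c m
  have h2 := (Q.datum hv).num_smul_tb_right c m
  have h0 : qNum v (m + 1) ≠ 0 := (Q.datum hv).num_ne_zero m
  change qNum v (m + 1) • _ = qWt v (c + 1) * _ at h1
  change qNum v (m + 1) • _ = _ * qWt v (c - m) at h2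
  have h3 : qWt v (c + 1) = ((v ^ (-(m + 1) : ℤ) : kˣ) : k) • qWt v (c - m) +
      qNum v (m + 1) • ((v ^ (c - m) : kˣ) : k) • T 1 := by
    have hs := sub_inv_ne_zero_of_sq_ne_one (hv 2 (by norm_num))
    simp only [qWt, qNum, smul_sub, smul_smul]
    rw [sub_add_eq_add_sub, ← add_smul]
    congr 2
    · simp only [zpow_sub, zpow_add, zpow_neg, Units.val_mul, Units.val_inv_eq_inv_val,
        Units.val_zpow_eq_zpow_val, mul_inv, zpow_one] at hs ⊢
      have h1 := zpow_ne_zero m v.ne_zero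
      have h2 := zpow_ne_zero c v.ne_zero
      have h3 := v.ne_zero
      field_simp
      ring
    · rw [mul_left_comm, ← Units.val_mul, ← zpow_add]
      congr 3
      ring_nf
  apply smul_right_injective _ h0
  simp only [smul_add]
  rw [h1, smul_comm (qNum v _), h2, h3, add_mul, smul_mul_assoc, smul_mul_assoc, mul_comm (qWt v _)]

lemma bin_pascal (x : ℤ) (m : ℕ) : (Q.datum hv).bin (x + 1) (m + 1) =
    ((v ^ (-(m + 1) : ℤ) : kˣ) : k) * (Q.datum hv).bin x (m + 1) +
      ((v ^ (x - m) : kˣ) : k) * (Q.datum hv).bin x m := by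
  have h := congr_arg ((Q.datum hv).char 0) (Q.tb_pascal hv x m)
  have hT : (Q.datum hv).char 0 (T 1) = 1 := by
    change laurentHom (v ^ (0 : ℤ)) (T 1) = _
    simp
  simpa only [map_add, map_smul, map_mul, SlTwoDatum.char_tb, zero_add, hT, smul_eq_mul, mul_one] using h

/-- Reduction of `K² [K; 0, c]` and of `K⁻¹ [K; 0, c]`, by which the span of the elements `Kᵈ [K; 0, c]`,
`d ∈ {0, 1}`, is stable under `K` and `K⁻¹`. -/
lemma T_mul_T_mul_tb (c : ℕ) : T 1 * (T 1 * (Q.datum hv).tb 0 c) =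
    ((v ^ (2 * c) : kˣ) : k) • (Q.datum hv).tb 0 c +
      (((v ^ c : kˣ) : k) * ((v ^ (c + 1 : ℤ) : kˣ) - (v ^ (-(c + 1) : ℤ) : kˣ))) •
        (T 1 * (Q.datum hv).tb 0 (c + 1)) ∧
    T (-1) * (Q.datum hv).tb 0 c =
      (((v ^ (2 * c))⁻¹ : kˣ) : k) • (T 1 * (Q.datum hv).tb 0 c) -
      (((v ^ c)⁻¹ : kˣ) * (((v ^ (c + 1 : ℤ) : kˣ) : k) - (v ^ (-(c + 1) : ℤ) : kˣ))) •
        (Q.datum hv).tb 0 (c + 1) := by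
  have h2 := (Q.datum hv).num_smul_tb_right 0 c
  change qNum v (c + 1) • _ = _ * qWt v (0 - c) at h2
  have hs := sub_inv_ne_zero_of_sq_ne_one (hv 2 (by norm_num))
  have h3 : (((v ^ (c + 1 : ℤ) : kˣ) : k) - (v ^ (-(c + 1) : ℤ) : kˣ)) • (Q.datum hv).tb 0 (c + 1) =
      (Q.datum hv).tb 0 c * ((((v ^ c)⁻¹ : kˣ) : k) • T 1 - ((v ^ c : kˣ) : k) • T (-1)) := by
    have := congr_arg (fun y => ((v : k) - (v⁻¹ : kˣ)) • y) h2
    simp only [qNum, qWt, smul_smul, mul_smul_comm] at this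
    rw [mul_div_cancel₀ _ hs, mul_inv_cancel₀ hs, one_smul] at this
    rw [this]
    simp
  have hT : (T 1 * T (-1) : k[T;T⁻¹]) = 1 := by rw [← T_add]; simp
  have hc : ((v ^ c : kˣ) : k) * ((v ^ c)⁻¹ : kˣ) = 1 := Units.mul_inv _
  constructor
  · rw [mul_smul, ← mul_smul_comm _ (T 1), h3, two_mul, pow_add, Units.val_mul]
    simp only [Algebra.smul_def, mul_sub]
    have hc' := congr_arg (algebraMap k k[T;T⁻¹]) hc
    rw [map_mul, map_one] at hc'
    rw [map_mul]
    set a := algebraMap k k[T;T⁻¹] ((v ^ c : kˣ) : k)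
    set b := algebraMap k k[T;T⁻¹] (((v ^ c)⁻¹ : kˣ) : k)
    linear_combination (-T 1 * T 1 * (Q.datum hv).tb 0 c) * hc' + a * a * (Q.datum hv).tb 0 c * hT
  · rw [mul_smul, h3, two_mul, pow_add, mul_inv, Units.val_mul]
    simp only [Algebra.smul_def, mul_sub]
    have hc' := congr_arg (algebraMap k k[T;T⁻¹]) hc
    rw [map_mul, map_one] at hc'
    rw [map_mul]
    set a := algebraMap k k[T;T⁻¹] ((v ^ c : kˣ) : k)
    set b := algebraMap k k[T;T⁻¹] (((v ^ c)⁻¹ : kˣ) : k)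
    linear_combination (-(Q.datum hv).tb 0 c * T (-1)) * hc'

end QuantumTriple

end QuantumTriple

/-! ### The integral form of the torus of quantum `sl₂` -/

section QuantumIntegral

open LaurentPolynomial

variable {k : Type*} [Field k] {R : Type*} [CommRing R] [Algebra R k]

/-- The elements of `k[ω]`, `ω² = 1`, with both coordinates in an `R`-submodule of `k`. -/
def coordSubmodule (M : Submodule R k) : Submodule R (QuadraticAlgebra k 1 0) where
  carrier := {s | s.re ∈ M ∧ s.im ∈ M}
  zero_mem' := ⟨M.zero_mem, M.zero_mem⟩
  add_mem' h h' := ⟨M.add_mem h.1 h'.1, M.add_mem h.2 h'.2⟩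
  smul_mem' r _ h := ⟨M.smul_mem r h.1, M.smul_mem r h.2⟩

/-- The square root `ω` of `1`, as a unit. -/
def omegaUnit (k : Type*) [Field k] : (QuadraticAlgebra k 1 0)ˣ where
  val := ⟨0, 1⟩
  inv := ⟨0, 1⟩
  val_inv := by ext <;> simp [QuadraticAlgebra.re_one, QuadraticAlgebra.im_one]
  inv_val := by ext <;> simp [QuadraticAlgebra.re_one, QuadraticAlgebra.im_one]

lemma omegaUnit_inv : (omegaUnit k)⁻¹ = omegaUnit k := rfl

lemma omegaUnit_mul_self : (omegaUnit k : QuadraticAlgebra k 1 0) * omegaUnit k = 1 :=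
  (omegaUnit k).mul_inv

lemma omegaUnit_mul_mem {M : Submodule R k} {s : QuadraticAlgebra k 1 0} (h : s ∈ coordSubmodule M) :
    omegaUnit k * s ∈ coordSubmodule M := by
  constructor
  · simpa [omegaUnit] using h.2
  · simpa [omegaUnit] using h.1

lemma omegaUnit_pow_mul_mem_iff {M : Submodule R k} (n : ℕ) {s : QuadraticAlgebra k 1 0} :
    (omegaUnit k : QuadraticAlgebra k 1 0) ^ n * s ∈ coordSubmodule M ↔ s ∈ coordSubmodule M := by
  induction n with
  | zero => simp
  | succ n ih =>
    rw [pow_succ', mul_assoc, ← ih]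
    refine ⟨fun h => ?_, omegaUnit_mul_mem⟩
    have := omegaUnit_mul_mem h
    rwa [← mul_assoc, omegaUnit_mul_self, one_mul] at this

/-- Evaluation of elements of the torus at the weight `n`, simultaneously for both signs: `T` is sent to
`ω vⁿ` with `ω² = 1`. -/
def signedEval (v : kˣ) (n : ℤ) : k[T;T⁻¹] →ₐ[k] QuadraticAlgebra k 1 0 :=
  laurentHom (omegaUnit k * Units.map (algebraMap k (QuadraticAlgebra k 1 0)).toMonoidHom (v ^ n))

/-- The morphism `ω ↦ 1`. -/
def omegaToOne (k : Type*) [Field k] : QuadraticAlgebra k 1 0 →ₐ[k] k where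
  toFun s := s.re + s.im
  map_one' := by simp [QuadraticAlgebra.re_one, QuadraticAlgebra.im_one]
  map_zero' := by simp
  map_mul' x y := by simp; ring
  map_add' x y := by simp; ring
  commutes' r := by simp

lemma omegaToOne_signedEval (v : kˣ) (n : ℤ) (g : k[T;T⁻¹]) :
    omegaToOne k (signedEval v n g) = laurentHom (v ^ n) g := by
  have : (omegaToOne k).comp (signedEval v n) = laurentHom (v ^ n) := laurent_algHom_ext fun m => by
    rw [AlgHom.comp_apply, signedEval, laurentHom_T, laurentHom_T]
    have h : Units.map (omegaToOne k).toMonoidHom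
      (omegaUnit k * Units.map (algebraMap k (QuadraticAlgebra k 1 0)).toMonoidHom (v ^ n)) = v ^ n := by
      ext
      simp [omegaToOne, omegaUnit]
    have h2 := congr_arg (fun u => ((u ^ m : kˣ) : k)) h
    simp only [← map_zpow] at h2
    exact h2
  exact DFunLike.congr_fun this g

lemma signedEval_T_one (v : kˣ) (n : ℤ) :
    signedEval v n (T 1) = ((v ^ n : kˣ) : k) • (omegaUnit k : QuadraticAlgebra k 1 0) := by
  rw [signedEval, laurentHom_T, zpow_one, Units.val_mul, mul_comm, Algebra.smul_def]
  rfl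

lemma signedEval_scaleT (v : kˣ) (c n : ℤ) (g : k[T;T⁻¹]) :
    signedEval v n (scaleT (v ^ c) g) = signedEval v (n + c) g := by
  have : (signedEval v n).comp (scaleT (v ^ c)) = signedEval v (n + c) := laurent_algHom_ext fun m => by
    rw [AlgHom.comp_apply, scaleT_T, map_smul, signedEval, signedEval, laurentHom_T, laurentHom_T,
      zpow_add, map_mul, ← mul_assoc, mul_zpow _ (Units.map _ (v ^ c)), Units.val_mul, mul_comm,
      ← map_zpow _ (v ^ c), Algebra.smul_def]
    exact mul_comm _ _
  exact DFunLike.congr_fun this g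

lemma signedEval_qWt (v : kˣ) (n c : ℤ) :
    signedEval v n (qWt v c) = qNum v (n + c) • (omegaUnit k : QuadraticAlgebra k 1 0) := by
  have h : signedEval v n (T (-1)) = ((v ^ (-n) : kˣ) : k) • (omegaUnit k : QuadraticAlgebra k 1 0) := by
    rw [signedEval, laurentHom_T, zpow_neg_one, mul_inv, omegaUnit_inv, ← map_inv, ← zpow_neg,
      Units.val_mul, mul_comm, Algebra.smul_def]
    rfl
  rw [qWt, map_smul, map_sub, map_smul, map_smul, h, signedEval_T_one, smul_smul, smul_smul,
    ← sub_smul, smul_smul, qNum, ← Units.val_mul, ← Units.val_mul, ← zpow_add, ← zpow_add, ← neg_add,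
    add_comm, div_eq_inv_mul]

variable (R) in
/-- The integral form of the torus: the Laurent polynomials whose values at all integral weights, for both
signs, are integral. The signs are needed because `2` is not invertible. -/
def intTorus (v : kˣ) : Subalgebra R k[T;T⁻¹] where
  carrier := {g | ∀ n, signedEval v n g ∈ coordSubmodule (1 : Submodule R k)}
  mul_mem' {f g} hf hg n := by
    rw [map_mul]
    have h := fun {x y : k} (hx : x ∈ (1 : Submodule R k)) (hy : y ∈ (1 : Submodule R k)) =>
      (by simpa using Submodule.mul_mem_mul hx hy : x * y ∈ (1 : Submodule R k))
    constructor
    · simpa using Submodule.add_mem _ (h (hf n).1 (hg n).1) (h (hf n).2 (hg n).2)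
    · simpa using Submodule.add_mem _ (h (hf n).1 (hg n).2) (h (hf n).2 (hg n).1)
  add_mem' {f g} hf hg n := by
    rw [map_add]; exact Submodule.add_mem _ (hf n) (hg n)
  algebraMap_mem' r n := by
    rw [IsScalarTower.algebraMap_apply R k k[T;T⁻¹], AlgHom.commutes]
    exact ⟨by simp [Submodule.mem_one], by simp⟩

lemma mem_intTorus {v : kˣ} {g : k[T;T⁻¹]} :
    g ∈ intTorus R v ↔ ∀ n, signedEval v n g ∈ coordSubmodule (1 : Submodule R k) := Iff.rfl

lemma scaleT_mem_intTorus {v : kˣ} {g : k[T;T⁻¹]} (hg : g ∈ intTorus R v) (c : ℤ) :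
    scaleT (v ^ c) g ∈ intTorus R v := fun n => by
  rw [signedEval_scaleT]; exact hg _

namespace QuantumTriple

variable {v : kˣ} {𝔘 : Type*} [Ring 𝔘] [Algebra k 𝔘]
  (Q : QuantumTriple v 𝔘) (hv : ∀ n : ℕ, 0 < n → v ^ n ≠ 1)

lemma signedEval_tb (n c : ℤ) (m : ℕ) : signedEval v n ((Q.datum hv).tb c m) =
    (omegaUnit k : QuadraticAlgebra k 1 0) ^ m *
      algebraMap k (QuadraticAlgebra k 1 0) ((Q.datum hv).bin (n + c) m) := by
  have h : ∀ i : ℕ, signedEval v n ((Q.datum hv).wt (c - i)) =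
      (omegaUnit k : QuadraticAlgebra k 1 0) *
        algebraMap k (QuadraticAlgebra k 1 0) ((Q.datum hv).num (n + c - i)) := fun i => by
    refine (signedEval_qWt v n (c - i)).trans ?_
    rw [Algebra.smul_def, mul_comm, add_sub_assoc]
    rfl
  rw [SlTwoDatum.tb, SlTwoDatum.bin, map_smul, map_prod, Finset.prod_congr rfl fun i _ => h i,
    prod_mul_distrib, prod_const, card_range, map_mul, map_prod, Algebra.smul_def]
  ring

/-- The basis `Kᵈ [K; 0, c]`, `d ∈ {0, 1}`, of the integral form of the torus. -/
def torusBasis (p : Bool × ℕ) : k[T;T⁻¹] :=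
  (if p.1 then T 1 else 1) * (Q.datum hv).tb 0 p.2

lemma span_torusBasis : Submodule.span k (Set.range (Q.torusBasis hv)) = ⊤ := by
  set W := Submodule.span k (Set.range (Q.torusBasis hv)) with hW
  have h0 : ∀ c, (Q.datum hv).tb 0 c ∈ W := fun c =>
    Submodule.subset_span ⟨(false, c), by simp [torusBasis]⟩
  have h1 : ∀ c, T 1 * (Q.datum hv).tb 0 c ∈ W := fun c =>
    Submodule.subset_span ⟨(true, c), by simp [torusBasis]⟩
  have hT : ∀ f ∈ W, T 1 * f ∈ W := by
    intro f hf
    induction hf using Submodule.span_induction with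
    | mem f hf =>
      obtain ⟨⟨d, c⟩, rfl⟩ := hf
      cases d
      · simpa [torusBasis] using h1 c
      · simp only [torusBasis, if_true]
        rw [(Q.T_mul_T_mul_tb hv c).1]
        exact W.add_mem (W.smul_mem _ (h0 _)) (W.smul_mem _ (h1 _))
    | zero => simp
    | add f g _ _ hf hg => rw [mul_add]; exact W.add_mem hf hg
    | smul c f _ hf => rw [mul_smul_comm]; exact W.smul_mem _ hf
  have hT' : ∀ f ∈ W, T (-1) * f ∈ W := by
    intro f hf
    induction hf using Submodule.span_induction with
    | mem f hf =>
      obtain ⟨⟨d, c⟩, rfl⟩ := hf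
      cases d
      · simp only [torusBasis, Bool.false_eq_true, if_false, one_mul]
        rw [(Q.T_mul_T_mul_tb hv c).2]
        exact W.sub_mem (W.smul_mem _ (h1 _)) (W.smul_mem _ (h0 _))
      · simp only [torusBasis, if_true]
        rw [← mul_assoc, ← T_add]
        simpa using h0 c
    | zero => simp
    | add f g _ _ hf hg => rw [mul_add]; exact W.add_mem hf hg
    | smul c f _ hf => rw [mul_smul_comm]; exact W.smul_mem _ hf
  rw [eq_top_iff]
  rintro f -
  refine laurent_induction (p := (· ∈ W)) (fun n => ?_) (fun f g => W.add_mem)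
    (fun c f => W.smul_mem c) f
  induction n using Int.induction_on with
  | zero => simpa using h0 0
  | succ n ih => rw [add_comm, T_add]; exact hT _ ih
  | pred n ih => rw [sub_eq_add_neg, add_comm, T_add]; exact hT' _ ih

/-- The hypothesis that `v` comes from a unit of `R` makes the binomial coefficients integral. -/
lemma bin_mem {u : Rˣ} (hu : Units.map (algebraMap R k).toMonoidHom u = v) (x : ℤ) (m : ℕ) :
    ∃ r : R, algebraMap R k r = (Q.datum hv).bin x m := by
  have hz : ∀ n : ℤ, ((v ^ n : kˣ) : k) = algebraMap R k ((u ^ n : Rˣ) : R) := fun n => by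
    rw [← hu, ← map_zpow]; rfl
  refine (Q.datum hv).bin_mem_range (fun x m => ⟨u ^ (-(m + 1) : ℤ), ((u ^ (x - m) : Rˣ) : R), ?_⟩) x m
  rw [bin_pascal, hz, hz, Algebra.smul_def, Algebra.smul_def]

/-- Triangularity: `Kᵈ [K; 0, c]` vanishes at the weights `0, …, c - 1` and takes invertible values at the
weight `c`, so that the coefficients can be read off successively from the values. -/
lemma coeff_mem_of_signedEval_mem {u : Rˣ} (hu : Units.map (algebraMap R k).toMonoidHom u = v)
    (M : Submodule R k) (x : Bool × ℕ →₀ k)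
    (h : ∀ n : ℕ, signedEval v n (Finsupp.linearCombination k (Q.torusBasis hv) x) ∈ coordSubmodule M)
    (p : Bool × ℕ) : x p ∈ M := by
  set ω : QuadraticAlgebra k 1 0 := (omegaUnit k).val
  have hz : ∀ n : ℤ, ((v ^ n : kˣ) : k) = algebraMap R k ((u ^ n : Rˣ) : R) := fun n => by
    rw [← hu, ← map_zpow]; rfl
  let y (n c : ℕ) : QuadraticAlgebra k 1 0 := ⟨x (false, c), ((v ^ (n : ℤ) : kˣ) : k) * x (true, c)⟩
  have hω : ∀ a b : k, (⟨a, b⟩ : QuadraticAlgebra k 1 0) = algebraMap k _ a + algebraMap k _ b * ω :=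
    fun a b => by ext <;> simp [ω, omegaUnit]
  have heval : ∀ n : ℕ, signedEval v n (Finsupp.linearCombination k (Q.torusBasis hv) x) =
      ∑ c ∈ x.support.image Prod.snd ∪ {n}, (Q.datum hv).bin n c • (ω ^ c * y n c) := by
    intro n
    rw [Finsupp.linearCombination_apply, Finsupp.sum_of_support_subset x
      (s := (univ : Finset Bool) ×ˢ (x.support.image Prod.snd ∪ {n}))
      (fun p hp => by
        simp only [mem_product, mem_univ, true_and, mem_union, mem_image]
        exact Or.inl ⟨p, hp, rfl⟩) _ (by simp), sum_product_right, map_sum]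
    refine sum_congr rfl fun c _ => ?_
    rw [Fintype.sum_bool, map_add, map_smul, map_smul]
    simp only [torusBasis, if_true, Bool.false_eq_true, if_false, one_mul, map_mul]
    rw [signedEval_tb, signedEval_T_one, add_zero]
    have hy : y n c = algebraMap k _ (x (false, c)) +
        algebraMap k _ (((v ^ (n : ℤ) : kˣ) : k) * x (true, c)) * ω := hω _ _
    rw [hy]
    simp only [Algebra.smul_def, map_mul]
    ring
  have hy : ∀ n c, x (false, c) ∈ M → x (true, c) ∈ M → y n c ∈ coordSubmodule M := fun n c h1 h2 =>
    ⟨h1, by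
      change ((v ^ (n : ℤ) : kˣ) : k) * x (true, c) ∈ M
      rw [hz, ← Algebra.smul_def]; exact M.smul_mem _ h2⟩
  have key : ∀ n, x (false, n) ∈ M ∧ x (true, n) ∈ M := by
    intro n
    induction n using Nat.strong_induction_on with
    | _ n ih =>
      have h1 := h n
      rw [heval, ← add_sum_erase _ _ (mem_union_right _ (mem_singleton_self n)),
        SlTwoDatum.bin_self, one_smul] at h1
      rw [Submodule.add_mem_iff_left _ (Submodule.sum_mem _ fun c hc => ?_),
        omegaUnit_pow_mul_mem_iff] at h1
      · refine ⟨h1.1, ?_⟩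
        have h2 : ((v ^ (n : ℤ) : kˣ) : k) * x (true, n) ∈ M := h1.2
        have := M.smul_mem ((u ^ (-n : ℤ) : Rˣ) : R) h2
        rwa [Algebra.smul_def, ← hz, ← mul_assoc, ← Units.val_mul, ← zpow_add, neg_add_cancel, zpow_zero,
          Units.val_one, one_mul] at this
      · rcases lt_or_gt_of_ne (mem_erase.1 hc).1 with hcn | hcn
        · obtain ⟨r, hr⟩ := Q.bin_mem hv hu n c
          rw [← hr, algebraMap_smul]
          exact Submodule.smul_mem _ _
            ((omegaUnit_pow_mul_mem_iff c).2 (hy n c (ih c hcn).1 (ih c hcn).2))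
        · rw [SlTwoDatum.bin_natCast_of_lt _ hcn, zero_smul]
          exact Submodule.zero_mem _
  obtain ⟨d, c⟩ := p
  cases d
  exacts [(key c).1, (key c).2]

variable [FaithfulSMul R k]

lemma linearIndependent_torusBasis {u : Rˣ} (hu : Units.map (algebraMap R k).toMonoidHom u = v) :
    LinearIndependent k (Q.torusBasis hv) := by
  rw [linearIndependent_iff]
  intro x hx
  ext p
  simpa using Q.coeff_mem_of_signedEval_mem hv hu ⊥ x (fun n => by
    rw [hx, map_zero]; exact Submodule.zero_mem _) p

lemma tb_mem_intTorus {u : Rˣ} (hu : Units.map (algebraMap R k).toMonoidHom u = v) (c : ℤ) (m : ℕ) :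
    (Q.datum hv).tb c m ∈ intTorus R v := fun n => by
  rw [signedEval_tb, omegaUnit_pow_mul_mem_iff]
  obtain ⟨r, hr⟩ := Q.bin_mem hv hu (n + c) m
  exact ⟨by simpa [Submodule.mem_one] using ⟨r, hr⟩, by simp⟩

lemma T_mem_intTorus {v : kˣ} {u : Rˣ} (hu : Units.map (algebraMap R k).toMonoidHom u = v) (m : ℤ) :
    T m ∈ intTorus R v := fun n => by
  rw [signedEval, laurentHom_T, mul_zpow, ← map_zpow, ← zpow_mul, ← hu, ← map_zpow, Units.val_mul]
  have h : ∀ s ∈ coordSubmodule (1 : Submodule R k),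
      ((omegaUnit k ^ m : (QuadraticAlgebra k 1 0)ˣ) : QuadraticAlgebra k 1 0) * s ∈
        coordSubmodule (1 : Submodule R k) := by
    obtain ⟨j, rfl | rfl⟩ := m.eq_nat_or_neg
    · intro s hs
      rw [zpow_natCast, Units.val_pow_eq_pow_val]
      exact (omegaUnit_pow_mul_mem_iff j).2 hs
    · intro s hs
      rw [zpow_neg, ← inv_zpow, omegaUnit_inv, zpow_natCast, Units.val_pow_eq_pow_val]
      exact (omegaUnit_pow_mul_mem_iff j).2 hs
  change _ * algebraMap k _ (algebraMap R k ((u ^ (n * m) : Rˣ) : R)) ∈ _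
  exact h _ ⟨by rw [QuadraticAlgebra.algebraMap_re]; exact Submodule.mem_one.2 ⟨_, rfl⟩, by simp⟩

lemma span_torusBasis_eq_intTorus {u : Rˣ} (hu : Units.map (algebraMap R k).toMonoidHom u = v) :
    Submodule.span R (Set.range (Q.torusBasis hv)) = (intTorus R v).toSubmodule := by
  apply le_antisymm
  · rw [Submodule.span_le]
    rintro _ ⟨⟨d, c⟩, rfl⟩
    refine (intTorus R v).mul_mem ?_ (Q.tb_mem_intTorus hv hu 0 c)
    split_ifs
    exacts [T_mem_intTorus hu 1, (intTorus R v).one_mem]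
  · intro g hg
    have h : g ∈ Submodule.span k (Set.range (Q.torusBasis hv)) := by
      rw [span_torusBasis]; trivial
    obtain ⟨x, rfl⟩ := Finsupp.mem_span_range_iff_exists_finsupp.1 h
    have hx := Q.coeff_mem_of_signedEval_mem hv hu (1 : Submodule R k) x (fun n => hg n)
    refine Submodule.sum_mem _ fun p _ => ?_
    obtain ⟨r, hr⟩ := Submodule.mem_one.1 (hx p)
    change x p • _ ∈ _
    rw [← hr, algebraMap_smul]
    exact Submodule.smul_mem _ _ (Submodule.subset_span ⟨p, rfl⟩)

theorem isIntegral_intTorus {u : Rˣ} (hu : Units.map (algebraMap R k).toMonoidHom u = v) :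
    (Q.datum hv).IsIntegral (intTorus R v) where
  bin_mem := Q.bin_mem hv hu
  shift_symm_mem g hg := by
    have := scaleT_mem_intTorus hg (-2)
    rwa [zpow_neg] at this
  tb_mem := Q.tb_mem_intTorus hv hu

end QuantumTriple

end QuantumIntegral

/-! ### Operators on sequence spaces -/

section VermaOperators

variable {k : Type*} [Field k]

/-- The operator `e_n ↦ c_n e_{s n}` on `ℕ →₀ k`. -/
def shiftOp (s : ℕ → ℕ) (c : ℕ → k) : Module.End k (ℕ →₀ k) :=
  Finsupp.linearCombination k fun n => c n • Finsupp.single (s n) 1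

@[simp] lemma shiftOp_single (s : ℕ → ℕ) (c : ℕ → k) (n : ℕ) :
    shiftOp s c (Finsupp.single n 1) = c n • Finsupp.single (s n) 1 := by
  rw [shiftOp, Finsupp.linearCombination_single, one_smul]

lemma end_ext {k : Type*} [CommSemiring k] {φ ψ : Module.End k (ℕ →₀ k)}
    (h : ∀ n, φ (Finsupp.single n 1) = ψ (Finsupp.single n 1)) : φ = ψ :=
  Finsupp.lhom_ext' fun n => LinearMap.ext_ring (h n)

end VermaOperators

/-! ### The integral form of quantum `sl₂` -/

/-- The indeterminate `v` as a unit of `𝒜`. -/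
def vA : Aˣ where
  val := LaurentPolynomial.T 1
  inv := LaurentPolynomial.T (-1)
  val_inv := by rw [← LaurentPolynomial.T_add]; simp
  inv_val := by rw [← LaurentPolynomial.T_add]; simp

/-- The indeterminate `v` as a unit of `ℚ(v)`. -/
def vUnit : Qvˣ := Units.map (algebraMap A Qv).toMonoidHom vA

lemma coe_vUnit : (vUnit : Qv) = v := rfl

lemma coe_vUnit_zpow (n : ℤ) : ((vUnit ^ n : Qvˣ) : Qv) = v ^ n := by
  rw [Units.val_zpow_eq_zpow_val, coe_vUnit]

lemma coe_vUnit_zpow_eq_algebraMap (n : ℤ) :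
    ((vUnit ^ n : Qvˣ) : Qv) = algebraMap A Qv ((vA ^ n : Aˣ) : A) := by
  rw [show vUnit = Units.map (algebraMap A Qv).toMonoidHom vA from rfl, ← map_zpow]; rfl

lemma coe_vUnit_inv : ((vUnit⁻¹ : Qvˣ) : Qv) = v⁻¹ := by
  rw [Units.val_inv_eq_inv_val, coe_vUnit]

lemma algebraMap_A_Qv_injective : Function.Injective (algebraMap A Qv) :=
  IsFractionRing.injective A Qv

lemma vUnit_pow_ne_one (n : ℕ) (hn : 0 < n) : vUnit ^ n ≠ 1 := by
  intro h
  have h1 : algebraMap A Qv (LaurentPolynomial.T 1 ^ n) = algebraMap A Qv 1 := by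
    rw [map_pow, map_one]
    exact congr_arg Units.val h
  have h2 := algebraMap_A_Qv_injective h1
  rw [LaurentPolynomial.T_pow] at h2
  have h3 := congr_arg (fun p : A => p.coeff 0) h2
  rw [← LaurentPolynomial.T_zero] at h3
  simp [hn.ne'] at h3

lemma qInt_eq (n : ℕ) : qInt n = qNum vUnit n := by
  rw [qInt, qNum, coe_vUnit, coe_vUnit_inv, coe_vUnit_zpow, coe_vUnit_zpow, zpow_neg, zpow_natCast,
    inv_pow]

lemma stdGen_K_mul_Kinv : stdGen .K * stdGen .Kinv = 1 := by
  rw [stdGen, stdGen, ← map_mul, RingQuot.mkAlgHom_rel Qv Rel.K_mul_Kinv, map_one]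

lemma stdGen_Kinv_mul_K : stdGen .Kinv * stdGen .K = 1 := by
  rw [stdGen, stdGen, ← map_mul, RingQuot.mkAlgHom_rel Qv Rel.Kinv_mul_K, map_one]

/-- The action of the generators on the dual Verma module of highest weight `μ`. -/
def vermaGen (μ : ℤ) : Gen → Module.End Qv (ℕ →₀ Qv)
  | .E => shiftOp (· - 1) fun n => qNum vUnit n
  | .F => shiftOp (· + 1) fun n => qNum vUnit (μ - n)
  | .K => shiftOp id fun n => ((vUnit ^ (μ - 2 * n) : Qvˣ) : Qv)
  | .Kinv => shiftOp id fun n => ((vUnit ^ (-(μ - 2 * n)) : Qvˣ) : Qv)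

lemma qNum_zero {k : Type*} [Field k] (v : kˣ) : qNum v 0 = 0 := by simp [qNum]

lemma vermaGen_rel (μ : ℤ) ⦃x y : FreeAlgebra Qv Gen⦄ (h : Rel x y) :
    FreeAlgebra.lift Qv (vermaGen μ) x = FreeAlgebra.lift Qv (vermaGen μ) y := by
  have hs := sub_inv_ne_zero_of_sq_ne_one (vUnit_pow_ne_one 2 (by norm_num))
  cases h with
  | K_mul_Kinv =>
    refine end_ext fun n => ?_
    simp only [map_mul, map_one, FreeAlgebra.lift_ι_apply, vermaGen, Module.End.mul_apply,
      Module.End.one_apply, shiftOp_single, map_smul, smul_smul, id, ← Units.val_mul, ← zpow_add]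
    simp
  | Kinv_mul_K =>
    refine end_ext fun n => ?_
    simp only [map_mul, map_one, FreeAlgebra.lift_ι_apply, vermaGen, Module.End.mul_apply,
      Module.End.one_apply, shiftOp_single, map_smul, smul_smul, id, ← Units.val_mul, ← zpow_add]
    simp
  | K_mul_E =>
    refine end_ext fun n => ?_
    rcases n with _ | n
    · simp [vermaGen, qNum, shiftOp]
    · simp only [map_mul, map_smul, FreeAlgebra.lift_ι_apply, vermaGen, Module.End.mul_apply,
        LinearMap.smul_apply, shiftOp_single, map_smul, smul_smul, id, Nat.add_sub_cancel,
        coe_vUnit_zpow]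
      congr 1
      rw [mul_comm, ← mul_assoc]
      congr 1
      rw [← zpow_natCast v 2, ← zpow_add₀ (by rw [← coe_vUnit]; exact vUnit.ne_zero)]
      congr 1
      push_cast; ring
  | K_mul_F =>
    refine end_ext fun n => ?_
    simp only [map_mul, map_smul, FreeAlgebra.lift_ι_apply, vermaGen, Module.End.mul_apply,
      LinearMap.smul_apply, shiftOp_single, map_smul, smul_smul, id, coe_vUnit_zpow]
    congr 1
    rw [mul_comm, ← mul_assoc]
    congr 1
    rw [← zpow_natCast v 2, ← zpow_neg, ← zpow_add₀ (by rw [← coe_vUnit]; exact vUnit.ne_zero)]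
    congr 1
    push_cast; ring
  | E_F =>
    refine end_ext fun n => ?_
    have h := qNum_mul_zpow_add (v := vUnit) 1 (-n) (1 - n)
    have h1 : qNum vUnit (n + 1 : ℕ) * qNum vUnit (μ - n) - qNum vUnit n * qNum vUnit (μ - (n - 1 : ℤ)) =
        qNum vUnit (μ - 2 * n) := by
      simp only [qNum, zpow_sub, zpow_add, zpow_neg, Units.val_mul, Units.val_inv_eq_inv_val,
        Units.val_zpow_eq_zpow_val, mul_inv, inv_inv, Nat.cast_add, Nat.cast_one, zpow_one,
        two_mul] at hs ⊢
      have h1 := zpow_ne_zero μ vUnit.ne_zero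
      have h2 := zpow_ne_zero n vUnit.ne_zero
      have h3 := vUnit.ne_zero
      set s := (vUnit : Qv) - (vUnit : Qv)⁻¹ with hs'
      rw [div_mul_div_comm, div_mul_div_comm, ← sub_div, div_eq_div_iff (mul_ne_zero hs hs) hs, hs']
      field_simp
      ring
    have h2 : FreeAlgebra.lift Qv (vermaGen μ)
        ((v - v⁻¹)⁻¹ • (gen .K - gen .Kinv)) (Finsupp.single n 1) =
        qNum vUnit (μ - 2 * n) • Finsupp.single n 1 := by
      simp only [map_smul, map_sub, FreeAlgebra.lift_ι_apply, vermaGen,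
        LinearMap.smul_apply, LinearMap.sub_apply, shiftOp_single, id, ← sub_smul, smul_smul]
      rw [qNum, div_eq_inv_mul, coe_vUnit, coe_vUnit_inv]
    rw [h2, ← h1]
    rcases n with _ | n
    · simp only [map_mul, map_sub, FreeAlgebra.lift_ι_apply, vermaGen, Module.End.mul_apply,
        LinearMap.sub_apply, shiftOp_single, map_smul, smul_smul, sub_smul, Nat.cast_zero, qNum_zero,
        zero_smul, map_zero, zero_mul]
      rw [mul_comm]
    · simp only [map_mul, map_sub, FreeAlgebra.lift_ι_apply, vermaGen, Module.End.mul_apply,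
        LinearMap.sub_apply, shiftOp_single, map_smul, smul_smul, Nat.add_sub_cancel, sub_smul]
      congr 2
      · rw [mul_comm]
      · push_cast; ring_nf

/-- The dual Verma module of highest weight `μ`. -/
def vermaRep (μ : ℤ) : UQv →ₐ[Qv] Module.End Qv (ℕ →₀ Qv) :=
  RingQuot.liftAlgHom Qv ⟨FreeAlgebra.lift Qv (vermaGen μ), vermaGen_rel μ⟩

lemma vermaRep_stdGen (μ : ℤ) (g : Gen) : vermaRep μ (stdGen g) = vermaGen μ g := by
  rw [vermaRep, stdGen, RingQuot.liftAlgHom_mkAlgHom_apply, FreeAlgebra.lift_ι_apply]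

/-- The standard generators of quantum `sl₂`. -/
def quantumTriple : QuantumTriple vUnit UQv where
  K := ⟨stdGen .K, stdGen .Kinv, stdGen_K_mul_Kinv, stdGen_Kinv_mul_K⟩
  E := stdGen .E
  F := stdGen .F
  K_mul_E := by
    have := RingQuot.mkAlgHom_rel Qv Rel.K_mul_E
    rwa [map_mul, map_smul, map_mul] at this
  K_mul_F := by
    have := RingQuot.mkAlgHom_rel Qv Rel.K_mul_F
    rw [map_mul, map_smul, map_mul] at this
    rw [Units.val_inv_eq_inv_val]
    exact this
  E_mul_F := by
    have := RingQuot.mkAlgHom_rel Qv Rel.E_F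
    rw [map_sub, map_mul, map_mul, map_smul, map_sub] at this
    rw [coe_vUnit_inv]
    exact this
  rep := vermaRep
  rep_E μ n := by rw [vermaRep_stdGen]; exact shiftOp_single _ _ n
  rep_F μ n := by rw [vermaRep_stdGen]; exact shiftOp_single _ _ n
  rep_K μ n := by
    change vermaRep μ (stdGen .K) _ = _
    rw [vermaRep_stdGen]; exact shiftOp_single _ _ n

/-- The framework of `SlTwoDatum` for the quantum algebra `UQv`. -/
abbrev quantum : SlTwoDatum Qv (LaurentPolynomial Qv) UQv := quantumTriple.datum vUnit_pow_ne_one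

lemma quantum_fact (n : ℕ) : quantum.fact n = qFactorial n := by
  induction n with
  | zero => simp [qFactorial]
  | succ n ih =>
    rw [SlTwoDatum.fact_succ, ih, qFactorial, qFactorial, prod_Icc_succ_top (by omega), qInt_eq]
    push_cast
    rfl

lemma quantum_dE (n : ℕ) : quantum.dE n = divE n := by
  rw [SlTwoDatum.dE, quantum_fact]; rfl

lemma quantum_dF (n : ℕ) : quantum.dF n = divF n := by
  rw [SlTwoDatum.dF, quantum_fact]; rfl

lemma quantum_tor_T (n : ℤ) : quantum.tor (LaurentPolynomial.T n) = ((quantumTriple.K ^ n : UQvˣ) : UQv) :=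
  laurentHom_T _ n

lemma quantum_tor_T_one : quantum.tor (LaurentPolynomial.T 1) = stdGen .K := by
  rw [quantum_tor_T, zpow_one]; rfl

lemma quantum_tor_T_neg_one : quantum.tor (LaurentPolynomial.T (-1)) = stdGen .Kinv := by
  rw [quantum_tor_T, zpow_neg_one]; rfl

lemma quantum_tor_tb (c : ℤ) (m : ℕ) : quantum.tor (quantum.tb c m) = torusBinom c m := by
  induction m with
  | zero => simp [torusBinom]
  | succ m ih =>
    have h0 : quantum.num (m + 1) ≠ 0 := quantum.num_ne_zero m
    have h := quantum.num_smul_tb_right c m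
    rw [← eq_inv_smul_iff₀ h0] at h
    rw [h, map_smul, map_mul, ih, torusBinom, torusBinom, List.range_succ, List.map_append,
      List.prod_append, List.map_singleton, List.prod_singleton, ← mul_smul_comm]
    congr 1
    have hs := sub_inv_ne_zero_of_sq_ne_one (vUnit_pow_ne_one 2 (by norm_num))
    change (qNum vUnit (m + 1))⁻¹ • quantum.tor (qWt vUnit (c - m)) = _
    rw [qWt, map_smul, map_sub, map_smul, map_smul, quantum_tor_T_one, quantum_tor_T_neg_one, smul_smul,
      qNum, ← mul_inv, div_mul_cancel₀ _ hs, coe_vUnit_zpow, coe_vUnit_zpow, coe_vUnit_zpow,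
      coe_vUnit_zpow, zpow_neg v (m + 1), ← inv_zpow]
    rfl

/-- The integral form of the torus of `UQv`. -/
abbrev torusA : Subalgebra A (LaurentPolynomial Qv) := intTorus A vUnit

lemma isIntegral_torusA : quantum.IsIntegral torusA := quantumTriple.isIntegral_intTorus _ rfl

/-- The basis `Kᵈ [K; 0, c]` of the integral form of the torus of `UQv`. -/
abbrev torusAElt : Bool × ℕ → LaurentPolynomial Qv := quantumTriple.torusBasis vUnit_pow_ne_one

lemma tor_tb_mem_U (c : ℤ) (m : ℕ) : quantum.tor (quantum.tb c m) ∈ U := by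
  refine quantum.tor_tb_mem (fun n => by rw [quantum_dE]; exact divE_mem n)
    (fun n => by rw [quantum_dF]; exact divF_mem n) (fun c m => ?_) c m
  refine ⟨vA ^ (-(m + 1) : ℤ), algebraMap A Qv ((vA ^ (c - m) : Aˣ) : A) • LaurentPolynomial.T 1, ?_, ?_⟩
  · rw [map_smul, quantum_tor_T_one, algebraMap_smul]
    exact U.smul_mem K_mem _
  · rw [quantumTriple.tb_pascal, coe_vUnit_zpow_eq_algebraMap, coe_vUnit_zpow_eq_algebraMap]
    exact congr_arg₂ (· + ·) (algebraMap_smul Qv _ _) rfl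

lemma torusBinom_mem (c : ℤ) (m : ℕ) : torusBinom c m ∈ U := by
  rw [← quantum_tor_tb]; exact tor_tb_mem_U c m

lemma tor_mem_U {g : LaurentPolynomial Qv} (hg : g ∈ torusA) : quantum.tor g ∈ U := by
  have hg' : g ∈ Submodule.span A (Set.range torusAElt) := by
    rw [quantumTriple.span_torusBasis_eq_intTorus _ (u := vA) rfl]; exact hg
  clear hg
  induction hg' using Submodule.span_induction with
  | mem g hg =>
    obtain ⟨⟨d, c⟩, rfl⟩ := hg
    change quantum.tor ((if d then LaurentPolynomial.T 1 else 1) * quantum.tb 0 c) ∈ U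
    rw [map_mul]
    refine U.mul_mem ?_ (tor_tb_mem_U _ _)
    split_ifs
    · rw [quantum_tor_T_one]; exact K_mem
    · rw [map_one]; exact U.one_mem
  | zero => rw [map_zero]; exact U.zero_mem
  | add f g _ _ hf hg => rw [map_add]; exact U.add_mem hf hg
  | smul r f _ hf =>
    rw [← algebraMap_smul Qv, map_smul, algebraMap_smul]; exact U.smul_mem hf r

lemma U_toSubmodule : U.toSubmodule = quantum.form torusA := by
  refine isIntegral_torusA.toSubmodule_eq_form ?_ (fun n => by rw [quantum_dE]; exact divE_mem n)
    (fun n => by rw [quantum_dF]; exact divF_mem n) (fun g hg => tor_mem_U hg)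
  rintro x ((⟨n, rfl⟩ | ⟨n, rfl⟩) | rfl | rfl)
  · rw [← quantum_dE]
    simpa using SlTwoDatum.dF_tor_dE_mem_form (D := quantum) 0 n torusA.one_mem
  · rw [← quantum_dF]
    simpa using SlTwoDatum.dF_tor_dE_mem_form (D := quantum) n 0 torusA.one_mem
  · rw [← quantum_tor_T_one]
    simpa using SlTwoDatum.dF_tor_dE_mem_form (D := quantum) 0 0
      (QuantumTriple.T_mem_intTorus (R := A) (v := vUnit) (u := vA) rfl 1)
  · rw [← quantum_tor_T_neg_one]
    simpa using SlTwoDatum.dF_tor_dE_mem_form (D := quantum) 0 0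
      (QuantumTriple.T_mem_intTorus (R := A) (v := vUnit) (u := vA) rfl (-1))

/-- The Poincaré–Birkhoff–Witt basis of `U`. -/
theorem exists_basis_U : ∃ b : Module.Basis ((ℕ × ℕ) × (Bool × ℕ)) A U,
    ∀ p, (b p : UQv) = quantum.dF p.1.1 * quantum.tor (torusAElt p.2) * quantum.dE p.1.2 :=
  SlTwoDatum.exists_basis_of_toSubmodule_eq_form (D := quantum) (P := torusA) U_toSubmodule
    (quantumTriple.linearIndependent_torusBasis _ (R := A) (u := vA) rfl)
    (quantumTriple.span_torusBasis_eq_intTorus _ (u := vA) rfl)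

instance : Module.Free A U := .of_basis exists_basis_U.choose

/-- `U_ℬ` is free over the domain `ℬ`, hence embeds into its localization. -/
theorem toUq_injective (l : ℕ) [NeZero l] : Function.Injective (toUq l) :=
  Algebra.TensorProduct.includeRight_injective (IsFractionRing.injective (B l) (Qq l))

/-! ### The Kostant form of the enveloping algebra of `sl₂` -/

section Classical

attribute [local instance] LieRing.ofAssociativeRing

/-- The action of `sl₂` on the dual Verma module of highest weight `μ`. -/
def vermaLie (μ : ℤ) : sl2 →ₗ⁅ℚ⁆ Module.End ℚ (ℕ →₀ ℚ) where
  toFun x := x.val 0 1 • shiftOp (· - 1) (fun n => (n : ℚ)) +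
    x.val 1 0 • shiftOp (· + 1) (fun n => ((μ - n : ℤ) : ℚ)) +
    x.val 0 0 • shiftOp id (fun n => ((μ - 2 * n : ℤ) : ℚ))
  map_add' x y := by
    change (x.val 0 1 + y.val 0 1) • _ + (x.val 1 0 + y.val 1 0) • _ + (x.val 0 0 + y.val 0 0) • _ = _
    module
  map_smul' c x := by
    change (c * x.val 0 1) • _ + (c * x.val 1 0) • _ + (c * x.val 0 0) • _ = c • _
    module
  map_lie' {x y} := by
    have htr : ∀ z : sl2, z.val 1 1 = -z.val 0 0 := fun z => by
      have : Matrix.trace z.val = 0 := z.2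
      rw [Matrix.trace_fin_two] at this
      linarith
    have hx := htr x
    have hy := htr y
    refine end_ext fun n => ?_
    rw [LieRing.of_associative_ring_bracket]
    simp only [LieAlgebra.SpecialLinear.sl_bracket, Matrix.sub_apply, Matrix.mul_apply,
      Fin.sum_univ_two, hx, hy, LinearMap.sub_apply, Module.End.mul_apply, LinearMap.add_apply,
      LinearMap.smul_apply, shiftOp_single, map_add, map_smul, id, smul_smul, smul_add]
    rcases n with _ | n
    · push_cast
      simp only [zero_smul, mul_zero, zero_mul, zero_add]
      module
    · simp only [Nat.add_sub_cancel]
      push_cast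
      module

/-- The dual Verma module of highest weight `μ` of the enveloping algebra. -/
def classicalRep (μ : ℤ) : Env →ₐ[ℚ] Module.End ℚ (ℕ →₀ ℚ) :=
  UniversalEnvelopingAlgebra.lift ℚ (vermaLie μ)

lemma classicalRep_ι (μ : ℤ) (x : sl2) :
    classicalRep μ (UniversalEnvelopingAlgebra.ι ℚ x) = vermaLie μ x :=
  UniversalEnvelopingAlgebra.lift_ι_apply ℚ _ _

lemma env_bracket (x y : sl2) : UniversalEnvelopingAlgebra.ι ℚ x * UniversalEnvelopingAlgebra.ι ℚ y =
    UniversalEnvelopingAlgebra.ι ℚ y * UniversalEnvelopingAlgebra.ι ℚ x +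
      UniversalEnvelopingAlgebra.ι ℚ ⁅x, y⁆ := by
  rw [LieHom.map_lie, LieRing.of_associative_ring_bracket]
  abel

lemma env_map_smul (c : ℚ) (x : sl2) :
    UniversalEnvelopingAlgebra.ι ℚ (c • x) = c • UniversalEnvelopingAlgebra.ι ℚ x :=
  map_smul (UniversalEnvelopingAlgebra.ι ℚ) c x

end Classical

lemma bracket_X_Y : ⁅X, Y⁆ = H := by
  apply Subtype.ext
  rw [LieAlgebra.SpecialLinear.sl_bracket]
  ext i j
  fin_cases i <;> fin_cases j <;> simp [X, Y, H]

lemma bracket_H_X : ⁅H, X⁆ = (2 : ℚ) • X := by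
  apply Subtype.ext
  rw [LieAlgebra.SpecialLinear.sl_bracket]
  change _ = (2 : ℚ) • X.val
  ext i j
  fin_cases i <;> fin_cases j <;> simp [X, H]
  norm_num

lemma bracket_H_Y : ⁅H, Y⁆ = (-2 : ℚ) • Y := by
  apply Subtype.ext
  rw [LieAlgebra.SpecialLinear.sl_bracket]
  change _ = (-2 : ℚ) • Y.val
  ext i j
  fin_cases i <;> fin_cases j <;> simp [Y, H]
  norm_num

section

open Polynomial

lemma aeval_semiconj {𝔄 : Type*} [Ring 𝔄] [Algebra ℚ 𝔄] {x a b : 𝔄} (h : SemiconjBy x a b) (g : ℚ[X]) :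
    SemiconjBy x (aeval a g) (aeval b g) := by
  induction g using Polynomial.induction_on' with
  | add f g hf hg => rw [map_add, map_add]; exact hf.add_right hg
  | monomial n r =>
    rw [aeval_monomial, aeval_monomial]
    exact SemiconjBy.mul_right (Algebra.commutes r x).symm (h.pow_right n)

/-- The translation `T ↦ T + 2` of polynomials. -/
def polyShift : ℚ[X] ≃ₐ[ℚ] ℚ[X] :=
  AlgEquiv.ofAlgHom (aeval (Polynomial.X + 2)) (aeval (Polynomial.X - 2)) (by ext1; simp [map_ofNat]) (by ext1; simp [map_ofNat])

lemma aeval_polyShift {𝔄 : Type*} [Ring 𝔄] [Algebra ℚ 𝔄] (a : 𝔄) (g : ℚ[X]) :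
    aeval a (polyShift g) = aeval (a + 2) g := by
  change aeval a (aeval (Polynomial.X + 2) g) = _
  rw [← aeval_algHom_apply]
  simp [map_ofNat]

/-- The framework of `SlTwoDatum` for the enveloping algebra of `sl₂`. -/
def classical : SlTwoDatum ℚ ℚ[X] Env where
  num n := n
  num_zero := by simp
  num_one := by simp
  num_ne_zero n := by exact_mod_cast n.succ_ne_zero
  wt c := Polynomial.X + C (c : ℚ)
  wt_rel m t x := by
    simp only [smul_eq_C_mul]
    push_cast
    simp only [map_sub, map_add]
    ring
  shift := polyShift
  shift_wt c := by
    change polyShift (Polynomial.X + C (c : ℚ)) = Polynomial.X + C ((c + 2 : ℤ) : ℚ)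
    rw [map_add, ← algebraMap_eq, AlgEquiv.commutes, Int.cast_add, map_add, Int.cast_ofNat, map_ofNat]
    simp only [polyShift, AlgEquiv.ofAlgHom_apply, aeval_X]
    ring
  tor := aeval (UniversalEnvelopingAlgebra.ι ℚ H)
  e := UniversalEnvelopingAlgebra.ι ℚ X
  f := UniversalEnvelopingAlgebra.ι ℚ Y
  tor_mul_e g := by
    have h := env_bracket H X
    rw [bracket_H_X, env_map_smul] at h
    rw [aeval_polyShift]
    refine (aeval_semiconj ?_ g).symm
    rw [SemiconjBy, h, mul_add, two_smul, mul_two]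
  tor_mul_f g := by
    have h := env_bracket H Y
    rw [bracket_H_Y, env_map_smul] at h
    rw [aeval_polyShift]
    refine (aeval_semiconj ?_ g).symm
    rw [SemiconjBy, add_mul, h, neg_smul, two_smul, two_mul]
    abel
  e_mul_f := by rw [env_bracket, bracket_X_Y]; simp
  char μ := aeval (μ : ℚ)
  char_shift μ g := by
    rw [aeval_polyShift]
    simp
  char_wt μ c := by simp
  char_dense N g h := by
    refine Polynomial.eq_zero_of_infinite_isRoot g (Set.Infinite.mono ?_
      ((Set.Ici_infinite N).image (Nat.cast_injective (R := ℚ)).injOn))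
    rintro _ ⟨m, hm, rfl⟩
    simpa [Polynomial.aeval_def] using h m hm
  rep := classicalRep
  rep_e μ n := by rw [classicalRep_ι]; simp [vermaLie, X]
  rep_f μ n := by rw [classicalRep_ι]; simp [vermaLie, Y]
  rep_tor μ g n := by
    rw [← aeval_algHom_apply, classicalRep_ι]
    have h : vermaLie μ H = shiftOp id (fun n => ((μ - 2 * n : ℤ) : ℚ)) := by simp [vermaLie, H]
    rw [h]
    induction g using Polynomial.induction_on' with
    | add f g hf hg => rw [map_add, map_add, LinearMap.add_apply, hf, hg, add_smul]
    | monomial m r =>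
      rw [aeval_monomial, aeval_monomial, Module.End.mul_apply, Module.algebraMap_end_apply]
      have : ∀ m : ℕ, (shiftOp id (fun n => ((μ - 2 * n : ℤ) : ℚ)) ^ m) (Finsupp.single n 1) =
        ((μ - 2 * n : ℤ) : ℚ) ^ m • Finsupp.single n 1 := fun m => by
        induction m with
        | zero => simp
        | succ m ih => rw [pow_succ, Module.End.mul_apply, shiftOp_single, map_smul, id, ih, smul_smul, pow_succ']
      rw [this, smul_smul]
      rfl

lemma classical_num (n : ℤ) : classical.num n = n := rfl

lemma classical_wt (c : ℤ) : classical.wt c = Polynomial.X + C (c : ℚ) := rfl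

lemma classical_fact (n : ℕ) : classical.fact n = n.factorial := by
  rw [SlTwoDatum.fact, ← prod_range_add_one_eq_factorial]
  push_cast
  exact prod_congr rfl fun i _ => by rw [classical_num]; push_cast; rfl

lemma classical_dE (n : ℕ) : classical.dE n = divX n := by
  rw [SlTwoDatum.dE, classical_fact]; rfl

lemma classical_dF (n : ℕ) : classical.dF n = divY n := by
  rw [SlTwoDatum.dF, classical_fact]; rfl

lemma classical_tor_tb (m : ℕ) : classical.tor (classical.tb 0 m) = binomH m := by
  rw [SlTwoDatum.tb, map_smul, classical_fact, binomH]
  congr 1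
  induction m with
  | zero => simp
  | succ m ih =>
    rw [prod_range_succ, map_mul, ih, List.range_succ, List.map_append, List.prod_append,
      List.map_singleton, List.prod_singleton, classical_wt]
    congr 1
    simp [classical, sub_eq_add_neg]

lemma classical_tb_pascal (c : ℤ) (m : ℕ) :
    classical.tb (c + 1) (m + 1) = classical.tb c (m + 1) + classical.tb c m := by
  have h := classical.num_smul_tb_left c m
  have h' := classical.num_smul_tb_right c m
  refine smul_right_injective _ (classical.num_ne_zero m) ?_
  simp only [smul_add]
  rw [h, h', classical_wt, classical_wt, classical_num, smul_eq_C_mul]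
  push_cast
  simp only [map_add, map_sub]
  ring

lemma classical_bin_pascal (x : ℤ) (m : ℕ) :
    classical.bin (x + 1) (m + 1) = classical.bin x (m + 1) + classical.bin x m := by
  have h := congr_arg (classical.char 0) (classical_tb_pascal x m)
  rw [map_add] at h
  simpa only [SlTwoDatum.char_tb, zero_add] using h

lemma classical_bin_zero_succ (m : ℕ) : classical.bin 0 (m + 1) = 0 := by
  simpa using classical.bin_natCast_of_lt m.succ_pos

lemma classical_bin (x : ℤ) (m : ℕ) : classical.bin x m = Ring.choose x m := by
  induction m generalizing x with
  | zero => simp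
  | succ m ih =>
    induction x using Int.induction_on with
    | zero => rw [classical_bin_zero_succ, Ring.choose_zero_succ, Int.cast_zero]
    | succ x ih' => rw [classical_bin_pascal, Ring.choose_succ_succ, ih', ih, Int.cast_add, add_comm]
    | pred x ih' =>
      have h := classical_bin_pascal (-x - 1) m
      have h' := Ring.choose_succ_succ (-x - 1 : ℤ) m
      rw [sub_add_cancel] at h h'
      rw [ih', h', ih, Int.cast_add, add_comm] at h
      exact (add_right_cancel h).symm

/-- The integral form of the torus of the enveloping algebra: the integer-valued polynomials. -/
def intPoly : Subalgebra ℤ ℚ[X] :=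
  ⨅ n : ℤ, (⊥ : Subalgebra ℤ ℚ).comap ((classical.char n).restrictScalars ℤ)

lemma mem_intPoly {g : ℚ[X]} : g ∈ intPoly ↔ ∀ n : ℤ, ∃ z : ℤ, (z : ℚ) = classical.char n g := by
  simp [intPoly, Algebra.mem_iInf, Algebra.mem_bot]

lemma polyShift_symm_mem_intPoly {g : ℚ[X]} (hg : g ∈ intPoly) : polyShift.symm g ∈ intPoly := by
  rw [mem_intPoly] at hg ⊢
  intro n
  obtain ⟨z, hz⟩ := hg (n - 2)
  have h := classical.char_shift (n - 2) (polyShift.symm g)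
  rw [sub_add_cancel] at h
  refine ⟨z, hz.trans (Eq.trans ?_ h)⟩
  change _ = classical.char (n - 2) (polyShift (polyShift.symm g))
  rw [AlgEquiv.apply_symm_apply]

lemma classical_tb_mem_intPoly (c : ℤ) (m : ℕ) : classical.tb c m ∈ intPoly :=
  mem_intPoly.2 fun n => ⟨Ring.choose (n + c) m, by rw [SlTwoDatum.char_tb, classical_bin]⟩

lemma isIntegral_intPoly : classical.IsIntegral intPoly where
  bin_mem x m := ⟨Ring.choose x m, (classical_bin x m).symm⟩
  shift_symm_mem _ := polyShift_symm_mem_intPoly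
  tb_mem := classical_tb_mem_intPoly

lemma span_classical_tb : Submodule.span ℚ (Set.range (classical.tb 0)) = ⊤ := by
  set W := Submodule.span ℚ (Set.range (classical.tb 0)) with hW
  have h0 : ∀ c, classical.tb 0 c ∈ W := fun c => Submodule.subset_span ⟨c, rfl⟩
  have hX : ∀ f ∈ W, Polynomial.X * f ∈ W := by
    intro f hf
    induction hf using Submodule.span_induction with
    | mem f hf =>
      obtain ⟨c, rfl⟩ := hf
      have h := classical.num_smul_tb_right 0 c
      rw [classical_wt, zero_sub, Int.cast_neg, map_neg, ← sub_eq_add_neg, mul_sub, eq_sub_iff_add_eq] at h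
      rw [mul_comm, ← h, mul_comm, ← smul_eq_C_mul]
      exact W.add_mem (W.smul_mem _ (h0 _)) (W.smul_mem _ (h0 _))
    | zero => simp
    | add f g _ _ hf hg => rw [mul_add]; exact W.add_mem hf hg
    | smul c f _ hf => rw [mul_smul_comm]; exact W.smul_mem _ hf
  rw [eq_top_iff]
  rintro f -
  induction f using Polynomial.induction_on' with
  | add f g hf hg => exact W.add_mem hf hg
  | monomial n r =>
    rw [← C_mul_X_pow_eq_monomial, ← smul_eq_C_mul]
    refine W.smul_mem _ ?_
    induction n with
    | zero => simpa using h0 0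
    | succ n ih => rw [pow_succ']; exact hX _ ih

/-- Newton interpolation: the coefficients with respect to the polynomials `binom(T, c)` can be read off
successively from the values at `0, 1, 2, …`. -/
lemma classical_coeff_mem (M : Submodule ℤ ℚ) (x : ℕ →₀ ℚ)
    (h : ∀ n : ℕ, classical.char n (Finsupp.linearCombination ℚ (classical.tb 0) x) ∈ M) (n : ℕ) :
    x n ∈ M := by
  induction n using Nat.strong_induction_on with
  | _ n ih =>
    have h1 := h n
    rw [Finsupp.linearCombination_apply, Finsupp.sum_of_support_subset x
      (s := x.support ∪ {n}) subset_union_left _ (by simp), map_sum,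
      ← add_sum_erase _ _ (mem_union_right _ (mem_singleton_self n)), map_smul, SlTwoDatum.char_tb, add_zero,
      SlTwoDatum.bin_self, smul_eq_mul, mul_one,
      Submodule.add_mem_iff_left _ (Submodule.sum_mem _ fun c hc => ?_)] at h1
    · exact h1
    · rw [map_smul, SlTwoDatum.char_tb, add_zero]
      rcases lt_or_gt_of_ne (mem_erase.1 hc).1 with hcn | hcn
      · rw [classical_bin, smul_eq_mul, mul_comm, ← zsmul_eq_mul]
        exact M.smul_mem _ (ih c hcn)
      · rw [SlTwoDatum.bin_natCast_of_lt _ hcn, smul_zero]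
        exact M.zero_mem

lemma linearIndependent_classical_tb : LinearIndependent ℚ (classical.tb 0) := by
  rw [linearIndependent_iff]
  intro x hx
  ext p
  simpa using classical_coeff_mem ⊥ x (fun n => by rw [hx, map_zero]; exact Submodule.zero_mem _) p

lemma span_classical_tb_eq_intPoly :
    Submodule.span ℤ (Set.range (classical.tb 0)) = intPoly.toSubmodule := by
  apply le_antisymm
  · rw [Submodule.span_le]
    rintro _ ⟨c, rfl⟩
    exact classical_tb_mem_intPoly 0 c
  · intro g hg
    have h : g ∈ Submodule.span ℚ (Set.range (classical.tb 0)) := by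
      rw [span_classical_tb]; trivial
    obtain ⟨x, rfl⟩ := Finsupp.mem_span_range_iff_exists_finsupp.1 h
    have hx := classical_coeff_mem (1 : Submodule ℤ ℚ) x (fun n => by
      obtain ⟨z, hz⟩ := mem_intPoly.1 hg n
      exact Submodule.mem_one.2 ⟨z, hz⟩)
    refine Submodule.sum_mem _ fun p _ => ?_
    obtain ⟨r, hr⟩ := Submodule.mem_one.1 (hx p)
    change x p • _ ∈ _
    rw [← hr, algebraMap_smul]
    exact Submodule.smul_mem _ _ (Submodule.subset_span ⟨p, rfl⟩)

lemma classical_tor_tb_mem (c : ℤ) (m : ℕ) : classical.tor (classical.tb c m) ∈ Kostant :=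
  classical.tor_tb_mem (fun n => by rw [classical_dE]; exact divX_mem n)
    (fun n => by rw [classical_dF]; exact divY_mem n)
    (fun c m => ⟨1, 1, by rw [map_one]; exact Kostant.one_mem, by
      rw [classical_tb_pascal, Units.val_one, one_smul, one_mul]⟩) c m

lemma binomH_mem (m : ℕ) : binomH m ∈ Kostant := by
  rw [← classical_tor_tb]; exact classical_tor_tb_mem 0 m

lemma Kostant_toSubmodule : Kostant.toSubmodule = classical.form intPoly := by
  refine isIntegral_intPoly.toSubmodule_eq_form ?_ (fun n => by rw [classical_dE]; exact divX_mem n)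
    (fun n => by rw [classical_dF]; exact divY_mem n) (fun g hg => ?_)
  · rintro x (⟨n, rfl⟩ | ⟨n, rfl⟩)
    · rw [← classical_dE]
      simpa using SlTwoDatum.dF_tor_dE_mem_form (D := classical) 0 n intPoly.one_mem
    · rw [← classical_dF]
      simpa using SlTwoDatum.dF_tor_dE_mem_form (D := classical) n 0 intPoly.one_mem
  · have hg' : g ∈ Submodule.span ℤ (Set.range (classical.tb 0)) := by
      rw [span_classical_tb_eq_intPoly]; exact hg
    clear hg
    induction hg' using Submodule.span_induction with
    | mem g hg => obtain ⟨c, rfl⟩ := hg; exact classical_tor_tb_mem _ _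
    | zero => rw [map_zero]; exact Kostant.zero_mem
    | add f g _ _ hf hg => rw [map_add]; exact Kostant.add_mem hf hg
    | smul r f _ hf => rw [map_zsmul]; exact Kostant.smul_mem hf r

/-- The Poincaré–Birkhoff–Witt basis of the Kostant form. -/
theorem exists_basis_Kostant : ∃ b : Module.Basis ((ℕ × ℕ) × ℕ) ℤ Kostant,
    ∀ p, (b p : Env) = divY p.1.1 * binomH p.2 * divX p.1.2 := by
  obtain ⟨b, hb⟩ := SlTwoDatum.exists_basis_of_toSubmodule_eq_form (D := classical) (P := intPoly)
    Kostant_toSubmodule linearIndependent_classical_tb span_classical_tb_eq_intPoly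
  exact ⟨b, fun p => by rw [hb, classical_dE, classical_dF, classical_tor_tb]⟩

end

/-! ### Lucas' theorem at a root of unity -/

/-- The homogeneous factorization of `xⁿ - yⁿ` by a primitive root of unity. -/
lemma prod_range_sub_pow_mul {R : Type*} [CommRing R] [IsDomain R] {ζ : R} {n : ℕ} (hn : 0 < n)
    (h : IsPrimitiveRoot ζ n) (x y : R) : ∏ i ∈ range n, (x - ζ ^ i * y) = x ^ n - y ^ n := by
  classical
  rw [h.pow_sub_pow_eq_prod_sub_mul x y hn]
  have : Polynomial.nthRootsFinset n (1 : R) = (range n).image (ζ ^ ·) := by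
    symm
    refine eq_of_subset_of_card_le ?_ ?_
    · intro z hz
      obtain ⟨i, -, rfl⟩ := mem_image.1 hz
      rw [Polynomial.mem_nthRootsFinset hn, ← pow_mul, mul_comm, pow_mul, h.pow_eq_one, one_pow]
    · rw [h.card_nthRootsFinset, card_image_of_injOn h.injOn_pow, card_range]
  rw [this, prod_image fun i hi j hj hij => h.injOn_pow hi hj hij]

section Lucas

variable {R : Type*} [CommRing R] [IsDomain R] {l : ℕ} {q : Rˣ} {b : ℤ → ℕ → R}

/-- The generating functions `G_x(z) = ∑ₐ [x, a] zᵃ` of quantum binomial coefficients satisfy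
`G_{x + n}(z) = ∏ᵢ (1 + q^{x + n - 1 - 2i} z) G_x(q⁻ⁿ z)`. -/
lemma mk_add_natCast_eq (hb0 : ∀ x, b x 0 = 1)
    (hb : ∀ x m, b (x + 1) (m + 1) =
      (q ^ (-(m + 1) : ℤ) : Rˣ) * b x (m + 1) + (q ^ (x - m) : Rˣ) * b x m) (x : ℤ) (n : ℕ) :
    PowerSeries.mk (b (x + n)) =
      (∏ i ∈ range n, (1 + PowerSeries.C ((q ^ (x + n - 1 - 2 * i) : Rˣ) : R) * PowerSeries.X)) *
        PowerSeries.rescale ((q ^ (-n : ℤ) : Rˣ) : R) (PowerSeries.mk (b x)) := by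
  induction n with
  | zero => simp
  | succ n ih =>
    have h1 : PowerSeries.mk (b (x + n + 1)) =
        (1 + PowerSeries.C ((q ^ (x + n) : Rˣ) : R) * PowerSeries.X) *
          PowerSeries.rescale ((q⁻¹ : Rˣ) : R) (PowerSeries.mk (b (x + n))) := by
      ext m
      rw [add_mul, one_mul, mul_assoc, map_add, PowerSeries.coeff_C_mul]
      rcases m with _ | m
      · simp [hb0]
      · rw [PowerSeries.coeff_succ_X_mul, PowerSeries.coeff_rescale, PowerSeries.coeff_rescale,
          PowerSeries.coeff_mk, PowerSeries.coeff_mk, PowerSeries.coeff_mk, hb, ← mul_assoc,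
          ← Units.val_pow_eq_pow_val, ← Units.val_pow_eq_pow_val, ← Units.val_mul, inv_pow, inv_pow,
          ← zpow_natCast, ← zpow_natCast, ← zpow_neg, ← zpow_neg, ← zpow_add, Nat.cast_succ,
          ← sub_eq_add_neg]
    have hr : ∀ c d : R, ∀ f : PowerSeries R,
        PowerSeries.rescale c (PowerSeries.rescale d f) = PowerSeries.rescale (c * d) f := by
      intro c d f
      ext m
      simp only [PowerSeries.coeff_rescale, mul_pow, mul_assoc]
    have hC : ∀ c d : R, PowerSeries.rescale c (PowerSeries.C d) = PowerSeries.C d := by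
      intro c d
      ext m
      rw [PowerSeries.coeff_rescale, PowerSeries.coeff_C]
      split_ifs with h
      · rw [h, pow_zero, one_mul]
      · rw [mul_zero]
    have h2 : ∀ i : ℕ, PowerSeries.rescale ((q⁻¹ : Rˣ) : R)
        (1 + PowerSeries.C ((q ^ (x + n - 1 - 2 * i) : Rˣ) : R) * PowerSeries.X) =
        1 + PowerSeries.C ((q ^ (x + n + 1 - 1 - 2 * (i + 1 : ℕ)) : Rˣ) : R) * PowerSeries.X := by
      intro i
      rw [map_add, map_one, map_mul, PowerSeries.rescale_X, ← mul_assoc, hC, ← map_mul, ← Units.val_mul,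
        ← zpow_sub_one]
      congr 5
      push_cast
      ring
    rw [Nat.cast_succ, ← add_assoc, h1, ih, map_mul, hr, map_prod, prod_congr rfl fun i _ => h2 i,
      prod_range_succ', ← mul_assoc, mul_comm (1 + _), ← Units.val_mul, ← zpow_neg_one, ← zpow_add,
      neg_add_rev, Nat.cast_zero, mul_zero, sub_zero, add_sub_cancel_right]

/-- Quantum binomial coefficients at a primitive root of unity of odd order `l`: the product of the
factors `1 + q^{x + l - 1 - 2i} z` is `1 + zˡ`. -/
lemma bin_add_order (hl : Odd l) (hq : IsPrimitiveRoot (q : R) l) (hb0 : ∀ x, b x 0 = 1)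
    (hb : ∀ x m, b (x + 1) (m + 1) =
      (q ^ (-(m + 1) : ℤ) : Rˣ) * b x (m + 1) + (q ^ (x - m) : Rˣ) * b x m) (x : ℤ) (m : ℕ) :
    b (x + l) m = b x m + if l ≤ m then b x (m - l) else 0 := by
  have hqu : IsPrimitiveRoot q l := IsPrimitiveRoot.coe_units_iff.1 hq
  have h := mk_add_natCast_eq hb0 hb x l
  have hζ : IsPrimitiveRoot (PowerSeries.C ((q ^ (-2 : ℤ) : Rˣ) : R)) l := by
    refine IsPrimitiveRoot.map_of_injective (f := PowerSeries.C) ?_ PowerSeries.C_injective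
    rw [IsPrimitiveRoot.coe_units_iff, zpow_neg]
    exact (hqu.pow_of_coprime 2 hl.coprime_two_left).inv
  have hprod := prod_range_sub_pow_mul hl.pos hζ 1
    (-(PowerSeries.C ((q ^ (x + l - 1) : Rˣ) : R) * PowerSeries.X))
  rw [prod_congr rfl (g := fun i : ℕ => 1 + PowerSeries.C ((q ^ (x + l - 1 - 2 * i) : Rˣ) : R) * PowerSeries.X)
    fun i _ => by
      rw [mul_neg, sub_neg_eq_add, ← mul_assoc, ← map_pow, ← map_mul, ← Units.val_pow_eq_pow_val,
        ← Units.val_mul, ← zpow_natCast, ← zpow_mul, ← zpow_add]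
      congr 5
      ring] at hprod
  have hone : ∀ y : ℤ, q ^ (y * l) = 1 := fun y => by
    rw [mul_comm, zpow_mul, zpow_natCast, hqu.pow_eq_one, one_zpow]
  rw [hprod, one_pow, hl.neg_pow, sub_neg_eq_add, mul_pow, ← map_pow, ← Units.val_pow_eq_pow_val,
    ← zpow_natCast (q ^ (x + l - 1)), ← zpow_mul, hone, Units.val_one, map_one, one_mul,
    show (-l : ℤ) = -1 * l by ring, hone, Units.val_one, PowerSeries.rescale_one, RingHom.id_apply,
    add_mul, one_mul] at h
  simpa [PowerSeries.coeff_X_pow_mul'] using congr_arg (PowerSeries.coeff m) h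

/-- Lucas' theorem: `[l x, m] = binom(x, m / l)` if `l ∣ m`, and `[l x, m] = 0` otherwise. -/
theorem bin_order_mul (hl : Odd l) (hq : IsPrimitiveRoot (q : R) l) (hb0 : ∀ x, b x 0 = 1)
    (hb0' : ∀ m, b 0 (m + 1) = 0) (hb : ∀ x m, b (x + 1) (m + 1) =
      (q ^ (-(m + 1) : ℤ) : Rˣ) * b x (m + 1) + (q ^ (x - m) : Rˣ) * b x m) (x : ℤ) (m : ℕ) :
    b (l * x) m = if l ∣ m then ((Ring.choose x (m / l) : ℤ) : R) else 0 := by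
  set c : ℤ → ℕ → R := fun x m => if l ∣ m then ((Ring.choose x (m / l) : ℤ) : R) else 0 with hc
  have hc1 : ∀ x m, c (x + 1) m = c x m + if l ≤ m then c x (m - l) else 0 := by
    intro x m
    by_cases hm : l ∣ m
    · obtain ⟨s, rfl⟩ := hm
      rcases s with _ | s
      · simp [hc, hl.pos.ne']
      · have h1 : l * (s + 1) - l = l * s := by rw [mul_add, mul_one, Nat.add_sub_cancel]
        rw [if_pos (Nat.le_mul_of_pos_right l s.succ_pos), h1]
        simp only [hc, dvd_mul_right, if_true, Nat.mul_div_cancel_left _ hl.pos]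
        rw [Ring.choose_succ_succ, Int.cast_add, add_comm]
    · by_cases hlm : l ≤ m
      · have : ¬ l ∣ m - l := fun h => hm ((Nat.dvd_sub_iff_left hlm dvd_rfl).1 h)
        simp [hc, hm, this]
      · simp [hc, hm, hlm]
  have hb1 : ∀ x m, b (l * (x + 1)) m = b (l * x) m + if l ≤ m then b (l * x) (m - l) else 0 := by
    intro x m
    rw [mul_add, mul_one, bin_add_order hl hq hb0 hb]
  have h00 : ∀ m, b (l * 0) m = c 0 m := by
    intro m
    rcases m with _ | m
    · simp [hc, hb0]
    · rw [mul_zero, hb0']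
      simp only [hc]
      split_ifs with h
      · obtain ⟨s, hs⟩ := h
        rcases s with _ | s
        · omega
        · rw [hs, Nat.mul_div_cancel_left _ hl.pos, Ring.choose_zero_succ, Int.cast_zero]
      · rfl
  change _ = c x m
  induction m using Nat.strong_induction_on generalizing x with
  | _ m ih =>
    have hih : ∀ x, (if l ≤ m then b (l * x) (m - l) else 0) = if l ≤ m then c x (m - l) else 0 := by
      intro x
      split_ifs with h
      · exact ih _ (by have := hl.pos; omega) x
      · rfl
    induction x using Int.induction_on with
    | zero => exact h00 m
    | succ x ih' => rw [hb1, hc1, ih', hih]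
    | pred x ih' =>
      have h1 := hb1 (-x - 1) m
      have h2 := hc1 (-x - 1) m
      rw [sub_add_cancel] at h1 h2
      rw [h1, h2, hih] at ih'
      exact add_right_cancel ih'

end Lucas

/-! ### The ring `ℬ` -/

section RingB

variable (l : ℕ) [NeZero l]

lemma coe_q : (q l : B l) = root l := rfl

instance : CharZero ZHalf := by
  have h2 : Submonoid.powers (2 : ℤ) ≤ nonZeroDivisors ℤ :=
    powers_le_nonZeroDivisors_of_noZeroDivisors (by norm_num)
  exact charZero_of_injective_algebraMap (R := ℤ) (IsLocalization.injective ZHalf h2)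

instance : IsDomain ZHalf :=
  IsLocalization.isDomain_localization
    (powers_le_nonZeroDivisors_of_noZeroDivisors (by norm_num) : Submonoid.powers (2 : ℤ) ≤ _)

instance : CharZero (B l) := by
  refine charZero_of_injective_ringHom
    (AdjoinRoot.of.injective_of_degree_ne_zero (f := Polynomial.cyclotomic l ZHalf) ?_)
  rw [Polynomial.degree_cyclotomic]
  exact_mod_cast (Nat.totient_pos.2 (NeZero.pos l)).ne'

lemma isPrimitiveRoot_q : IsPrimitiveRoot (q l : B l) l := by
  have : NeZero (l : B l) := ⟨Nat.cast_ne_zero.2 (NeZero.ne l)⟩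
  rw [← Polynomial.isRoot_cyclotomic_iff, coe_q]
  have h := AdjoinRoot.isRoot_root (Polynomial.cyclotomic l ZHalf)
  rwa [Polynomial.map_cyclotomic] at h

lemma q_zpow_eq_one_iff (n : ℤ) : q l ^ n = 1 ↔ (l : ℤ) ∣ n :=
  (IsPrimitiveRoot.coe_units_iff.1 (isPrimitiveRoot_q l)).zpow_eq_one_iff_dvd n

lemma algebraMap_vA_zpow (n : ℤ) :
    algebraMap A (B l) ((vA ^ n : Aˣ) : A) = ((q l ^ n : (B l)ˣ) : B l) := by
  have h : ((vA ^ n : Aˣ) : A) = LaurentPolynomial.T n := by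
    induction n using Int.induction_on with
    | zero => simp
    | succ n ih => rw [zpow_add_one, Units.val_mul, ih, LaurentPolynomial.T_add]; rfl
    | pred n ih => rw [zpow_sub_one, Units.val_mul, ih, sub_eq_add_neg, LaurentPolynomial.T_add]; rfl
  rw [h]
  exact LaurentPolynomial.eval₂_T _ _ _

lemma half_mul_two : half l * 2 = 1 := by
  have h := congr_arg (algebraMap ZHalf (B l)) (IsLocalization.Away.mul_invSelf (S := ZHalf) (2 : ℤ))
  rw [map_mul, map_one, map_ofNat, map_ofNat, mul_comm] at h
  exact h

/-- The quantum binomial coefficient `[x, m]`, as an element of `𝒜`. -/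
def binA (x : ℤ) (m : ℕ) : A := (isIntegral_torusA.bin_mem x m).choose

lemma algebraMap_binA (x : ℤ) (m : ℕ) : algebraMap A Qv (binA x m) = quantum.bin x m :=
  (isIntegral_torusA.bin_mem x m).choose_spec

/-- Lucas' theorem for the quantum binomial coefficients in `ℬ`. -/
theorem algebraMap_binA_mul (hodd : Odd l) (x : ℤ) (m : ℕ) :
    algebraMap A (B l) (binA (l * x) m) =
      if l ∣ m then ((Ring.choose x (m / l) : ℤ) : B l) else 0 := by
  refine bin_order_mul (b := fun x m => algebraMap A (B l) (binA x m)) hodd (isPrimitiveRoot_q l)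
    (fun x => ?_) (fun m => ?_) (fun x m => ?_) x m
  · have : binA x 0 = 1 := algebraMap_A_Qv_injective (by rw [algebraMap_binA]; simp)
    simp [this]
  · have : binA 0 (m + 1) = 0 := algebraMap_A_Qv_injective (by
      rw [algebraMap_binA, map_zero]
      simpa using quantum.bin_natCast_of_lt m.succ_pos)
    simp [this]
  · have : binA (x + 1) (m + 1) = ((vA ^ (-(m + 1) : ℤ) : Aˣ) : A) * binA x (m + 1) +
        ((vA ^ (x - m) : Aˣ) : A) * binA x m := algebraMap_A_Qv_injective (by
      rw [map_add, map_mul, map_mul, algebraMap_binA, algebraMap_binA, algebraMap_binA,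
        quantumTriple.bin_pascal, coe_vUnit_zpow_eq_algebraMap, coe_vUnit_zpow_eq_algebraMap])
    simp only [this, map_add, map_mul, algebraMap_vA_zpow]

end RingB

/-! ### The quantum Frobenius morphism -/

/-- Combinations of the functions `μ ↦ binom(μ, c)` that vanish at all large integers have zero
coefficients. -/
lemma eq_zero_of_sum_choose {S : Type*} [CommRing S] [IsDomain S] [CharZero S] (s : Finset ℕ)
    (x : ℕ → S) (N : ℕ)
    (h : ∀ μ : ℕ, N ≤ μ → ∑ c ∈ s, x c * ((Ring.choose (μ : ℤ) c : ℤ) : S) = 0) : ∀ c ∈ s, x c = 0 := by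
  set L := FractionRing S
  have : CharZero L := charZero_of_injective_algebraMap (IsFractionRing.injective S L)
  let g : Polynomial L :=
    ∑ c ∈ s, Polynomial.C (algebraMap S L (x c)) * (classical.tb 0 c).map (algebraMap ℚ L)
  have hg : ∀ μ : ℤ, g.eval (μ : L) =
      algebraMap S L (∑ c ∈ s, x c * ((Ring.choose μ c : ℤ) : S)) := by
    intro μ
    have h1 : ∀ c, (classical.tb 0 c).eval (μ : ℚ) = Ring.choose μ c := fun c => by
      rw [← classical_bin, ← add_zero μ, ← SlTwoDatum.char_tb, add_zero]
      exact (congr_fun (Polynomial.coe_aeval_eq_eval (μ : ℚ)) _).symm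
    simp only [g, Polynomial.eval_finsetSum, Polynomial.eval_mul, Polynomial.eval_C,
      Polynomial.eval_intCast_map, h1, map_sum, map_mul, map_intCast]
  have hg0 : g = 0 := by
    refine Polynomial.eq_zero_of_infinite_isRoot g (Set.Infinite.mono ?_
      ((Set.Ici_infinite N).image (Nat.cast_injective (R := L)).injOn))
    rintro _ ⟨m, hm, rfl⟩
    have h1 := hg m
    rw [h m hm, map_zero, Int.cast_natCast] at h1
    exact h1
  have h' : ∀ μ : ℤ, ∑ c ∈ s, x c * ((Ring.choose μ c : ℤ) : S) = 0 := fun μ => by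
    have h1 := hg μ
    rw [hg0, Polynomial.eval_zero] at h1
    exact IsFractionRing.injective S L (by rw [← h1, map_zero])
  intro c
  induction c using Nat.strong_induction_on with
  | _ c ih =>
    intro hc
    have h1 := h' c
    rw [sum_eq_single_of_mem c hc] at h1
    · simpa [Ring.choose_natCast] using h1
    · intro c' hc' hne
      rcases lt_or_gt_of_ne hne with hlt | hlt
      · rw [ih c' hlt hc', zero_mul]
      · rw [Ring.choose_natCast, Nat.choose_eq_zero_of_lt hlt]; simp

section Frobenius

variable (l : ℕ) [NeZero l]

lemma adjoin_UB : Algebra.adjoin (B l) (Set.range (fun n => toUB l (divE n) (divE_mem n)) ∪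
    Set.range (fun n => toUB l (divF n) (divF_mem n)) ∪
    {toUB l (stdGen .K) K_mem, toUB l (stdGen .Kinv) Kinv_mem}) = ⊤ := by
  have h : Algebra.adjoin A ((fun x : U => (x : UQv)) ⁻¹'
      (Set.range divE ∪ Set.range divF ∪ {stdGen .K, stdGen .Kinv})) = ⊤ :=
    Algebra.adjoin_adjoin_coe_preimage
  refine Eq.trans ?_ (Algebra.TensorProduct.adjoin_one_tmul_image_eq_top (A := B l) _ h)
  congr 1
  ext z
  constructor
  · rintro ((⟨n, rfl⟩ | ⟨n, rfl⟩) | rfl | rfl)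
    · exact ⟨⟨divE n, divE_mem n⟩, Or.inl (Or.inl ⟨n, rfl⟩), rfl⟩
    · exact ⟨⟨divF n, divF_mem n⟩, Or.inl (Or.inr ⟨n, rfl⟩), rfl⟩
    · exact ⟨⟨stdGen .K, K_mem⟩, Or.inr (Or.inl rfl), rfl⟩
    · exact ⟨⟨stdGen .Kinv, Kinv_mem⟩, Or.inr (Or.inr rfl), rfl⟩
  · rintro ⟨⟨x, hx⟩, (⟨n, rfl⟩ | ⟨n, rfl⟩) | rfl | rfl, rfl⟩
    · exact Or.inl (Or.inl ⟨n, rfl⟩)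
    · exact Or.inl (Or.inr ⟨n, rfl⟩)
    · exact Or.inr (Or.inl rfl)
    · exact Or.inr (Or.inr rfl)

lemma adjoin_KostantB : Algebra.adjoin (B l) (Set.range (fun n => toKostantB l (divX n) (divX_mem n)) ∪
    Set.range (fun n => toKostantB l (divY n) (divY_mem n))) = ⊤ := by
  have h : Algebra.adjoin ℤ ((fun x : Kostant => (x : Env)) ⁻¹' (Set.range divX ∪ Set.range divY)) = ⊤ :=
    Algebra.adjoin_adjoin_coe_preimage
  refine Eq.trans ?_ (Algebra.TensorProduct.adjoin_one_tmul_image_eq_top (A := B l) _ h)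
  congr 1
  ext z
  constructor
  · rintro (⟨n, rfl⟩ | ⟨n, rfl⟩)
    · exact ⟨⟨divX n, divX_mem n⟩, Or.inl ⟨n, rfl⟩, rfl⟩
    · exact ⟨⟨divY n, divY_mem n⟩, Or.inr ⟨n, rfl⟩, rfl⟩
  · rintro ⟨⟨x, hx⟩, ⟨n, rfl⟩ | ⟨n, rfl⟩, rfl⟩
    · exact Or.inl ⟨n, rfl⟩
    · exact Or.inr ⟨n, rfl⟩

lemma IsFrobenius.unique {Fr Fr' : UB l →ₐ[B l] KostantB l} (h : IsFrobenius l Fr)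
    (h' : IsFrobenius l Fr') : Fr' = Fr := by
  refine AlgHom.ext_of_adjoin_eq_top (adjoin_UB l) ?_
  rintro _ ((⟨n, rfl⟩ | ⟨n, rfl⟩) | rfl | rfl)
  · exact (h'.map_divE n).trans (h.map_divE n).symm
  · exact (h'.map_divF n).trans (h.map_divF n).symm
  · exact h'.map_K.trans h.map_K.symm
  · exact h'.map_Kinv.trans h.map_Kinv.symm

/-- The action of `𝐔_ℬ` on the dual Verma module of highest weight `μ`. -/
lemma exists_rep_KostantB (μ : ℤ) : ∃ σ : KostantB l →ₐ[B l] Module.End (B l) (ℕ →₀ B l),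
    (∀ b n, σ (toKostantB l (divX b) (divX_mem b)) (Finsupp.single n 1) =
      ((Ring.choose (n : ℤ) b : ℤ) : B l) • Finsupp.single (n - b) 1) ∧
    (∀ a n, σ (toKostantB l (divY a) (divY_mem a)) (Finsupp.single n 1) =
      ((Ring.choose (μ - n) a : ℤ) : B l) • Finsupp.single (n + a) 1) ∧
    ∀ c n, σ (toKostantB l (binomH c) (binomH_mem c)) (Finsupp.single n 1) =
      ((Ring.choose (μ - 2 * n) c : ℤ) : B l) • Finsupp.single n 1 := by
  obtain ⟨σ, hσ⟩ := isIntegral_intPoly.exists_rep Kostant_toSubmodule μ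
    (fun g hg n => mem_intPoly.1 hg (μ - 2 * n)) (B l)
  refine ⟨σ, fun b n => hσ ⟨divX b, divX_mem b⟩ n _ _ ?_, fun a n => hσ ⟨divY a, divY_mem a⟩ n _ _ ?_,
    fun c n => hσ ⟨binomH c, binomH_mem c⟩ n _ _ ?_⟩
  · dsimp only
    rw [← classical_dE, SlTwoDatum.rep_dE, classical_bin]; rfl
  · dsimp only
    rw [← classical_dF, SlTwoDatum.rep_dF, classical_bin]; rfl
  · dsimp only
    rw [← classical_tor_tb, SlTwoDatum.rep_tor, SlTwoDatum.char_tb, add_zero, classical_bin]; rfl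

/-- The action of `U_ℬ` on the dual Verma module of highest weight `l μ`: on the vectors `e_{l n}` it is
given by classical binomial coefficients, by Lucas' theorem. -/
lemma exists_rep_UB (hodd : Odd l) (μ : ℤ) : ∃ ρ : UB l →ₐ[B l] Module.End (B l) (ℕ →₀ B l),
    (∀ b n, ρ (toUB l (divE b) (divE_mem b)) (Finsupp.single (l * n) 1) =
      (if l ∣ b then ((Ring.choose (n : ℤ) (b / l) : ℤ) : B l) else 0) •
        Finsupp.single (l * n - b) 1) ∧
    (∀ a n, ρ (toUB l (divF a) (divF_mem a)) (Finsupp.single (l * n) 1) =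
      (if l ∣ a then ((Ring.choose (μ - n) (a / l) : ℤ) : B l) else 0) •
        Finsupp.single (l * n + a) 1) ∧
    (∀ c n, ρ (toUB l (torusBinom 0 c) (torusBinom_mem 0 c)) (Finsupp.single (l * n) 1) =
      (if l ∣ c then ((Ring.choose (μ - 2 * n) (c / l) : ℤ) : B l) else 0) •
        Finsupp.single (l * n) 1) ∧
    (∀ n, ρ (toUB l (stdGen .K) K_mem) (Finsupp.single (l * n) 1) = Finsupp.single (l * n) 1) ∧
    ∀ n, ρ (toUB l (stdGen .Kinv) Kinv_mem) (Finsupp.single (l * n) 1) = Finsupp.single (l * n) 1 := by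
  have hchar : ∀ (m : ℤ) (i : ℤ), quantum.char m (LaurentPolynomial.T i) =
      algebraMap A Qv ((vA ^ (m * i) : Aˣ) : A) := fun m i => by
    rw [← coe_vUnit_zpow_eq_algebraMap, zpow_mul]
    exact laurentHom_T _ _
  have hq : ∀ (n : ℕ) (i : ℤ), q l ^ ((l * μ - 2 * (l * n : ℕ)) * i) = 1 := fun n i => by
    rw [q_zpow_eq_one_iff]
    exact Dvd.dvd.mul_right ⟨μ - 2 * n, by push_cast; ring⟩ _
  obtain ⟨ρ, hρ⟩ := isIntegral_torusA.exists_rep U_toSubmodule (l * μ) (fun g hg n => by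
    have h := mem_intTorus.1 hg (l * μ - 2 * n)
    obtain ⟨a, ha⟩ := Submodule.mem_one.1 h.1
    obtain ⟨b, hb⟩ := Submodule.mem_one.1 h.2
    refine ⟨a + b, ?_⟩
    rw [map_add, ha, hb]
    exact omegaToOne_signedEval _ _ _) (B l)
  refine ⟨ρ, fun b n => ?_, fun a n => ?_, fun c n => ?_, fun n => ?_, fun n => ?_⟩
  · rw [← algebraMap_binA_mul l hodd]
    refine hρ ⟨divE b, divE_mem b⟩ _ _ _ ?_
    dsimp only
    rw [algebraMap_binA, ← quantum_dE, SlTwoDatum.rep_dE, Nat.cast_mul]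
  · rw [← algebraMap_binA_mul l hodd]
    refine hρ ⟨divF a, divF_mem a⟩ _ _ _ ?_
    dsimp only
    rw [algebraMap_binA, ← quantum_dF, SlTwoDatum.rep_dF, Nat.cast_mul, mul_sub]
  · rw [← algebraMap_binA_mul l hodd]
    refine hρ ⟨torusBinom 0 c, torusBinom_mem 0 c⟩ _ _ _ ?_
    dsimp only
    rw [algebraMap_binA, ← quantum_tor_tb, SlTwoDatum.rep_tor, SlTwoDatum.char_tb, Nat.cast_mul, add_zero]
    congr 2
    ring
  · have := hρ ⟨stdGen .K, K_mem⟩ (l * n) (l * n) ((vA ^ ((l * μ - 2 * (l * n : ℕ)) * 1) : Aˣ) : A) (by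
      dsimp only
      rw [← quantum_tor_T_one, SlTwoDatum.rep_tor, hchar])
    rwa [algebraMap_vA_zpow, hq, Units.val_one, one_smul] at this
  · have := hρ ⟨stdGen .Kinv, Kinv_mem⟩ (l * n) (l * n) ((vA ^ ((l * μ - 2 * (l * n : ℕ)) * (-1)) : Aˣ) : A) (by
      dsimp only
      rw [← quantum_tor_T_neg_one, SlTwoDatum.rep_tor, hchar])
    rwa [algebraMap_vA_zpow, hq, Units.val_one, one_smul] at this

/-- The basis `Y^{[a]} binom(H, c) X^{[b]}` of `𝐔_ℬ`. -/
def basisKostantB : Module.Basis ((ℕ × ℕ) × ℕ) (B l) (KostantB l) :=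
  Algebra.TensorProduct.basis (B l) exists_basis_Kostant.choose

lemma basisKostantB_apply (p : (ℕ × ℕ) × ℕ) : basisKostantB l p =
    toKostantB l (divY p.1.1) (divY_mem _) * toKostantB l (binomH p.2) (binomH_mem _) *
      toKostantB l (divX p.1.2) (divX_mem _) := by
  rw [basisKostantB, Algebra.TensorProduct.basis_apply, toKostantB, toKostantB, toKostantB,
    Algebra.TensorProduct.tmul_mul_tmul, Algebra.TensorProduct.tmul_mul_tmul, mul_one, mul_one]
  congr 1
  exact Subtype.ext (exists_basis_Kostant.choose_spec p)

/-- `𝐔_ℬ` acts faithfully on the sum of all dual Verma modules. -/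
lemma KostantB_faithful (σ : ℤ → KostantB l →ₐ[B l] Module.End (B l) (ℕ →₀ B l))
    (hX : ∀ μ b n, σ μ (toKostantB l (divX b) (divX_mem b)) (Finsupp.single n 1) =
      ((Ring.choose (n : ℤ) b : ℤ) : B l) • Finsupp.single (n - b) 1)
    (hY : ∀ μ a n, σ μ (toKostantB l (divY a) (divY_mem a)) (Finsupp.single n 1) =
      ((Ring.choose (μ - n) a : ℤ) : B l) • Finsupp.single (n + a) 1)
    (hH : ∀ μ c n, σ μ (toKostantB l (binomH c) (binomH_mem c)) (Finsupp.single n 1) =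
      ((Ring.choose (μ - 2 * n) c : ℤ) : B l) • Finsupp.single n 1)
    (k : KostantB l) (hk : ∀ μ n, σ μ k (Finsupp.single n 1) = 0) : k = 0 := by
  set x := (basisKostantB l).repr k with hx
  set s := x.support.image Prod.fst
  set s' := x.support.image Prod.snd
  have hkx : k = ∑ p ∈ s, ∑ c ∈ s', x (p, c) • basisKostantB l (p, c) := by
    conv_lhs => rw [← (basisKostantB l).linearCombination_repr k]
    rw [Finsupp.linearCombination_apply, ← sum_product', Finsupp.sum_of_support_subset _
      (s := s ×ˢ s') ?_ _ (by simp)]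
    intro p hp
    exact mem_product.2 ⟨mem_image_of_mem _ hp, mem_image_of_mem _ hp⟩
  have key := coeff_eq_zero_of_verma_action s
    (fun p μ => ∑ c ∈ s', x (p, c) * ((Ring.choose μ c : ℤ) : B l))
    (fun μ c => ((Ring.choose μ c : ℤ) : B l))
    (fun n b h => by rw [Ring.choose_natCast, Nat.choose_eq_zero_of_lt h]; simp)
    (fun n => by rw [Ring.choose_natCast]; simp)
    (fun p _ h μ => by
      refine sum_eq_zero fun c hc => ?_
      rw [eq_zero_of_sum_choose s' (fun c => x (p, c)) p.1 (fun μ hμ => ?_) c hc, zero_mul]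
      refine (mul_eq_zero.1 (h μ hμ)).resolve_right ?_
      rw [Ring.choose_natCast, Int.cast_natCast]
      exact Nat.cast_ne_zero.2 (Nat.choose_pos hμ).ne')
    (fun μ n => by
      have h := hk μ n
      rw [hkx, map_sum, LinearMap.sum_apply] at h
      rw [← h]
      refine sum_congr rfl fun p _ => ?_
      rw [map_sum, LinearMap.sum_apply, mul_sum, sum_mul, sum_smul]
      refine sum_congr rfl fun c _ => ?_
      rw [map_smul, LinearMap.smul_apply, basisKostantB_apply, map_mul, map_mul, Module.End.mul_apply, hX,
        map_smul, Module.End.mul_apply, hH, map_smul, hY, smul_smul, smul_smul, smul_smul]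
      congr 1
      ring)
  rw [hkx]
  refine sum_eq_zero fun p hp => sum_eq_zero fun c hc => ?_
  rw [eq_zero_of_sum_choose s' (fun c => x (p, c)) 0 (fun μ _ => key p hp μ) c hc, zero_smul]

/-- The quantum Frobenius morphism. An element `u` of `U_ℬ` and its image `k` act in the same way, `u` on
the vectors `e_{l n}` of the modules of highest weight `l μ`, and `k` on the vectors `e_n` of the modules
of highest weight `μ`. -/
theorem exists_frobenius (hodd : Odd l) : ∃ Fr : UB l →ₐ[B l] KostantB l, IsFrobenius l Fr ∧
    ∀ c, Fr (toUB l (torusBinom 0 c) (torusBinom_mem 0 c)) =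
      if l ∣ c then toKostantB l (binomH (c / l)) (binomH_mem _) else 0 := by
  have hl := NeZero.pos l
  choose ρ hE hF hT hK hKi using exists_rep_UB l hodd
  choose σ hX hY hH using exists_rep_KostantB l
  let ι : (ℕ →₀ B l) →ₗ[B l] (ℕ →₀ B l) := Finsupp.lmapDomain (B l) (B l) (l * ·)
  have hι1 : ∀ n, ι (Finsupp.single n 1) = Finsupp.single (l * n) 1 := fun n => Finsupp.mapDomain_single
  have hι : Function.Injective ι :=
    Finsupp.mapDomain_injective fun m n h => Nat.eq_of_mul_eq_mul_left hl h
  -- The graph of the Frobenius morphism: the pairs of elements that act in the same way.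
  let G : UB l → KostantB l → Prop := fun u k => ∀ μ y, ρ μ u (ι y) = ι (σ μ k y)
  have hG : ∀ {u k}, (∀ μ n, ρ μ u (Finsupp.single (l * n) 1) = ι (σ μ k (Finsupp.single n 1))) →
      G u k := by
    intro u k h μ y
    have : (ρ μ u).comp ι = ι.comp (σ μ k) := by
      ext1 n
      ext1
      simpa [hι1] using h μ n
    exact LinearMap.congr_fun this y
  have hmul : ∀ {u u' k k'}, G u k → G u' k' → G (u * u') (k * k') := fun h h' μ y => by
    rw [map_mul, map_mul, Module.End.mul_apply, Module.End.mul_apply, h', h]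
  have hadd : ∀ {u u' k k'}, G u k → G u' k' → G (u + u') (k + k') := fun h h' μ y => by
    rw [map_add, map_add, LinearMap.add_apply, LinearMap.add_apply, map_add, h, h']
  have halg : ∀ r : B l, G (algebraMap _ _ r) (algebraMap _ _ r) := fun r μ y => by
    rw [AlgHom.commutes, AlgHom.commutes, Module.algebraMap_end_apply, Module.algebraMap_end_apply,
      map_smul]
  have h0 : ∀ k, G 0 k → k = 0 := fun k hk => by
    refine KostantB_faithful l σ hX hY hH k fun μ n => hι ?_
    rw [← hk, map_zero, map_zero, LinearMap.zero_apply]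
  have GE : ∀ n, G (toUB l (divE n) (divE_mem n))
      (if l ∣ n then toKostantB l (divX (n / l)) (divX_mem _) else 0) := fun b => hG fun μ n => by
    rw [hE]
    split_ifs with h
    · obtain ⟨b, rfl⟩ := h
      rw [Nat.mul_div_cancel_left _ hl, hX, map_smul, hι1, Nat.mul_sub]
    · rw [map_zero, LinearMap.zero_apply, map_zero, zero_smul]
  have GF : ∀ n, G (toUB l (divF n) (divF_mem n))
      (if l ∣ n then toKostantB l (divY (n / l)) (divY_mem _) else 0) := fun b => hG fun μ n => by
    rw [hF]
    split_ifs with h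
    · obtain ⟨b, rfl⟩ := h
      rw [Nat.mul_div_cancel_left _ hl, hY, map_smul, hι1, Nat.mul_add]
    · rw [map_zero, LinearMap.zero_apply, map_zero, zero_smul]
  have GT : ∀ n, G (toUB l (torusBinom 0 n) (torusBinom_mem 0 n))
      (if l ∣ n then toKostantB l (binomH (n / l)) (binomH_mem _) else 0) := fun b => hG fun μ n => by
    rw [hT]
    split_ifs with h
    · obtain ⟨b, rfl⟩ := h
      rw [Nat.mul_div_cancel_left _ hl, hH, map_smul, hι1]
    · rw [map_zero, LinearMap.zero_apply, map_zero, zero_smul]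
  have GK : G (toUB l (stdGen .K) K_mem) 1 := hG fun μ n => by
    rw [hK, map_one, Module.End.one_apply, hι1]
  have GKi : G (toUB l (stdGen .Kinv) Kinv_mem) 1 := hG fun μ n => by
    rw [hKi, map_one, Module.End.one_apply, hι1]
  obtain ⟨Fr, hFr⟩ := exists_algHom_of_rel G hmul hadd halg (fun u => by
    have hu : u ∈ Algebra.adjoin (B l) _ := adjoin_UB l ▸ Algebra.mem_top
    induction hu using Algebra.adjoin_induction with
    | mem u hu =>
      obtain ((⟨n, rfl⟩ | ⟨n, rfl⟩) | rfl | rfl) := hu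
      exacts [⟨_, GE n⟩, ⟨_, GF n⟩, ⟨_, GK⟩, ⟨_, GKi⟩]
    | algebraMap r => exact ⟨_, halg r⟩
    | add u u' _ _ hu hu' => exact ⟨_, hadd hu.choose_spec hu'.choose_spec⟩
    | mul u u' _ _ hu hu' => exact ⟨_, hmul hu.choose_spec hu'.choose_spec⟩) h0
  have huniq : ∀ {u k}, G u k → Fr u = k := fun {u k} h => by
    have h1 : G u (Fr u - k + k) := by rw [sub_add_cancel]; exact hFr u
    have h2 : G 0 (Fr u - k) := fun μ y => by
      have := h1 μ y
      rw [map_add, LinearMap.add_apply, map_add, h μ y, right_eq_add] at this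
      rw [this, map_zero, LinearMap.zero_apply]
    exact sub_eq_zero.1 (h0 _ h2)
  exact ⟨Fr, ⟨fun n => huniq (GE n), fun n => huniq (GF n), huniq GK, huniq GKi⟩, fun c => huniq (GT c)⟩

end Frobenius

/-! ### The idempotent `κ` -/

section Kappa

variable {R S : Type*} [CommRing R] [CommRing S] [Algebra R S]

/-- The properties of the elements `[K; c, m]` of a commutative ring that survive the specialization
of `v` to `Q`. -/
structure IsTorusBinom (Q K : Sˣ) (t : ℤ → ℕ → S) : Prop where
  zero : ∀ c, t c 0 = 1
  left : ∀ (c : ℤ) (m : ℕ), ((Q ^ (m + 1 : ℤ) : Sˣ) - (Q ^ (-(m + 1) : ℤ) : Sˣ)) * t (c + 1) (m + 1) =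
    ((Q ^ (c + 1) : Sˣ) * K - (Q ^ (-(c + 1)) : Sˣ) * (K⁻¹ : Sˣ)) * t c m
  right : ∀ (c : ℤ) (m : ℕ), ((Q ^ (m + 1 : ℤ) : Sˣ) - (Q ^ (-(m + 1) : ℤ) : Sˣ)) * t c (m + 1) =
    t c m * ((Q ^ (c - m) : Sˣ) * K - (Q ^ (-(c - m)) : Sˣ) * (K⁻¹ : Sˣ))
  pascal : ∀ (c : ℤ) (m : ℕ), t (c + 1) (m + 1) =
    (Q ^ (-(m + 1) : ℤ) : Sˣ) * t c (m + 1) + (Q ^ (c - m) : Sˣ) * K * t c m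

lemma prod_range_sub_pow_succ [IsDomain R] {ζ : R} {m : ℕ} (h : IsPrimitiveRoot ζ (m + 1)) (z : S) :
    ∏ i ∈ range m, (z - algebraMap R S (ζ ^ (i + 1))) = ∑ j ∈ range (m + 1), z ^ j := by
  have h1 : ∏ i ∈ range m, (Polynomial.X - Polynomial.C (ζ ^ (i + 1))) =
      ∑ j ∈ range (m + 1), (Polynomial.X : Polynomial R) ^ j := by
    have h2 := prod_range_sub_pow_mul m.succ_pos
      (h.map_of_injective (f := Polynomial.C) Polynomial.C_injective) Polynomial.X 1
    rw [prod_range_succ', one_pow, ← mul_geom_sum, mul_comm, pow_zero, one_mul] at h2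
    simp only [mul_one, ← map_pow] at h2
    exact mul_left_cancel₀ (Polynomial.X_sub_C_ne_zero 1) (by simpa using h2)
  simpa using congr_arg (Polynomial.aeval z) h1

namespace IsTorusBinom

variable {Q K : Sˣ} {t : ℤ → ℕ → S}

/-- The sum telescopes: by the Pascal rule and the product formula for `[K; -1, m + 1]`, its last term
is the difference of two consecutive values of the right-hand side. -/
lemma sum_eq (h : IsTorusBinom Q K t) (m : ℕ) :
    ∑ i ∈ range (m + 1), (-1) ^ i * (t 0 i * ((Q ^ (i : ℤ) : Sˣ) + (Q ^ (-i : ℤ) : Sˣ) * K)) =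
      (-1) ^ m * ((1 + K) * t (-1) m) := by
  induction m with
  | zero => simp [h.zero]
  | succ m ih =>
    have h1 := h.right (-1) m
    have h2 := h.pascal (-1) m
    have h3 : ((Q ^ (m + 1 : ℤ) : Sˣ) : S) * (Q ^ (-(m + 1) : ℤ) : Sˣ) = 1 := by
      rw [← Units.val_mul, ← zpow_add, add_neg_cancel, zpow_zero, Units.val_one]
    have h4 := K.mul_inv
    rw [show (-1 - m : ℤ) = -(m + 1) by ring] at h1 h2
    rw [neg_neg] at h1
    rw [neg_add_cancel] at h2
    rw [sum_range_succ, ih, h2]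
    push_cast at *
    generalize ((Q ^ (m + 1 : ℤ) : Sˣ) : S) = a at *
    generalize ((Q ^ (-(m + 1) : ℤ) : Sˣ) : S) = a' at *
    generalize t (-1) (m + 1) = x at *
    generalize t (-1) m = y at *
    rw [pow_succ]
    linear_combination (-1) ^ m * (a' * K * h1 -
      (x + K * y + K * x + K * (K⁻¹ : Sˣ) * y) * h3 - y * h4)

/-- The product formula for `[K; -1, m]`, cleared of denominators and of negative powers of `Q` and `K`. -/
lemma prod_mul_pow_mul (h : IsTorusBinom Q K t) (m : ℕ) :
    (-1) ^ m * (∏ i ∈ range m, (1 - ((Q ^ 2) ^ (i + 1) : Sˣ) : S)) * ((K : S) ^ m * t (-1) m) =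
      ∏ i ∈ range m, ((K : S) ^ 2 - ((Q ^ 2) ^ (i + 1) : Sˣ)) := by
  induction m with
  | zero => simp [h.zero]
  | succ m ih =>
    have h1 := h.right (-1) m
    have h3 : ((Q ^ (m + 1 : ℤ) : Sˣ) : S) * (Q ^ (-(m + 1) : ℤ) : Sˣ) = 1 := by
      rw [← Units.val_mul, ← zpow_add, add_neg_cancel, zpow_zero, Units.val_one]
    have h4 := K.mul_inv
    have h5 : (((Q ^ 2) ^ (m + 1) : Sˣ) : S) = ((Q ^ (m + 1 : ℤ) : Sˣ) : S) ^ 2 := by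
      rw [← Units.val_pow_eq_pow_val, ← zpow_natCast (Q ^ (m + 1 : ℤ)), ← zpow_mul, ← pow_mul,
        ← zpow_natCast]
      congr 2
      push_cast
      ring
    rw [show (-1 - m : ℤ) = -(m + 1) by ring, neg_neg] at h1
    rw [prod_range_succ, prod_range_succ, ← ih, h5]
    generalize ((Q ^ (m + 1 : ℤ) : Sˣ) : S) = a at *
    generalize ((Q ^ (-(m + 1) : ℤ) : Sˣ) : S) = a' at *
    generalize t (-1) (m + 1) = x at *
    generalize t (-1) m = y at *
    generalize ∏ i ∈ range m, (1 - ((Q ^ 2) ^ (i + 1) : Sˣ) : S) = p at *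
    rw [pow_succ, pow_succ]
    linear_combination (-1) ^ m * p * (K : S) ^ m * (a * K * h1 +
      (K * x + y * K ^ 2) * h3 - a ^ 2 * y * h4)

variable {l : ℕ}

lemma left_pred (h : IsTorusBinom Q K t) (c : ℤ) {j : ℕ} (hj : 0 < j) :
    ((Q ^ (j : ℤ) : Sˣ) - (Q ^ (-j : ℤ) : Sˣ)) * t c j =
      ((Q ^ c : Sˣ) * K - (Q ^ (-c) : Sˣ) * (K⁻¹ : Sˣ)) * t (c - 1) (j - 1) := by
  obtain ⟨j, rfl⟩ : ∃ i, j = i + 1 := ⟨j - 1, by omega⟩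
  have h1 := h.left (c - 1) j
  rw [sub_add_cancel] at h1
  push_cast
  exact h1

/-- If `Qˡ = 1`, then `K² [K; -1, l - 1] = [K; -1, l - 1]`, since the product `(K - K⁻¹) [K; -1, l - 1]`
is `(Qˡ - Q⁻ˡ) [K; 0, l] = 0`. -/
lemma K_mul_K_mul (h : IsTorusBinom Q K t) (hl : 0 < l) (hQ : Q ^ l = 1) :
    (K : S) * (K * t (-1) (l - 1)) = t (-1) (l - 1) := by
  have h1 := h.left_pred 0 hl
  rw [zpow_neg, zpow_natCast, hQ, inv_one, sub_self, zero_mul, zero_sub, neg_zero, zpow_zero,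
    Units.val_one, one_mul, one_mul] at h1
  linear_combination -K * h1 + t (-1) (l - 1) * K.mul_inv

/-- `l [K; -1, l - 1]` is the sum of the powers of `K²`, because at a root of unity of order `l` both the
product of the `1 - Q^{2i}` and the product of the `K² - Q^{2i}`, for `0 < i < l`, are geometric sums. -/
lemma order_mul (h : IsTorusBinom Q K t) [IsDomain R] {q : Rˣ} (hqQ : Units.map (algebraMap R S).toMonoidHom q = Q)
    (hl : Odd l) (hq : IsPrimitiveRoot (q : R) l) :
    (l : S) * t (-1) (l - 1) = ∑ j ∈ range l, ((K : S) ^ 2) ^ j := by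
  have hqu : IsPrimitiveRoot q l := IsPrimitiveRoot.coe_units_iff.1 hq
  have hQl : Q ^ l = 1 := by rw [← hqQ, ← map_pow, hqu.pow_eq_one, map_one]
  have hK := h.K_mul_K_mul hl.pos hQl
  obtain ⟨n, rfl⟩ := hl
  have hζ : IsPrimitiveRoot ((q : R) ^ 2) (2 * n + 1) :=
    hq.pow_of_coprime 2 (by simp)
  have hc : ∀ i : ℕ, (((Q ^ 2) ^ (i + 1) : Sˣ) : S) = algebraMap R S (((q : R) ^ 2) ^ (i + 1)) := fun i => by
    rw [← hqQ, ← map_pow, ← map_pow, ← Units.val_pow_eq_pow_val, ← Units.val_pow_eq_pow_val]; rfl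
  have h1 := h.prod_mul_pow_mul (2 * n)
  simp only [hc] at h1
  rw [prod_range_sub_pow_succ hζ, prod_range_sub_pow_succ hζ, pow_mul, neg_one_sq, one_pow, one_mul] at h1
  have hK' : (K : S) * (K * t (-1) (2 * n)) = t (-1) (2 * n) := hK
  have hKn : ∀ k, (K : S) ^ (2 * k) * t (-1) (2 * n) = t (-1) (2 * n) := fun k => by
    induction k with
    | zero => simp
    | succ k ih => rw [mul_add, pow_add, mul_assoc, mul_one, pow_two, mul_assoc, hK', ih]
  rw [hKn] at h1
  rw [← h1]
  simp

/-- The element `κ = ½ (1 + K) [K; -1, l - 1]`, where `η = ½`. -/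
def _root_.QuantumSl2.torusKappa (η : S) (K : Sˣ) (t : ℤ → ℕ → S) (l : ℕ) : S :=
  η * ((1 + K) * t (-1) (l - 1))

variable (η : S)

lemma torusKappa_eq_sum (h : IsTorusBinom Q K t) (hl : Odd l) :
    torusKappa η K t l =
      η * ∑ i ∈ range l, (-1) ^ i * (t 0 i * ((Q ^ (i : ℤ) : Sˣ) + (Q ^ (-i : ℤ) : Sˣ) * K)) := by
  obtain ⟨n, rfl⟩ := hl
  rw [h.sum_eq, pow_mul, neg_one_sq, one_pow, one_mul]
  rfl

lemma K_mul_torusKappa (h : IsTorusBinom Q K t) (hl : 0 < l) (hQ : Q ^ l = 1) :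
    (K : S) * torusKappa η K t l = torusKappa η K t l := by
  rw [torusKappa]
  linear_combination η * h.K_mul_K_mul hl hQ

/-- The averaging formula `2 l κ = ∑ Kⁱ`, which identifies `κ` over the field of fractions. -/
lemma order_mul_torusKappa (h : IsTorusBinom Q K t) [IsDomain R] {q : Rˣ}
    (hqQ : Units.map (algebraMap R S).toMonoidHom q = Q) (hl : Odd l) (hq : IsPrimitiveRoot (q : R) l)
    {η : S} (hη : η * 2 = 1) :
    2 * (l : S) * torusKappa η K t l = ∑ i ∈ range (2 * l), (K : S) ^ i := by
  have h2 : ∀ n, ∑ i ∈ range (2 * n), (K : S) ^ i = (1 + K) * ∑ j ∈ range n, ((K : S) ^ 2) ^ j := fun n => by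
    induction n with
    | zero => simp
    | succ n ih => rw [mul_add, mul_one, sum_range_succ, sum_range_succ, ih, sum_range_succ, ← pow_mul]; ring
  rw [h2, ← h.order_mul hqQ hl hq, torusKappa]
  linear_combination (l : S) * (1 + K) * t (-1) (l - 1) * hη

/-- `[K; c, j] κ = 0` for `l ∣ c` and `l ∤ j`: up to the regular factor `qʲ - q⁻ʲ`, this is a multiple of
`(K - K⁻¹) κ = 0`. -/
lemma mul_torusKappa_eq_zero (h : IsTorusBinom Q K t) (hl : 0 < l) (hQ : Q ^ l = 1)
    (hreg : ∀ j : ℕ, ¬ l ∣ j → ∀ x : S, ((Q ^ (j : ℤ) : Sˣ) - (Q ^ (-j : ℤ) : Sˣ)) * x = 0 → x = 0)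
    {c : ℤ} (hc : (l : ℤ) ∣ c) {j : ℕ} (hj : ¬ l ∣ j) : t c j * torusKappa η K t l = 0 := by
  refine hreg j hj _ ?_
  have hj0 : 0 < j := Nat.pos_of_ne_zero fun h0 => hj (h0 ▸ dvd_zero l)
  have h1 := h.left_pred c hj0
  have hQc : Q ^ c = 1 := by
    obtain ⟨c, rfl⟩ := hc
    rw [zpow_mul, zpow_natCast, hQ, one_zpow]
  rw [zpow_neg Q c, hQc, inv_one, Units.val_one, one_mul, one_mul] at h1
  rw [← mul_assoc, h1]
  have h2 := h.K_mul_torusKappa η hl hQ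
  linear_combination t (c - 1) (j - 1) * ((1 + (K⁻¹ : Sˣ)) * h2 - torusKappa η K t l * K.mul_inv)

lemma map {S' : Type*} [CommRing S'] (f : S →+* S') (h : IsTorusBinom Q K t) :
    IsTorusBinom (Units.map f.toMonoidHom Q) (Units.map f.toMonoidHom K) (fun c m => f (t c m)) := by
  have hu : ∀ n : ℤ, (((Units.map f.toMonoidHom Q) ^ n : S'ˣ) : S') = f ((Q ^ n : Sˣ) : S) := fun n => by
    rw [← map_zpow]; rfl
  have hK : ((Units.map f.toMonoidHom K : S'ˣ) : S') = f K := rfl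
  have hK' : (((Units.map f.toMonoidHom K)⁻¹ : S'ˣ) : S') = f (K⁻¹ : Sˣ) := rfl
  constructor <;> intro c <;> [skip; intro m; intro m; intro m] <;>
    simp only [hu, hK, hK', ← map_mul, ← map_add, ← map_sub, ← map_one f] <;> congr 1
  exacts [h.zero c, h.left c m, h.right c m, h.pascal c m]

lemma of_injective {S' : Type*} [CommRing S'] {f : S →+* S'} (hf : Function.Injective f)
    (h : IsTorusBinom (Units.map f.toMonoidHom Q) (Units.map f.toMonoidHom K) (fun c m => f (t c m))) :
    IsTorusBinom Q K t := by
  have hu : ∀ n : ℤ, (((Units.map f.toMonoidHom Q) ^ n : S'ˣ) : S') = f ((Q ^ n : Sˣ) : S) := fun n => by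
    rw [← map_zpow]; rfl
  have hK : ((Units.map f.toMonoidHom K : S'ˣ) : S') = f K := rfl
  have hK' : (((Units.map f.toMonoidHom K)⁻¹ : S'ˣ) : S') = f (K⁻¹ : Sˣ) := rfl
  obtain ⟨h1, h2, h3, h4⟩ := h
  simp only [hu, hK, hK', ← map_mul, ← map_add, ← map_sub, ← map_one f] at h1 h2 h3 h4
  exact ⟨fun c => hf (h1 c), fun c m => hf (h2 c m), fun c m => hf (h3 c m), fun c m => hf (h4 c m)⟩

end IsTorusBinom

end Kappa

/-! ### The integral torus at the root of unity -/

/-- The relations hold in the torus over `ℚ(v)`, from which they descend to the integral torus and pass to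
its base change. -/
lemma isTorusBinom_quantum : IsTorusBinom
    (Units.map (algebraMap Qv (LaurentPolynomial Qv)).toMonoidHom vUnit) (unitT Qv) quantum.tb := by
  have hs := sub_inv_ne_zero_of_sq_ne_one (vUnit_pow_ne_one 2 (by norm_num))
  have hu : ∀ n : ℤ, (((Units.map (algebraMap Qv (LaurentPolynomial Qv)).toMonoidHom vUnit) ^ n :
      (LaurentPolynomial Qv)ˣ) : LaurentPolynomial Qv) =
      algebraMap Qv (LaurentPolynomial Qv) ((vUnit ^ n : Qvˣ) : Qv) := fun n => by
    rw [← map_zpow]; rfl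
  have hnum : ∀ n : ℤ, ((vUnit ^ n : Qvˣ) : Qv) - (vUnit ^ (-n) : Qvˣ) =
      ((vUnit : Qv) - (vUnit⁻¹ : Qvˣ)) * qNum vUnit n := fun n => by
    rw [qNum, mul_div_cancel₀ _ hs]
  have hwt : ∀ c : ℤ, algebraMap Qv (LaurentPolynomial Qv) ((vUnit ^ c : Qvˣ) : Qv) * (unitT Qv : LaurentPolynomial Qv) -
      algebraMap Qv (LaurentPolynomial Qv) ((vUnit ^ (-c) : Qvˣ) : Qv) * ((unitT Qv)⁻¹ : (LaurentPolynomial Qv)ˣ) =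
      ((vUnit : Qv) - (vUnit⁻¹ : Qvˣ)) • qWt vUnit c := fun c => by
    rw [qWt, smul_smul, mul_inv_cancel₀ hs, one_smul, Algebra.smul_def, Algebra.smul_def]
    rfl
  refine ⟨fun c => quantum.tb_zero c, fun c m => ?_, fun c m => ?_, fun c m => ?_⟩
  · rw [hu, hu, hu, hu, ← map_sub, hnum, hwt, ← Algebra.smul_def, mul_smul, smul_mul_assoc]
    congr 1
    exact quantum.num_smul_tb_left c m
  · rw [hu, hu, hu, hu, ← map_sub, hnum, hwt, ← Algebra.smul_def, mul_smul, mul_smul_comm]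
    congr 1
    exact quantum.num_smul_tb_right c m
  · rw [hu, hu, ← Algebra.smul_def, ← Algebra.smul_def]
    exact quantumTriple.tb_pascal _ c m

/-- The element `[K; c, m]` of the integral torus. -/
def tA (c : ℤ) (m : ℕ) : torusA := ⟨quantum.tb c m, isIntegral_torusA.tb_mem c m⟩

/-- The element `K` of the integral torus. -/
def KA : (torusA)ˣ where
  val := ⟨LaurentPolynomial.T 1, QuantumTriple.T_mem_intTorus (u := vA) rfl 1⟩
  inv := ⟨LaurentPolynomial.T (-1), QuantumTriple.T_mem_intTorus (u := vA) rfl (-1)⟩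
  val_inv := Subtype.ext (unitT Qv).mul_inv
  inv_val := Subtype.ext (unitT Qv).inv_mul

lemma isTorusBinom_tA : IsTorusBinom (Units.map (algebraMap A torusA).toMonoidHom vA) KA tA := by
  refine IsTorusBinom.of_injective (f := torusA.val.toRingHom) Subtype.val_injective ?_
  have h : Units.map torusA.val.toRingHom.toMonoidHom (Units.map (algebraMap A torusA).toMonoidHom vA) =
      Units.map (algebraMap Qv (LaurentPolynomial Qv)).toMonoidHom vUnit := Units.ext rfl
  have h' : Units.map torusA.val.toRingHom.toMonoidHom KA = unitT Qv := Units.ext rfl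
  rw [h, h']
  exact isTorusBinom_quantum

lemma exists_basis_torusA : ∃ b : Module.Basis (Bool × ℕ) A torusA, ∀ p, (b p : LaurentPolynomial Qv) = torusAElt p := by
  have h1 : LinearIndependent A torusAElt :=
    (quantumTriple.linearIndependent_torusBasis _ (R := A) (u := vA) rfl).restrict_scalars' A
  have h2 := quantumTriple.span_torusBasis_eq_intTorus vUnit_pow_ne_one (R := A) (u := vA) rfl
  exact ⟨(Module.Basis.span h1).map (LinearEquiv.ofEq _ _ h2), fun p => by
    rw [Module.Basis.map_apply, LinearEquiv.coe_ofEq_apply, Module.Basis.span_apply]⟩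

instance : Module.Free A torusA := .of_basis exists_basis_torusA.choose

section TorusB

variable (l : ℕ) [NeZero l]

/-- The base change to `ℬ` of the integral torus. -/
abbrev torusB : Type := B l ⊗[A] torusA

lemma torusB_smul_def (r : B l) (x : torusB l) : r • x = algebraMap (B l) (torusB l) r * x :=
  Algebra.smul_def r x

/-- The element `[K; c, m]` over `ℬ`. -/
def tB (c : ℤ) (m : ℕ) : torusB l := 1 ⊗ₜ tA c m

/-- The element `K` over `ℬ`. -/
def KB : (torusB l)ˣ := Units.map (Algebra.TensorProduct.includeRight (R := A) (A := B l)).toRingHom.toMonoidHom KA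

/-- The element `q` of `ℬ` as a unit of the torus. -/
def qB : (torusB l)ˣ := Units.map (algebraMap (B l) (torusB l)).toMonoidHom (q l)

lemma algebraMap_vA : algebraMap A (B l) (vA : A) = q l := by
  have := algebraMap_vA_zpow l 1
  rwa [zpow_one, zpow_one] at this

lemma isTorusBinom_tB : IsTorusBinom (qB l) (KB l) (tB l) := by
  have h := isTorusBinom_tA.map (S' := torusB l)
    (Algebra.TensorProduct.includeRight (R := A) (A := B l) (B := torusA) : torusA →+* torusB l)
  have hq : qB l = Units.map (Algebra.TensorProduct.includeRight (R := A) (A := B l) (B := torusA) :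
      torusA →+* torusB l).toMonoidHom (Units.map (algebraMap A torusA).toMonoidHom vA) := by
    ext
    change algebraMap (B l) (torusB l) (q l) =
      (Algebra.TensorProduct.includeRight (R := A) (A := B l) (B := torusA)) (algebraMap A torusA vA)
    rw [AlgHom.commutes, ← algebraMap_vA, ← IsScalarTower.algebraMap_apply]
  rw [hq]
  exact h

lemma coe_qB_zpow (n : ℤ) : ((qB l ^ n : (torusB l)ˣ) : torusB l) =
    algebraMap (B l) (torusB l) ((q l ^ n : (B l)ˣ) : B l) := by
  rw [qB, ← map_zpow]; rfl

lemma qB_pow : qB l ^ l = 1 := by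
  have h : q l ^ l = 1 := by
    have := (q_zpow_eq_one_iff l l).2 dvd_rfl
    rwa [zpow_natCast] at this
  rw [qB, ← map_pow, h, map_one]

lemma qB_regular (hodd : Odd l) (j : ℕ) (hj : ¬ l ∣ j) (x : torusB l)
    (hx : (((qB l ^ (j : ℤ) : (torusB l)ˣ) : torusB l) - (qB l ^ (-j : ℤ) : (torusB l)ˣ)) * x = 0) : x = 0 := by
  rw [coe_qB_zpow, coe_qB_zpow, ← map_sub, ← torusB_smul_def] at hx
  refine (smul_eq_zero.1 hx).resolve_left fun h => hj ?_
  have h1 : q l ^ (j : ℤ) = q l ^ (-j : ℤ) := Units.ext (sub_eq_zero.1 h)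
  have h2 : q l ^ ((2 * j : ℕ) : ℤ) = 1 := by
    rw [show ((2 * j : ℕ) : ℤ) = j - (-j) by push_cast; ring, zpow_sub, ← h1, mul_inv_cancel]
  rw [q_zpow_eq_one_iff] at h2
  exact (hodd.coprime_two_right).dvd_of_dvd_mul_left (by exact_mod_cast h2)

/-- The element `κ` of the torus over `ℬ`. -/
def kappaB : torusB l := torusKappa (algebraMap (B l) (torusB l) (half l)) (KB l) (tB l) l

lemma K_mul_kappaB : (KB l : torusB l) * kappaB l = kappaB l :=
  (isTorusBinom_tB l).K_mul_torusKappa _ (NeZero.pos l) (qB_pow l)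

lemma tB_mul_kappaB (hodd : Odd l) {c : ℤ} (hc : (l : ℤ) ∣ c) {j : ℕ} (hj : ¬ l ∣ j) :
    tB l c j * kappaB l = 0 :=
  (isTorusBinom_tB l).mul_torusKappa_eq_zero _ (NeZero.pos l) (qB_pow l) (qB_regular l hodd) hc hj

lemma kappaB_eq_sum (hodd : Odd l) : kappaB l = half l • ∑ i ∈ range l,
    (-1 : B l) ^ i • (tB l 0 i * (((q l ^ (i : ℤ) : (B l)ˣ) : B l) • 1 +
      ((q l ^ (-(i : ℤ)) : (B l)ˣ) : B l) • (KB l : torusB l))) := by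
  rw [kappaB, (isTorusBinom_tB l).torusKappa_eq_sum _ hodd, torusB_smul_def]
  congr 1
  refine sum_congr rfl fun i _ => ?_
  rw [coe_qB_zpow, coe_qB_zpow, torusB_smul_def, torusB_smul_def, torusB_smul_def, map_pow, map_neg,
    map_one, mul_one]

lemma two_mul_order_smul_kappaB (hodd : Odd l) :
    (2 * (l : B l)) • kappaB l = ∑ i ∈ range (2 * l), (KB l : torusB l) ^ i := by
  rw [← (isTorusBinom_tB l).order_mul_torusKappa (R := B l) (q := q l) rfl hodd (isPrimitiveRoot_q l)
    (η := algebraMap (B l) (torusB l) (half l)) (by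
      have := congr_arg (algebraMap (B l) (torusB l)) (half_mul_two l)
      rwa [map_mul, map_one, map_ofNat] at this), torusB_smul_def, map_mul, map_ofNat, map_natCast]
  rfl

end TorusB

/-! ### Relations in `U_ℬ` -/

/-- The inclusion of the integral torus into `U`. -/
def uT : torusA →ₐ[A] U :=
  ((quantum.tor.restrictScalars A).comp torusA.val).codRestrict U fun g => tor_mem_U g.2

/-- The automorphism `K ↦ v^{2c} K` of the integral torus. -/
def shiftA (c : ℤ) : torusA →ₐ[A] torusA :=
  (((scaleT (vUnit ^ (2 * c))).restrictScalars A).comp torusA.val).codRestrict torusA fun g =>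
    scaleT_mem_intTorus g.2 _

lemma coe_shiftA (c : ℤ) (g : torusA) : (shiftA c g : LaurentPolynomial Qv) = scaleT (vUnit ^ (2 * c)) g := rfl

lemma iterate_shift (n : ℕ) (g : LaurentPolynomial Qv) :
    (quantum.shift : LaurentPolynomial Qv → LaurentPolynomial Qv)^[n] g = scaleT (vUnit ^ (2 * (n : ℤ))) g := by
  induction n with
  | zero => simp [scaleT_one]
  | succ n ih =>
    rw [Function.iterate_succ_apply', ih]
    change scaleT (vUnit ^ (2 : ℤ)) _ = _
    rw [scaleT_scaleT, ← zpow_add]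
    congr 3
    push_cast
    ring

section UB

variable (l : ℕ) [NeZero l]

lemma torusB_mul_comm (x y : torusB l) : x * y = y * x := mul_comm x y

lemma torusB_mul_left_comm (x y z : torusB l) : x * (y * z) = y * (x * z) := mul_left_comm x y z

/-- The map from the torus over `ℬ` to `U_ℬ`. -/
def torB : torusB l →ₐ[B l] UB l := Algebra.TensorProduct.map (AlgHom.id (B l) (B l)) uT

lemma torB_tmul (b : B l) (g : torusA) : torB l (b ⊗ₜ g) = b ⊗ₜ uT g := rfl

/-- The automorphism `K ↦ q^{2c} K` of the torus over `ℬ`. -/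
def shiftB (c : ℤ) : torusB l →ₐ[B l] torusB l := Algebra.TensorProduct.map (AlgHom.id (B l) (B l)) (shiftA c)

lemma shiftB_tmul (c : ℤ) (b : B l) (g : torusA) : shiftB l c (b ⊗ₜ g) = b ⊗ₜ shiftA c g := rfl

lemma shiftB_shiftB (c d : ℤ) (y : torusB l) : shiftB l c (shiftB l d y) = shiftB l (c + d) y := by
  induction y using TensorProduct.induction_on with
  | zero => simp only [map_zero]
  | add x y hx hy => simp only [map_add, hx, hy]
  | tmul b g =>
    rw [shiftB_tmul, shiftB_tmul, shiftB_tmul]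
    congr 1
    ext1
    rw [coe_shiftA, coe_shiftA, coe_shiftA, scaleT_scaleT, ← zpow_add, mul_add]

lemma shiftB_zero (y : torusB l) : shiftB l 0 y = y := by
  induction y using TensorProduct.induction_on with
  | zero => simp only [map_zero]
  | add x y hx hy => simp only [map_add, hx, hy]
  | tmul b g =>
    rw [shiftB_tmul]
    congr 1
    ext1
    rw [coe_shiftA, mul_zero, zpow_zero, scaleT_one]

lemma shiftB_tB (c d : ℤ) (m : ℕ) : shiftB l c (tB l d m) = tB l (d + 2 * c) m := by
  rw [tB, shiftB_tmul, tB]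
  congr 1
  ext1
  rw [coe_shiftA]
  change scaleT _ (quantum.tb d m) = quantum.tb (d + 2 * c) m
  simp only [SlTwoDatum.tb, map_smul, map_prod]
  congr 1
  refine prod_congr rfl fun i _ => ?_
  change scaleT _ (qWt vUnit _) = qWt vUnit _
  rw [scaleT_qWt]
  congr 1
  ring

lemma shiftB_KB (c : ℤ) : shiftB l c (KB l) = ((q l ^ (2 * c) : (B l)ˣ) : B l) • (KB l : torusB l) := by
  change (1 : B l) ⊗ₜ[A] shiftA c (KA : torusA) = _ • ((1 : B l) ⊗ₜ[A] (KA : torusA))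
  have h : shiftA c (KA : torusA) = ((vA ^ (2 * c) : Aˣ) : A) • (KA : torusA) := by
    ext1
    rw [coe_shiftA]
    change scaleT _ (LaurentPolynomial.T 1) = ((vA ^ (2 * c) : Aˣ) : A) • (LaurentPolynomial.T 1 : LaurentPolynomial Qv)
    rw [scaleT_T, zpow_one, coe_vUnit_zpow_eq_algebraMap, algebraMap_smul]
  rw [h, TensorProduct.tmul_smul, ← algebraMap_vA_zpow, algebraMap_smul]

lemma two_mul_order_smul_shiftB_kappaB (hodd : Odd l) (c : ℤ) : (2 * (l : B l)) • shiftB l c (kappaB l) =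
    ∑ i ∈ range (2 * l), ((q l ^ (2 * c * i) : (B l)ˣ) : B l) • (KB l : torusB l) ^ i := by
  rw [← map_smul, two_mul_order_smul_kappaB l hodd, map_sum]
  refine sum_congr rfl fun i _ => ?_
  rw [map_pow, shiftB_KB, smul_pow, ← Units.val_pow_eq_pow_val, ← zpow_natCast (q l ^ (2 * c)), ← zpow_mul]

/-- `κ` depends on the weight modulo `l` only. -/
lemma shiftB_kappaB (hodd : Odd l) {c : ℤ} (hc : (l : ℤ) ∣ c) : shiftB l c (kappaB l) = kappaB l := by
  have h2 : (2 * (l : B l)) ≠ 0 := mul_ne_zero two_ne_zero (Nat.cast_ne_zero.2 (NeZero.ne l))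
  refine smul_right_injective _ h2 ?_
  change (2 * (l : B l)) • _ = (2 * (l : B l)) • _
  rw [two_mul_order_smul_shiftB_kappaB l hodd, two_mul_order_smul_kappaB l hodd]
  refine sum_congr rfl fun i _ => ?_
  rw [(q_zpow_eq_one_iff l _).2 (Dvd.dvd.mul_right (Dvd.dvd.mul_left hc 2) _), Units.val_one, one_smul]

/-- `E⁽ⁿ⁾` in `U_ℬ`. -/
abbrev EB (n : ℕ) : UB l := toUB l (divE n) (divE_mem n)

/-- `F⁽ⁿ⁾` in `U_ℬ`. -/
abbrev FB (n : ℕ) : UB l := toUB l (divF n) (divF_mem n)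

lemma toUB_mul {x y : UQv} (hx : x ∈ U) (hy : y ∈ U) :
    toUB l x hx * toUB l y hy = toUB l (x * y) (U.mul_mem hx hy) := by
  rw [toUB, toUB, Algebra.TensorProduct.tmul_mul_tmul, mul_one]; rfl

lemma toUB_congr {x y : UQv} (h : x = y) (hx : x ∈ U) : toUB l x hx = toUB l y (h ▸ hx) := by
  subst h; rfl

lemma toUB_smul {x : UQv} (a : A) (hx : x ∈ U) :
    toUB l (a • x) (U.smul_mem hx a) = algebraMap A (B l) a • toUB l x hx := by
  rw [algebraMap_smul, toUB, toUB, ← TensorProduct.tmul_smul]; rfl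

lemma torB_one_tmul (g : torusA) : torB l (1 ⊗ₜ g) = toUB l (quantum.tor g) (tor_mem_U g.2) := rfl

lemma torB_tB (c : ℤ) (m : ℕ) : torB l (tB l c m) = toUB l (torusBinom c m) (torusBinom_mem c m) :=
  (torB_one_tmul l (tA c m)).trans (toUB_congr l (quantum_tor_tb c m) _)

lemma torB_KB : torB l (KB l) = toUB l (stdGen .K) K_mem :=
  (torB_one_tmul l KA).trans (toUB_congr l quantum_tor_T_one _)

lemma EB_mul_EB (a b : ℕ) : EB l a * EB l b = algebraMap A (B l) (binA (a + b) a) • EB l (a + b) := by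
  rw [toUB_mul, ← toUB_smul]
  refine toUB_congr l ?_ _
  rw [← quantum_dE, ← quantum_dE, ← quantum_dE, SlTwoDatum.dE_mul_dE, ← algebraMap_binA, algebraMap_smul]

lemma FB_mul_FB (a b : ℕ) : FB l a * FB l b = algebraMap A (B l) (binA (a + b) a) • FB l (a + b) := by
  rw [toUB_mul, ← toUB_smul]
  refine toUB_congr l ?_ _
  rw [← quantum_dF, ← quantum_dF, ← quantum_dF, SlTwoDatum.dF_mul_dF, ← algebraMap_binA, algebraMap_smul]

lemma torB_mul_FB (n : ℕ) (y : torusB l) : torB l (shiftB l n y) * FB l n = FB l n * torB l y := by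
  induction y using TensorProduct.induction_on with
  | zero => simp only [map_zero, mul_zero, zero_mul]
  | add x y hx hy => simp only [map_add, mul_add, add_mul, hx, hy]
  | tmul b g =>
    rw [shiftB_tmul, torB_tmul, torB_tmul, FB, toUB, Algebra.TensorProduct.tmul_mul_tmul,
      Algebra.TensorProduct.tmul_mul_tmul, mul_one, one_mul]
    congr 1
    ext1
    change quantum.tor (scaleT (vUnit ^ (2 * (n : ℤ))) (g : LaurentPolynomial Qv)) * divF n = divF n * quantum.tor g
    rw [← quantum_dF, ← iterate_shift]
    exact quantum.tor_mul_dF _ n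

lemma torB_mul_EB (n : ℕ) (y : torusB l) : torB l y * EB l n = EB l n * torB l (shiftB l n y) := by
  induction y using TensorProduct.induction_on with
  | zero => simp only [map_zero, mul_zero, zero_mul]
  | add x y hx hy => simp only [map_add, mul_add, add_mul, hx, hy]
  | tmul b g =>
    rw [shiftB_tmul, torB_tmul, torB_tmul, EB, toUB, Algebra.TensorProduct.tmul_mul_tmul,
      Algebra.TensorProduct.tmul_mul_tmul, mul_one, one_mul]
    congr 1
    ext1
    change quantum.tor (g : LaurentPolynomial Qv) * divE n = divE n * quantum.tor (scaleT (vUnit ^ (2 * (n : ℤ))) g)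
    rw [← quantum_dE, ← iterate_shift]
    exact quantum.tor_mul_dE _ n

lemma EB_mul_torB (n : ℕ) (y : torusB l) : EB l n * torB l y = torB l (shiftB l (-n) y) * EB l n := by
  rw [torB_mul_EB, shiftB_shiftB, add_neg_cancel, shiftB_zero]

lemma torB_mul_FB' (n : ℕ) (y : torusB l) : torB l y * FB l n = FB l n * torB l (shiftB l (-n) y) := by
  rw [← torB_mul_FB, shiftB_shiftB, add_neg_cancel, shiftB_zero]

lemma EB_mul_FB (a b : ℕ) : EB l a * FB l b = ∑ t ∈ range (a + 1),
    if t ≤ b then FB l (b - t) * torB l (tB l (2 * t - a - b) t) * EB l (a - t) else 0 := by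
  have h : (⟨divE a, divE_mem a⟩ * ⟨divF b, divF_mem b⟩ : U) = ∑ t ∈ range (a + 1),
      if t ≤ b then ⟨divF (b - t), divF_mem _⟩ * uT (tA (2 * t - a - b) t) * ⟨divE (a - t), divE_mem _⟩
      else 0 := by
    apply Subtype.val_injective
    change divE a * divF b = U.val _
    rw [← quantum_dE, ← quantum_dF, SlTwoDatum.dE_mul_dF, map_sum]
    refine sum_congr rfl fun t ht => ?_
    have hta : t ≤ a := Nat.lt_succ_iff.1 (mem_range.1 ht)
    split_ifs with htb
    · rw [← Nat.cast_sub hta, ← Nat.cast_sub htb, SlTwoDatum.zE_natCast, SlTwoDatum.zF_natCast,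
        quantum_dE, quantum_dF]
      rfl
    · rw [SlTwoDatum.zF_of_neg _ (by omega), zero_mul, zero_mul, map_zero]
  have h1 := congr_arg (Algebra.TensorProduct.includeRight : U →ₐ[A] UB l) h
  rw [map_mul, map_sum] at h1
  refine Eq.trans h1 (sum_congr rfl fun t _ => ?_)
  split_ifs
  · rw [map_mul, map_mul]; rfl
  · exact map_zero _

/-- The element `κ` of `U_ℬ`. -/
def kappaU : UB l := torB l (kappaB l)

lemma kappaU_mul_kappaU_eq (y z : torusB l) :
    torB l (y * kappaB l) * torB l (z * kappaB l) = torB l (y * kappaB l * z * kappaB l) := by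
  rw [← map_mul, mul_assoc (y * _)]

lemma kappaU_mul_EB (hodd : Odd l) (n : ℕ) : kappaU l * EB l (l * n) = EB l (l * n) * kappaU l := by
  rw [kappaU, torB_mul_EB, shiftB_kappaB l hodd ⟨n, by push_cast; rfl⟩]

/-- The ideal of the torus generated by `κ`, in `U_ℬ`. -/
def kappaIdeal : Submodule (B l) (UB l) :=
  LinearMap.range ((torB l).toLinearMap ∘ₗ LinearMap.mulRight (B l) (kappaB l))

lemma torB_mul_kappaB_mem (y : torusB l) : torB l (y * kappaB l) ∈ kappaIdeal l := ⟨y, rfl⟩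

/-- The span of the elements `F⁽ˡᵃ⁾ y E⁽ˡᵇ⁾` with `y` in the ideal of the torus generated by `κ`. This is
the range of the splitting. -/
def splitRange : Submodule (B l) (UB l) :=
  Submodule.span (B l) {z | ∃ a, ∃ y ∈ kappaIdeal l, ∃ b, z = FB l (l * a) * y * EB l (l * b)}

/-- In the commutation formula for `E⁽ˡᵃ⁾ F⁽ˡᵇ⁾`, multiplied by `κ`, only the terms of index divisible by
`l` survive. -/
lemma EB_mul_FB_mul_mem (hodd : Odd l) (a b : ℕ) (x : UB l) (hx : x ∈ kappaIdeal l) :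
    EB l (l * a) * FB l (l * b) * x ∈ splitRange l := by
  obtain ⟨y, rfl⟩ := hx
  change _ * torB l (y * kappaB l) ∈ _
  rw [EB_mul_FB, sum_mul]
  refine Submodule.sum_mem _ fun t ht => ?_
  have hta : t ≤ l * a := Nat.lt_succ_iff.1 (mem_range.1 ht)
  split_ifs with htb
  -- Moving `κ` past `E⁽ˡᵃ⁻ᵗ⁾` shifts it by `t` modulo `l`, and the torus element of the formula is, by the
  -- same shift, the image of some `[K; c, t]` with `l ∣ c`, which annihilates `κ` unless `l ∣ t`.
  · have h1 : shiftB l (-(l * a - t : ℕ)) (kappaB l) = shiftB l t (kappaB l) := by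
      rw [← shiftB_kappaB l hodd (c := -(l * a)) ⟨-a, by ring⟩, shiftB_shiftB, shiftB_shiftB]
      rw [show (-((l * a - t : ℕ) : ℤ) + -(l * a)) = t + -(l * a) + -(l * a) by
        rw [Nat.cast_sub hta]; push_cast; ring, ← shiftB_shiftB, shiftB_kappaB l hodd ⟨-a, by ring⟩,
        ← shiftB_shiftB, shiftB_kappaB l hodd ⟨-a, by ring⟩]
    have h2 : tB l (2 * t - (l * a : ℕ) - (l * b : ℕ)) t = shiftB l t (tB l (-(l * a + l * b)) t) := by
      rw [shiftB_tB]
      congr 1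
      push_cast
      ring
    rw [mul_assoc, EB_mul_torB, ← mul_assoc, mul_assoc (FB l _), ← map_mul, map_mul (shiftB l _), h1, h2,
      torusB_mul_left_comm, ← map_mul (shiftB l t)]
    by_cases hlt : l ∣ t
    · obtain ⟨s, rfl⟩ := hlt
      rw [map_mul (shiftB l _), shiftB_kappaB l hodd (c := (l * s : ℕ)) ⟨s, by push_cast; ring⟩, ← mul_assoc,
        ← Nat.mul_sub, ← Nat.mul_sub]
      exact Submodule.subset_span ⟨_, _, torB_mul_kappaB_mem l _, _, rfl⟩
    · rw [tB_mul_kappaB l hodd ⟨-(a + b), by ring⟩ hlt]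
      simp only [map_zero, mul_zero, zero_mul]
      exact Submodule.zero_mem _
  · rw [zero_mul]
    exact Submodule.zero_mem _

/-- The range of the splitting is closed under multiplication, by the same triangularity argument that
makes the integral forms algebras. -/
lemma mul_mem_splitRange (hodd : Odd l) {z w : UB l} (hz : z ∈ splitRange l) (hw : w ∈ splitRange l) :
    z * w ∈ splitRange l := by
  refine mul_mem_span_triangular (E := fun n => EB l (l * n)) (F := fun n => FB l (l * n))
    (P := kappaIdeal l) (fun a b => ?_) (fun a b => ?_) ?_ ?_ (EB_mul_FB_mul_mem l hodd) hz hw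
  · exact ⟨_, by rw [mul_add]; exact EB_mul_EB l _ _⟩
  · exact ⟨_, by rw [mul_add]; exact FB_mul_FB l _ _⟩
  · rintro _ ⟨y, rfl⟩ _ ⟨z, rfl⟩
    change torB l (y * kappaB l) * torB l (z * kappaB l) ∈ _
    rw [kappaU_mul_kappaU_eq]
    exact torB_mul_kappaB_mem l _
  · rintro n _ ⟨y, rfl⟩
    refine ⟨_, torB_mul_kappaB_mem l (shiftB l (-(l * n : ℕ)) y), ?_⟩
    change torB l (y * kappaB l) * FB l (l * n) = _
    rw [torB_mul_FB', map_mul, shiftB_kappaB l hodd ⟨-n, by push_cast; ring⟩]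

/-- The ideal generated by `κ` in the torus is spanned by the elements `[K; 0, l c] κ`. -/
lemma kappaIdeal_le (hodd : Odd l) :
    kappaIdeal l ≤ Submodule.span (B l) (Set.range fun c => torB l (tB l 0 (l * c) * kappaB l)) := by
  obtain ⟨b, hb⟩ := exists_basis_torusA
  rintro _ ⟨y, rfl⟩
  have hy := (Algebra.TensorProduct.basis (B l) b).mem_span y
  induction hy using Submodule.span_induction with
  | zero => rw [map_zero]; exact Submodule.zero_mem _
  | add x y _ _ hx hy => rw [map_add]; exact Submodule.add_mem _ hx hy
  | smul r x _ hx => rw [map_smul]; exact Submodule.smul_mem _ r hx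
  | mem x hx =>
    obtain ⟨⟨d, c⟩, rfl⟩ := hx
    change torB l (_ * kappaB l) ∈ _
    have h1 : Algebra.TensorProduct.basis (B l) b (d, c) = (if d then (KB l : torusB l) else 1) * tB l 0 c := by
      rw [Algebra.TensorProduct.basis_apply]
      have h2 : b (d, c) = (if d then (KA : torusA) else 1) * tA 0 c := by
        ext1
        rw [hb]
        cases d <;> rfl
      rw [h2]
      change (Algebra.TensorProduct.includeRight : torusA →ₐ[A] torusB l) _ = _
      rw [map_mul, apply_ite (Algebra.TensorProduct.includeRight : torusA →ₐ[A] torusB l), map_one]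
      rfl
    have h3 : (if d then (KB l : torusB l) else 1) * tB l 0 c * kappaB l = tB l 0 c * kappaB l := by
      cases d
      · rw [if_neg Bool.false_ne_true, one_mul]
      · rw [if_pos rfl, torusB_mul_comm l (KB l), mul_assoc, K_mul_kappaB]
    rw [h1, h3]
    by_cases hc : l ∣ c
    · obtain ⟨c, rfl⟩ := hc
      exact Submodule.subset_span ⟨c, rfl⟩
    · rw [tB_mul_kappaB l hodd (dvd_zero _) hc, map_zero]
      exact Submodule.zero_mem _

end UB

/-! ### The splitting -/

section Splitting

variable (l : ℕ) [NeZero l]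

lemma divE_zero : divE 0 = 1 := by rw [← quantum_dE, SlTwoDatum.dE_zero]
lemma divF_zero : divF 0 = 1 := by rw [← quantum_dF, SlTwoDatum.dF_zero]
lemma divX_zero : divX 0 = 1 := by rw [← classical_dE, SlTwoDatum.dE_zero]
lemma divY_zero : divY 0 = 1 := by rw [← classical_dF, SlTwoDatum.dF_zero]
lemma binomH_zero : binomH 0 = 1 := by rw [← classical_tor_tb, SlTwoDatum.tb_zero, map_one]

lemma EB_zero : EB l 0 = 1 := toUB_congr l divE_zero _

lemma FB_zero : FB l 0 = 1 := toUB_congr l divF_zero _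

lemma tB_zero (c : ℤ) : tB l c 0 = 1 := (isTorusBinom_tB l).zero c

lemma toKostantB_eq_one {x : Env} (h : x = 1) (hx : x ∈ Kostant) : toKostantB l x hx = 1 := by
  subst h; rfl

lemma kappaU_eq_sum (hodd : Odd l) : kappaU l = half l • ∑ i ∈ range l,
    (-1 : B l) ^ i • (toUB l (torusBinom 0 i) (torusBinom_mem 0 i) *
      (((q l ^ (i : ℤ) : (B l)ˣ) : B l) • (1 : UB l) +
        ((q l ^ (-(i : ℤ)) : (B l)ˣ) : B l) • toUB l (stdGen .K) K_mem)) := by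
  rw [kappaU, kappaB_eq_sum l hodd, map_smul, map_sum]
  congr 1
  refine sum_congr rfl fun i _ => ?_
  rw [map_smul, map_mul, map_add, map_smul, map_smul, map_one, torB_tB, torB_KB]

/-- The elements `κ_j` of `U_q` come from `U_ℬ`: they are obtained from `κ` by the substitution
`K ↦ q^{-2j} K`. -/
lemma toUq_torB_shiftB_kappaB (hodd : Odd l) (j : ℤ) :
    toUq l (torB l (shiftB l (-j) (kappaB l))) = kappa l j := by
  have h2 : (2 * (l : Qq l)) ≠ 0 := by
    have : CharZero (Qq l) := charZero_of_injective_algebraMap (IsFractionRing.injective (B l) (Qq l))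
    exact mul_ne_zero two_ne_zero (Nat.cast_ne_zero.2 (NeZero.ne l))
  have h3 : ∀ x : UB l, toUq l ((2 * (l : B l)) • x) = (2 * (l : Qq l)) • toUq l x := fun x => by
    rw [map_smul, ← algebraMap_smul (Qq l) (2 * (l : B l)), map_mul, map_ofNat, map_natCast]
  rw [kappa, one_div, eq_inv_smul_iff₀ h2, ← h3, ← map_smul, two_mul_order_smul_shiftB_kappaB l hodd,
    map_sum, map_sum]
  refine sum_congr rfl fun i _ => ?_
  have h4 : ∀ x : UB l, toUq l (x ^ i) = toUq l x ^ i := fun x => by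
    change 1 ⊗ₜ[B l] (x ^ i) = (1 ⊗ₜ[B l] x) ^ i
    rw [Algebra.TensorProduct.tmul_pow, one_pow]
  rw [map_smul, map_smul, map_pow (torB l), h4, torB_KB, algebraMap_smul, mul_neg, neg_mul_eq_neg_mul]

/-- `Fr κ = 1`: in the formula of `kappaU_eq_sum` only the term of index `0` survives. -/
lemma map_kappaU (hodd : Odd l) {Fr : UB l →ₐ[B l] KostantB l} (hFr : IsFrobenius l Fr)
    (hT : ∀ c, Fr (toUB l (torusBinom 0 c) (torusBinom_mem 0 c)) =
      if l ∣ c then toKostantB l (binomH (c / l)) (binomH_mem _) else 0) : Fr (kappaU l) = 1 := by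
  have h0 : 0 ∈ range l := mem_range.2 (NeZero.pos l)
  rw [kappaU_eq_sum l hodd, map_smul, map_sum, sum_eq_single_of_mem 0 h0]
  · rw [map_smul, map_mul, map_add, map_smul, map_smul, map_one, hFr.map_K, hT, if_pos (dvd_zero l),
      toKostantB_eq_one l (by rw [Nat.zero_div, binomH_zero]), Nat.cast_zero, neg_zero, zpow_zero,
      Units.val_one, pow_zero, one_smul, one_smul, one_mul, one_add_one_eq_two]
    have := congr_arg (algebraMap (B l) (KostantB l)) (half_mul_two l)
    rwa [map_mul, map_one, map_ofNat, ← Algebra.smul_def] at this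
  · intro i hi hi0
    rw [map_smul, map_mul, hT, if_neg, zero_mul, smul_zero]
    exact Nat.not_dvd_of_pos_of_lt (Nat.pos_of_ne_zero hi0) (mem_range.1 hi)

/-- The splitting of the Frobenius morphism as a linear map, on the basis `Y^{[a]} binom(H, c) X^{[b]}`. -/
def splitLinear : KostantB l →ₗ[B l] UB l :=
  (basisKostantB l).constr (B l) fun p =>
    FB l (l * p.1.1) * torB l (tB l 0 (l * p.2) * kappaB l) * EB l (l * p.1.2)

lemma splitLinear_basis (a b c : ℕ) : splitLinear l (toKostantB l (divY a) (divY_mem _) *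
    toKostantB l (binomH c) (binomH_mem _) * toKostantB l (divX b) (divX_mem _)) =
      FB l (l * a) * torB l (tB l 0 (l * c) * kappaB l) * EB l (l * b) := by
  have h := basisKostantB_apply l ((a, b), c)
  rw [← h]
  exact (basisKostantB l).constr_basis _ _ _

lemma splitLinear_divX (hodd : Odd l) (i : ℕ) : splitLinear l (toKostantB l (divX i) (divX_mem i)) =
    EB l (l * i) * kappaU l := by
  have h := splitLinear_basis l 0 i 0
  rwa [toKostantB_eq_one l divY_zero, toKostantB_eq_one l binomH_zero, one_mul, one_mul, mul_zero, FB_zero,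
    one_mul, tB_zero, one_mul, ← kappaU, kappaU_mul_EB l hodd] at h

lemma splitLinear_divY (i : ℕ) : splitLinear l (toKostantB l (divY i) (divY_mem i)) =
    FB l (l * i) * kappaU l := by
  have h := splitLinear_basis l i 0 0
  rwa [toKostantB_eq_one l divX_zero, toKostantB_eq_one l binomH_zero, mul_one, mul_one, mul_zero, EB_zero,
    mul_one, tB_zero, one_mul, ← kappaU] at h

lemma splitLinear_binomH (i : ℕ) : splitLinear l (toKostantB l (binomH i) (binomH_mem i)) =
    toUB l (torusBinom 0 (l * i)) (torusBinom_mem _ _) * kappaU l := by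
  have h := splitLinear_basis l 0 0 i
  rwa [toKostantB_eq_one l divX_zero, toKostantB_eq_one l divY_zero, mul_one, one_mul, mul_zero, EB_zero,
    FB_zero, mul_one, one_mul, map_mul, torB_tB, ← kappaU] at h

lemma splitLinear_one : splitLinear l 1 = kappaU l := by
  have h := splitLinear_divY l 0
  rwa [toKostantB_eq_one l divY_zero, mul_zero, FB_zero, one_mul] at h

lemma frobenius_splitLinear (hodd : Odd l) {Fr : UB l →ₐ[B l] KostantB l} (hFr : IsFrobenius l Fr)
    (hT : ∀ c, Fr (toUB l (torusBinom 0 c) (torusBinom_mem 0 c)) =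
      if l ∣ c then toKostantB l (binomH (c / l)) (binomH_mem _) else 0) (x : KostantB l) :
    Fr (splitLinear l x) = x := by
  suffices h : Fr.toLinearMap ∘ₗ splitLinear l = LinearMap.id from LinearMap.congr_fun h x
  refine (basisKostantB l).ext fun p => ?_
  obtain ⟨⟨a, b⟩, c⟩ := p
  rw [LinearMap.comp_apply, basisKostantB_apply, splitLinear_basis, map_mul (torB l)]
  change Fr (_ * (_ * kappaU l) * _) = _
  rw [map_mul, map_mul, map_mul, map_kappaU l hodd hFr hT, torB_tB, hT, hFr.map_divE, hFr.map_divF]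
  simp only [dvd_mul_right, if_true, Nat.mul_div_cancel_left _ (NeZero.pos l), mul_one]
  rfl

lemma splitLinear_mem (x : KostantB l) : splitLinear l x ∈ splitRange l := by
  have hx := (basisKostantB l).mem_span x
  induction hx using Submodule.span_induction with
  | zero => rw [map_zero]; exact Submodule.zero_mem _
  | add x y _ _ hx hy => rw [map_add]; exact Submodule.add_mem _ hx hy
  | smul r x _ hx => rw [map_smul]; exact Submodule.smul_mem _ r hx
  | mem x hx =>
    obtain ⟨⟨⟨a, b⟩, c⟩, rfl⟩ := hx
    rw [basisKostantB_apply, splitLinear_basis]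
    exact Submodule.subset_span ⟨_, _, torB_mul_kappaB_mem l _, _, rfl⟩

lemma splitRange_le (hodd : Odd l) : splitRange l ≤ LinearMap.range (splitLinear l) := by
  refine Submodule.span_le.2 ?_
  rintro _ ⟨a, y, hy, b, rfl⟩
  have hy' := kappaIdeal_le l hodd hy
  clear hy
  change _ ∈ LinearMap.range (splitLinear l)
  induction hy' using Submodule.span_induction with
  | zero => rw [mul_zero, zero_mul]; exact Submodule.zero_mem _
  | add x y _ _ hx hy => rw [mul_add, add_mul]; exact Submodule.add_mem _ hx hy
  | smul r x _ hx => rw [mul_smul_comm, smul_mul_assoc]; exact Submodule.smul_mem _ r hx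
  | mem x hx => obtain ⟨c, rfl⟩ := hx; exact ⟨_, splitLinear_basis l a b c⟩

/-- The Frobenius morphism is inverse to the splitting on its range, which is closed under
multiplication; hence the splitting is multiplicative. -/
lemma splitLinear_mul (hodd : Odd l) (x y : KostantB l) :
    splitLinear l (x * y) = splitLinear l x * splitLinear l y := by
  obtain ⟨Fr, hFr, hT⟩ := exists_frobenius l hodd
  obtain ⟨z, hz⟩ := splitRange_le l hodd
    (mul_mem_splitRange l hodd (splitLinear_mem l x) (splitLinear_mem l y))
  have h := congr_arg Fr hz
  rw [map_mul, frobenius_splitLinear l hodd hFr hT, frobenius_splitLinear l hodd hFr hT,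
    frobenius_splitLinear l hodd hFr hT] at h
  rw [← h, hz]

/-- The splitting of the Frobenius morphism. -/
def split (hodd : Odd l) : KostantB l →ₙₐ[B l] UB l where
  toFun := splitLinear l
  map_smul' := map_smul (splitLinear l)
  map_zero' := map_zero (splitLinear l)
  map_add' := map_add (splitLinear l)
  map_mul' := splitLinear_mul l hodd

lemma nonUnitalAlgHom_ext {φ ψ : KostantB l →ₙₐ[B l] UB l}
    (hX : ∀ i, ψ (toKostantB l (divX i) (divX_mem i)) = φ (toKostantB l (divX i) (divX_mem i)))
    (hY : ∀ i, ψ (toKostantB l (divY i) (divY_mem i)) = φ (toKostantB l (divY i) (divY_mem i)))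
    (h1 : ψ 1 = φ 1) : ψ = φ := by
  ext x
  have hx : x ∈ Algebra.adjoin (B l) _ := adjoin_KostantB l ▸ Algebra.mem_top
  induction hx using Algebra.adjoin_induction with
  | mem x hx =>
    obtain ⟨n, rfl⟩ | ⟨n, rfl⟩ := hx
    exacts [hX n, hY n]
  | algebraMap r => rw [Algebra.algebraMap_eq_smul_one, map_smul, map_smul, h1]
  | add x y _ _ hx hy => rw [map_add, map_add, hx, hy]
  | mul x y _ _ hx hy => rw [map_mul, map_mul, hx, hy]

end Splitting

end QuantumSl2

end

open QuantumSl2 in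
theorem proposition2p1 (l : ℕ) [NeZero l] (hodd : Odd l) (hl : 1 < l) :
    -- `U_ℬ` is identified with its image in `U_q`
    Function.Injective (toUq l) ∧
    -- (i)
    (∀ j : ℤ, kappa l j ∈ Set.range (toUq l)) ∧
    -- the elements `[K; m]` and `binom(H, m)` belong to the integral forms
    ∃ (hK : ∀ m : ℕ, torusBinom 0 m ∈ U) (hH : ∀ m : ℕ, binomH m ∈ Kostant),
    -- the quantum Frobenius morphism
    ∃ Fr : UB l →ₐ[B l] KostantB l, IsFrobenius l Fr ∧
      (∀ Fr' : UB l →ₐ[B l] KostantB l, IsFrobenius l Fr' → Fr' = Fr) ∧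
    -- the element `κ = κ_0` of `U_ℬ`
    ∃ κ : UB l, toUq l κ = kappa l 0 ∧
      -- (ii)
      κ = half l • ∑ i ∈ Finset.range l,
        (-1 : B l) ^ i • (toUB l (torusBinom 0 i) (hK i) *
          (((q l ^ (i : ℤ) : (B l)ˣ) : B l) • (1 : UB l) +
            ((q l ^ (-(i : ℤ)) : (B l)ˣ) : B l) • toUB l (stdGen .K) K_mem)) ∧
      -- (iii)
      ∃ φ : KostantB l →ₙₐ[B l] UB l,
        ((∀ i : ℕ, φ (toKostantB l (divX i) (divX_mem i)) =
            toUB l (divE (l * i)) (divE_mem _) * κ) ∧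
          (∀ i : ℕ, φ (toKostantB l (divY i) (divY_mem i)) =
            toUB l (divF (l * i)) (divF_mem _) * κ) ∧
          φ 1 = κ ∧
          (∀ i : ℕ, φ (toKostantB l (binomH i) (hH i)) =
            toUB l (torusBinom 0 (l * i)) (hK _) * κ)) ∧
        (∀ x : KostantB l, Fr (φ x) = x) ∧
        (∀ ψ : KostantB l →ₙₐ[B l] UB l,
          (∀ i : ℕ, ψ (toKostantB l (divX i) (divX_mem i)) =
            toUB l (divE (l * i)) (divE_mem _) * κ) →
          (∀ i : ℕ, ψ (toKostantB l (divY i) (divY_mem i)) =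
            toUB l (divF (l * i)) (divF_mem _) * κ) →
          ψ 1 = κ → ψ = φ) := by
  obtain ⟨Fr, hFr, hT⟩ := exists_frobenius l hodd
  refine ⟨toUq_injective l, fun j => ⟨_, toUq_torB_shiftB_kappaB l hodd j⟩, torusBinom_mem 0, binomH_mem, Fr,
    hFr, fun _ => hFr.unique, kappaU l, ?_, kappaU_eq_sum l hodd, split l hodd,
    ⟨splitLinear_divX l hodd, splitLinear_divY l, splitLinear_one l, splitLinear_binomH l⟩,
    frobenius_splitLinear l hodd hFr hT, fun ψ hX hY h1 => nonUnitalAlgHom_ext l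
      (fun i => (hX i).trans (splitLinear_divX l hodd i).symm)
      (fun i => (hY i).trans (splitLinear_divY l i).symm) (h1.trans (splitLinear_one l).symm)⟩
  have h := toUq_torB_shiftB_kappaB l hodd 0
  rwa [neg_zero, shiftB_zero] at h
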